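/- Let $G$ be a finite directed graph (loops and multiple edges are allowed). A \emph{virtual graph diagram} of $G$ is a generic drawing of $G$ in the plane, in which the edges at each vertex leave it along distinct rays and the edges meet otherwise only in transverse double points (crossings) in their interiors; each crossing is either classical (one strand is marked as passing over the other) or virtual (no over/under information). A diagram without virtual crossings is called \emph{classical}. Two virtual graph diagrams of $G$ are \emph{virtually equivalent} if they are related by a finite sequence of planar isotopies, of the Reidemeister moves (I)--(V) of rigid vertex isotopy [(I) adding or removing a classical kink; (II) adding or removing two consecutive classical crossings of two strands, one strand being over at both; (III) moving a strand past a classical crossing of two others, all crossings classical and the three strands lying at three different heights; (IV) moving a strand over, or under, a vertex and the edges at it; (V) turning a vertex over, which reverses the order of the edges at it and adds a classical half twist of these edges], and of the virtual moves (I*)--(V*) [(I*)--(IV*) are (I)--(IV) with all the crossings involved virtual; (V*) moves a strand having only virtual crossings past a classical crossing of two other strands]. The \emph{Gauss code} of a virtual graph diagram records, for each edge, the sequence of classical crossings met along the edge in its direction, each with its symbol, with the information whether it is passed over or under, and with its sign, and, for each vertex, the cyclic order (clockwise in the plane) of the half-edges around it; virtual crossings are ignored. Gauss codes are regarded as equal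 if they differ only in the names of the crossings. A Gauss code for $G$ is \emph{realizable} (planar) if it is the Gauss code of some classical graph diagram of $G$. \textbf{Corollary.} If a virtual graph diagram $D$ of $G$ has a realizable Gauss code, then $D$ is virtually equivalent to a classical graph diagram of $G$. -/

import Mathlib

/-!
Virtual spatial graph diagrams in the plane, in Morse position.

A plane diagram in general position with respect to the height function is cut by horizontal
lines into finitely many slices, each containing exactly one elementary event: a local minimum,
a local maximum, a crossing, or a vertex (drawn with all its half-edges leaving upwards).
A diagram is recorded as the list of these slices, from bottom to top.  Planar isotopy is
generated by the relations `PlanarMove` below: events at different places can be interchanged,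
wiggles can be straightened, and crossings and vertices can be rotated.
-/

namespace VirtualGraph

/-- A directed graph with vertex set `V` and edge set `E`; loops and parallel edges are allowed. -/
structure DirectedGraph (V E : Type*) where
  src : E → V
  tgt : E → V

/-- `(e, false)` is the initial and `(e, true)` the final half of the edge `e`. -/
abbrev HalfEdge (E : Type*) := E × Bool

/-- The vertex at which a half-edge is attached. -/
def DirectedGraph.vert {V E : Type*} (G : DirectedGraph V E) : HalfEdge E → V
  | (e, false) => G.src e
  | (e, true) => G.tgt e

/-- The kinds of crossings of a strand `/` (lower left to upper right) with a strand
`\` (lower right to upper left). -/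
inductive Kind
  /-- classical crossing, the strand `/` passes over -/
  | slash
  /-- classical crossing, the strand `\` passes over -/
  | backslash
  /-- virtual crossing, no over/under information -/
  | virtual

/-- Exchange the roles of `/` and `\`. -/
def Kind.flip : Kind → Kind
  | slash => backslash
  | backslash => slash
  | virtual => virtual

/-- The elementary events of a diagram. -/
inductive Event (V E : Type*)
  /-- a local minimum: two neighbouring strands are born -/
  | cup
  /-- a local maximum: two neighbouring strands end -/
  | cap
  /-- two neighbouring strands cross -/
  | cross (k : Kind)
  /-- the vertex `v`, with its half-edges leaving upwards, listed from left to right -/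
  | vertex (v : V) (legs : List (HalfEdge E))

/-- The number of strands entering an event from below. -/
def Event.bot {V E : Type*} : Event V E → ℕ
  | cup => 0
  | cap => 2
  | cross _ => 2
  | vertex _ _ => 0

/-- The number of strands leaving an event upwards. -/
def Event.top {V E : Type*} : Event V E → ℕ
  | cup => 2
  | cap => 0
  | cross _ => 2
  | vertex _ legs => legs.length

/-- A slice: an event together with the number `pos` of strands to the left of it.
All strands to the left and to the right of the event run straight up. -/
structure Slice (V E : Type*) where
  pos : ℕ
  ev : Event V E

/-- A list of slices, from bottom to top. -/
abbrev Word (V E : Type*) := List (Slice V E)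

/-- The number of strands at level `t`, that is, just below the slice number `t`
(there is no strand at the bottom level). -/
def Word.width {V E : Type*} (w : Word V E) (t : ℕ) : ℕ :=
  (w.take t).foldl (fun k s => k - s.ev.bot + s.ev.top) 0

/-- A traveller on a diagram: at level `level`, on the strand number `pos` from the left
(starting with `0`), looking upwards or downwards. -/
structure Loc where
  level : ℕ
  pos : ℕ
  up : Bool

/-- What happens to the traveller when it moves through the slice in front of it. -/
inductive Next (E : Type*)
  /-- it gets to `l`; `passed` is the list of classical crossings passed on the way (at most one):
  the crossing is named by the number of its slice, and the Boolean is `true` when the traveller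
  is on the upper strand of it -/
  | go (l : Loc) (passed : List (ℕ × Bool))
  /-- it reaches a vertex through the half-edge `h` -/
  | arrive (h : HalfEdge E)
  /-- it leaves the diagram -/
  | off

/-- The record made when passing a crossing of kind `k` in slice `t`; `onSlash` tells whether
one passes on the strand `/`. -/
def Kind.record (k : Kind) (t : ℕ) (onSlash : Bool) : List (ℕ × Bool) :=
  match k with
  | slash => [(t, onSlash)]
  | backslash => [(t, !onSlash)]
  | virtual => []

/-- Moving up through slice number `t`, from position `i` below it. -/
def Slice.goUp {V E : Type*} (s : Slice V E) (t i : ℕ) : Next E :=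
  if i < s.pos then .go ⟨t + 1, i, true⟩ []
  else if s.pos + s.ev.bot ≤ i then .go ⟨t + 1, i - s.ev.bot + s.ev.top, true⟩ []
  else match s.ev with
    | .cap => .go ⟨t, 2 * s.pos + 1 - i, false⟩ []
    | .cross k => .go ⟨t + 1, 2 * s.pos + 1 - i, true⟩ (k.record t (i == s.pos))
    | _ => .off

/-- Moving down through slice number `t`, from position `i` above it. -/
def Slice.goDown {V E : Type*} (s : Slice V E) (t i : ℕ) : Next E :=
  if i < s.pos then .go ⟨t, i, false⟩ []
  else if s.pos + s.ev.top ≤ i then .go ⟨t, i - s.ev.top + s.ev.bot, false⟩ []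
  else match s.ev with
    | .cup => .go ⟨t + 1, 2 * s.pos + 1 - i, true⟩ []
    | .cross k => .go ⟨t, 2 * s.pos + 1 - i, false⟩ (k.record t (i == s.pos + 1))
    | .vertex _ legs => match legs[i - s.pos]? with
      | some h => .arrive h
      | none => .off
    | .cap => .off

/-- One step of the traveller.  At level `t` it has slice `t` above and slice `t - 1` below. -/
def Word.next {V E : Type*} (w : Word V E) : Loc → Next E
  | ⟨t, i, true⟩ => match w[t]? with
    | some s => s.goUp t i
    | none => .off
  | ⟨0, _, false⟩ => .off
  | ⟨t + 1, i, false⟩ => match w[t]? with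
    | some s => s.goDown t i
    | none => .off

/-- `l'` is reached from `l` by following the strand of `l` without passing through vertices. -/
def Word.Reaches {V E : Type*} (w : Word V E) : Loc → Loc → Prop :=
  Relation.ReflTransGen (fun l l' => ∃ es, w.next l = .go l' es)

/-- `Walk w l es h`: following the strand from `l`, one passes the classical crossings
listed in `es`, in this order, and then reaches a vertex through the half-edge `h`. -/
inductive Word.Walk {V E : Type*} (w : Word V E) : Loc → List (ℕ × Bool) → HalfEdge E → Prop
  | arrive {l : Loc} {h : HalfEdge E} : w.next l = .arrive h → Walk w l [] h
  | go {l l' : Loc} {es es' : List (ℕ × Bool)} {h : HalfEdge E} :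
      w.next l = .go l' es → Walk w l' es' h → Walk w l (es ++ es') h

/-- The location `l` is the beginning of the half-edge `h`, next to its vertex and looking away
from it. -/
def Word.IsStart {V E : Type*} (w : Word V E) (h : HalfEdge E) (l : Loc) : Prop :=
  ∃ t p v legs j, w[t]? = some ⟨p, .vertex v legs⟩ ∧ legs[j]? = some h ∧ l = ⟨t + 1, p + j, true⟩

/-- The curve leaving through the first half of `e` arrives through the second half of `e`,
after having passed the classical crossings `es`. -/
def Word.Traces {V E : Type*} (w : Word V E) (e : E) (es : List (ℕ × Bool)) : Prop :=
  ∃ l, w.IsStart (e, false) l ∧ w.Walk l es (e, true)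

/-- The edge `e`, followed along its direction, passes through `l`. -/
def Word.Visits {V E : Type*} (w : Word V E) (e : E) (l : Loc) : Prop :=
  ∃ l₀, w.IsStart (e, false) l₀ ∧ w.Reaches l₀ l

/-- A virtual graph diagram of the directed graph `G`. -/
structure Diagram {V E : Type*} (G : DirectedGraph V E) where
  word : Word V E
  /-- each event finds the strands it needs -/
  fits : ∀ (t : ℕ) (s : Slice V E), word[t]? = some s → s.pos + s.ev.bot ≤ word.width t
  /-- no strand is left at the top -/
  closed : word.width word.length = 0
  /-- each vertex of the graph is drawn exactly once -/
  vertex_once : ∀ v : V, ∃! t : ℕ, ∃ (p : ℕ) (legs : List (HalfEdge E)),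
    word[t]? = some ⟨p, .vertex v legs⟩
  /-- the half-edges leaving a drawn vertex are those of the graph, each once -/
  legs_spec : ∀ (t p : ℕ) (v : V) (legs : List (HalfEdge E)),
    word[t]? = some ⟨p, .vertex v legs⟩ →
    legs.Nodup ∧ ∀ h, h ∈ legs ↔ G.vert h = v
  /-- each edge is drawn as a curve from its initial to its final half -/
  traced : ∀ e : E, ∃ es, word.Traces e es
  /-- every strand of the diagram belongs to an edge of the graph (there are no free circles) -/
  covered : ∀ t i, i < word.width t → ∃ e b, word.Visits e ⟨t, i, b⟩

/-- A classical diagram is one without virtual crossings. -/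
def Diagram.IsClassical {V E : Type*} {G : DirectedGraph V E} (D : Diagram G) : Prop :=
  ∀ s ∈ D.word, s.ev ≠ .cross .virtual

/-! ### Gauss codes -/

/-- The list of crossings along a curve is determined by the beginning of the curve. -/
theorem Word.Walk.unique {V E : Type*} {w : Word V E} {l : Loc} {es es' : List (ℕ × Bool)}
    {h h' : HalfEdge E} (a : w.Walk l es h) (b : w.Walk l es' h') : es = es' ∧ h = h' := by
  induction a generalizing es' with
  | arrive e =>
    cases b with
    | arrive f => rw [e] at f; cases f; exact ⟨rfl, rfl⟩
    | go f _ => rw [e] at f; cases f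
  | go e _ ih =>
    cases b with
    | arrive f => rw [e] at f; cases f
    | go f k =>
      rw [e] at f
      cases f
      obtain ⟨h1, h2⟩ := ih k
      exact ⟨by rw [h1], h2⟩

/-- Every half-edge of a diagram has only one beginning. -/
theorem Diagram.isStart_unique {V E : Type*} {G : DirectedGraph V E} (D : Diagram G)
    {h : HalfEdge E} {l l' : Loc} (a : D.word.IsStart h l) (b : D.word.IsStart h l') :
    l = l' := by
  obtain ⟨t, p, v, legs, j, h1, h2, rfl⟩ := a
  obtain ⟨t', p', v', legs', j', h1', h2', rfl⟩ := b
  have hv : G.vert h = v := ((D.legs_spec _ _ _ _ h1).2 h).1 (List.mem_of_getElem? h2)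
  have hv' : G.vert h = v' := ((D.legs_spec _ _ _ _ h1').2 h).1 (List.mem_of_getElem? h2')
  subst hv
  subst hv'
  obtain rfl : t = t' := (D.vertex_once _).unique ⟨p, legs, h1⟩ ⟨p', legs', h1'⟩
  rw [h1] at h1'
  cases h1'
  have hj : j = j' := by
    obtain ⟨hl, e1⟩ := List.getElem?_eq_some_iff.1 h2
    obtain ⟨hl', e2⟩ := List.getElem?_eq_some_iff.1 h2'
    exact (D.legs_spec _ _ _ _ h1).1.getElem_inj_iff.1 (e1.trans e2.symm)
  rw [hj]

/-- The list of crossings along an edge is well defined. -/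
theorem Diagram.traces_unique {V E : Type*} {G : DirectedGraph V E} (D : Diagram G) {e : E}
    {es es' : List (ℕ × Bool)} (a : D.word.Traces e es) (b : D.word.Traces e es') : es = es' := by
  obtain ⟨l, h1, h2⟩ := a
  obtain ⟨l', h1', h2'⟩ := b
  obtain rfl := D.isStart_unique h1 h1'
  exact (h2.unique h2').1

/-- One entry of a Gauss code: the symbol of a crossing, whether it is passed as an over-crossing,
and whether the crossing is positive. -/
structure Entry where
  symbol : ℕ
  isOver : Bool
  positive : Bool

/-- A Gauss code for a graph with vertices `V` and edges `E`: the sequence of crossings along each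
edge and the cyclic (clockwise) order of the half-edges around each vertex. -/
structure GaussCode (V E : Type*) where
  along : E → List Entry
  order : V → Cycle (HalfEdge E)

/-- Two Gauss codes are the same if they differ in the names of the crossings only. -/
def GaussCode.Same {V E : Type*} (C C' : GaussCode V E) : Prop :=
  (∃ σ : Equiv.Perm ℕ, ∀ e, C'.along e = (C.along e).map fun x => { x with symbol := σ x.symbol }) ∧
    ∀ v, C'.order v = C.order v

open Classical in
/-- The sign of the classical crossing in slice `t`, `true` for a positive one.  The crossing is
positive if the direction of the upper strand is turned counterclockwise, by less than a straight
angle, to the direction of the lower strand: if `/` is on top, this is so when the two strands both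
run upwards or both run downwards; if `\` is on top, when just one of them runs upwards. -/
noncomputable def Diagram.sign {V E : Type*} {G : DirectedGraph V E} (D : Diagram G) (t : ℕ) :
    Bool :=
  match D.word[t]? with
  | some ⟨p, .cross .slash⟩ => decide
      ((∃ e, D.word.Visits e ⟨t, p, true⟩) ↔ (∃ e, D.word.Visits e ⟨t, p + 1, true⟩))
  | some ⟨p, .cross .backslash⟩ => decide
      (¬ ((∃ e, D.word.Visits e ⟨t, p, true⟩) ↔ (∃ e, D.word.Visits e ⟨t, p + 1, true⟩)))
  | _ => false

/-- The Gauss code of a virtual graph diagram; virtual crossings are ignored. -/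
noncomputable def Diagram.gaussCode {V E : Type*} {G : DirectedGraph V E} (D : Diagram G) :
    GaussCode V E where
  along e := (D.traced e).choose.map fun x => ⟨x.1, x.2, D.sign x.1⟩
  order v := ((D.vertex_once v).exists.choose_spec.choose_spec.choose : List (HalfEdge E))

/-- A Gauss code is realizable (planar) if it is the code of a classical diagram. -/
def GaussCode.Realizable {V E : Type*} (G : DirectedGraph V E) (C : GaussCode V E) : Prop :=
  ∃ D : Diagram G, D.IsClassical ∧ D.gaussCode.Same C

/-! ### Moves

All moves are given for parts of diagrams, up to reading them from right to left. -/

/-- The strand at position `p` crosses the `n` strands to the right of it. -/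
def passRight {V E : Type*} (k : Kind) (p n : ℕ) : Word V E :=
  (List.range n).map fun i => ⟨p + i, .cross k⟩

/-- A half twist of the `n` strands at the positions `p, …, p + n - 1`. -/
def halfTwist {V E : Type*} (k : Kind) (p : ℕ) : ℕ → Word V E
  | 0 => []
  | n + 1 => passRight k p n ++ halfTwist k p n

/-- Planar isotopy. -/
inductive PlanarMove {V E : Type*} : Word V E → Word V E → Prop
  /-- two events, one to the right of the other with `r` strands between them, change heights -/
  | interchange (p r : ℕ) (x y : Event V E) :
      PlanarMove [⟨p, x⟩, ⟨p + x.top + r, y⟩] [⟨p + x.bot + r, y⟩, ⟨p, x⟩]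
  | zigzag_left (p : ℕ) : PlanarMove [⟨p + 1, .cup⟩, ⟨p, .cap⟩] []
  | zigzag_right (p : ℕ) : PlanarMove [⟨p, .cup⟩, ⟨p + 1, .cap⟩] []
  /-- a crossing is rotated by a right angle -/
  | rotate_cross (p : ℕ) (k : Kind) :
      PlanarMove [⟨p + 2, .cup⟩, ⟨p + 1, .cross k⟩, ⟨p, .cap⟩] [⟨p, .cross k.flip⟩]
  | rotate_cross' (p : ℕ) (k : Kind) :
      PlanarMove [⟨p, .cup⟩, ⟨p + 1, .cross k⟩, ⟨p + 2, .cap⟩] [⟨p, .cross k.flip⟩]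
  /-- the rightmost half-edge at a vertex is brought to the left below the vertex -/
  | rotate_vertex (p : ℕ) (v : V) (h : HalfEdge E) (hs : List (HalfEdge E)) :
      PlanarMove [⟨p, .cup⟩, ⟨p + 1, .vertex v (hs ++ [h])⟩, ⟨p + 1 + hs.length, .cap⟩]
        [⟨p, .vertex v (h :: hs)⟩]
  /-- the leftmost half-edge at a vertex is brought to the right below the vertex -/
  | rotate_vertex' (p : ℕ) (v : V) (h : HalfEdge E) (hs : List (HalfEdge E)) :
      PlanarMove [⟨p, .cup⟩, ⟨p + 1, .vertex v (h :: hs)⟩, ⟨p, .cap⟩]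
        [⟨p, .vertex v (hs ++ [h])⟩]

/-- The Reidemeister moves (I) - (V) for rigid vertex isotopy of classical diagrams. -/
inductive ClassicalMove {V E : Type*} : Word V E → Word V E → Prop
  | I_right (p : ℕ) (k : Kind) (hk : k ≠ .virtual) :
      ClassicalMove [⟨p + 1, .cup⟩, ⟨p, .cross k⟩, ⟨p + 1, .cap⟩] []
  | I_left (p : ℕ) (k : Kind) (hk : k ≠ .virtual) :
      ClassicalMove [⟨p, .cup⟩, ⟨p + 1, .cross k⟩, ⟨p, .cap⟩] []
  | II (p : ℕ) (k : Kind) (hk : k ≠ .virtual) :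
      ClassicalMove [⟨p, .cross k⟩, ⟨p, .cross k.flip⟩] []
  /-- The last hypothesis says that one of the three strands is on top of the two others, and
  one below them. -/
  | III (p : ℕ) (k₁ k₂ k₃ : Kind) (h₁ : k₁ ≠ .virtual) (h₂ : k₂ ≠ .virtual) (h₃ : k₃ ≠ .virtual)
      (h : k₁ = k₂ ∨ k₂ = k₃) :
      ClassicalMove [⟨p, .cross k₁⟩, ⟨p + 1, .cross k₂⟩, ⟨p, .cross k₃⟩]
        [⟨p + 1, .cross k₃⟩, ⟨p, .cross k₂⟩, ⟨p + 1, .cross k₁⟩]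
  /-- a strand is moved over or under a vertex -/
  | IV (p : ℕ) (k : Kind) (hk : k ≠ .virtual) (v : V) (legs : List (HalfEdge E)) :
      ClassicalMove (⟨p + 1, .vertex v legs⟩ :: passRight k p legs.length) [⟨p, .vertex v legs⟩]
  /-- a vertex is turned over, together with the half-edges at it -/
  | V (p : ℕ) (k : Kind) (hk : k ≠ .virtual) (v : V) (legs : List (HalfEdge E)) :
      ClassicalMove (⟨p, .vertex v legs⟩ :: halfTwist k p legs.length)
        [⟨p, .vertex v legs.reverse⟩]

/-- The moves (I*) - (V*) with virtual crossings. -/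
inductive VirtualMove {V E : Type*} : Word V E → Word V E → Prop
  | I_right (p : ℕ) :
      VirtualMove [⟨p + 1, .cup⟩, ⟨p, .cross .virtual⟩, ⟨p + 1, .cap⟩] []
  | I_left (p : ℕ) :
      VirtualMove [⟨p, .cup⟩, ⟨p + 1, .cross .virtual⟩, ⟨p, .cap⟩] []
  | II (p : ℕ) : VirtualMove [⟨p, .cross .virtual⟩, ⟨p, .cross .virtual⟩] []
  | III (p : ℕ) :
      VirtualMove [⟨p, .cross .virtual⟩, ⟨p + 1, .cross .virtual⟩, ⟨p, .cross .virtual⟩]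
        [⟨p + 1, .cross .virtual⟩, ⟨p, .cross .virtual⟩, ⟨p + 1, .cross .virtual⟩]
  /-- a strand with virtual crossings only is moved across a vertex -/
  | IV (p : ℕ) (v : V) (legs : List (HalfEdge E)) :
      VirtualMove (⟨p + 1, .vertex v legs⟩ :: passRight .virtual p legs.length)
        [⟨p, .vertex v legs⟩]
  /-- a strand with virtual crossings only is moved across a classical crossing -/
  | V (p : ℕ) (k : Kind) (hk : k ≠ .virtual) :
      VirtualMove [⟨p, .cross k⟩, ⟨p + 1, .cross .virtual⟩, ⟨p, .cross .virtual⟩]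
        [⟨p + 1, .cross .virtual⟩, ⟨p, .cross .virtual⟩, ⟨p + 1, .cross k⟩]

/-- `D'` is obtained from `D` by one move inside a part of the diagram. -/
def Diagram.Move {V E : Type*} {G : DirectedGraph V E} (D D' : Diagram G) : Prop :=
  ∃ a b L R : Word V E, (PlanarMove L R ∨ ClassicalMove L R ∨ VirtualMove L R) ∧
    D.word = a ++ L ++ b ∧ D'.word = a ++ R ++ b

/-- Virtual equivalence of virtual graph diagrams: the equivalence relation generated by planar
isotopy and the moves (I) - (V) and (I*) - (V*). -/
def VirtuallyEquivalent {V E : Type*} {G : DirectedGraph V E} : Diagram G → Diagram G → Prop :=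
  Relation.EqvGen Diagram.Move

end VirtualGraph

/-! A Gauss code forgets only the course of the strands between consecutive classical crossings and
vertices, and the virtual moves make that course irrelevant. The proof gives more than the
corollary: by `virtuallyEquivalent_of_same`, two diagrams with the same code are related by planar
isotopy and virtual moves alone, without any classical move. The corollary applies this to the
classical diagram that realizes the code.

A diagram is turned into a word whose classical crossings carry names and whose crossing ends are
numbered. All vertices and classical crossings are pushed to the bottom, as boxes with all ends
pointing upwards. Above them remain virtual crossings, minima and maxima, which reduce to a standard
drawing `nf c` of a pairing of the ends (`normal_of_Z_le`). The boxes can be permuted and turned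
(`Normal.perm`, `Normal.turn`), so the equivalence class depends only on the nodes up to rotation
and on the pairing.

The pairing is recovered from an invariant. Each end of a strand at a node (a port) gets a colour,
black (`true`) or white (`false`), and `Z` counts the colourings of the strands that extend it.
Local relations preserve this number (`Rule.Op_eq`). Which port colourings extend determines the
pairing (`code_eq`, `normal_unique`). With all ports white a free circle would double the number, so
the value 1 expresses that there are no circles. For a diagram, the port colourings that extend can
be read off the Gauss code (`Diagram.Z_pos_iff`): over/under information and sign tell through which
numbered end a crossing is entered.

Virtual equivalence is a relation between diagrams of the graph, so every intermediate word must be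
such a diagram. The same invariant provides this: ports joined in a word stay joined in an
equivalent one (`Joined.transfer`), hence edges can be followed there (`Diagram.exists_of_eqv`). -/

namespace VirtualGraph

variable {V E : Type*}

/-! ### Labelled words -/

/-- Events of a diagram, with a name `c` for each classical crossing.  The four ends of the crossing
are numbered clockwise so that the ends `0` and `2` belong to the upper strand; `r` is the number of
the lower left end. -/
inductive LEvent (V E : Type*)
  | cup
  | cap
  | virt
  | cross (c : ℕ) (r : Fin 4)
  | vertex (v : V) (legs : List (HalfEdge E))

/-- The ends of the strands at the vertices and at the classical crossings. -/
abbrev Port (E : Type*) := HalfEdge E ⊕ (ℕ × Fin 4)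

/-- The kind of a crossing whose lower left end has the number `r`. -/
def kindOf (r : Fin 4) : Kind := if r.val % 2 = 0 then .slash else .backslash

theorem kindOf_ne (r : Fin 4) : kindOf r ≠ .virtual := by
  unfold kindOf; split <;> simp

theorem kindOf_succ (r : Fin 4) : kindOf (r + 1) = (kindOf r).flip := by
  fin_cases r <;> rfl

/-- Forget the labels. -/
def LEvent.toEvent : LEvent V E → Event V E
  | cup => .cup
  | cap => .cap
  | virt => .cross .virtual
  | cross _ r => .cross (kindOf r)
  | vertex v legs => .vertex v legs

def LEvent.bot : LEvent V E → ℕ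
  | cup => 0
  | cap => 2
  | virt => 2
  | cross _ _ => 2
  | vertex _ _ => 0

def LEvent.top : LEvent V E → ℕ
  | cup => 2
  | cap => 0
  | virt => 2
  | cross _ _ => 2
  | vertex _ legs => legs.length

@[simp] theorem LEvent.toEvent_bot (x : LEvent V E) : x.toEvent.bot = x.bot := by cases x <;> rfl
@[simp] theorem LEvent.toEvent_top (x : LEvent V E) : x.toEvent.top = x.top := by cases x <;> rfl

structure LSlice (V E : Type*) where
  pos : ℕ
  ev : LEvent V E

def LSlice.toSlice (s : LSlice V E) : Slice V E := ⟨s.pos, s.ev.toEvent⟩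

abbrev LWord (V E : Type*) := List (LSlice V E)

def LWord.toWord (w : LWord V E) : Word V E := w.map LSlice.toSlice

/-- The word can be read from a level with `n` strands on. -/
def Fits : ℕ → LWord V E → Prop
  | _, [] => True
  | n, s :: w => s.pos + s.ev.bot ≤ n ∧ Fits (n - s.ev.bot + s.ev.top) w

/-- The number of strands at the top of a word with `n` strands at the bottom. -/
def out : ℕ → LWord V E → ℕ
  | n, [] => n
  | n, s :: w => out (n - s.ev.bot + s.ev.top) w

@[simp] theorem Fits_nil (n : ℕ) : Fits n ([] : LWord V E) := trivial
@[simp] theorem Fits_cons (n : ℕ) (s : LSlice V E) (w : LWord V E) :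
    Fits n (s :: w) ↔ s.pos + s.ev.bot ≤ n ∧ Fits (n - s.ev.bot + s.ev.top) w := Iff.rfl
@[simp] theorem out_nil (n : ℕ) : out n ([] : LWord V E) = n := rfl
@[simp] theorem out_cons (n : ℕ) (s : LSlice V E) (w : LWord V E) :
    out n (s :: w) = out (n - s.ev.bot + s.ev.top) w := rfl

@[simp] theorem bot_cup : (LEvent.cup : LEvent V E).bot = 0 := rfl
@[simp] theorem bot_cap : (LEvent.cap : LEvent V E).bot = 2 := rfl
@[simp] theorem bot_virt : (LEvent.virt : LEvent V E).bot = 2 := rfl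
@[simp] theorem bot_cross (c r) : (LEvent.cross c r : LEvent V E).bot = 2 := rfl
@[simp] theorem bot_vertex (v : V) (l : List (HalfEdge E)) : (LEvent.vertex v l).bot = 0 := rfl
@[simp] theorem top_cup : (LEvent.cup : LEvent V E).top = 2 := rfl
@[simp] theorem top_cap : (LEvent.cap : LEvent V E).top = 0 := rfl
@[simp] theorem top_virt : (LEvent.virt : LEvent V E).top = 2 := rfl
@[simp] theorem top_cross (c r) : (LEvent.cross c r : LEvent V E).top = 2 := rfl
@[simp] theorem top_vertex (v : V) (l : List (HalfEdge E)) :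
    (LEvent.vertex v l).top = l.length := rfl

theorem Fits_append (n : ℕ) (a b : LWord V E) : Fits n (a ++ b) ↔ Fits n a ∧ Fits (out n a) b := by
  induction a generalizing n with
  | nil => simp
  | cons s a ih => simp [ih, and_assoc]

theorem out_append (n : ℕ) (a b : LWord V E) : out n (a ++ b) = out (out n a) b := by
  induction a generalizing n with
  | nil => rfl
  | cons s a ih => simp [ih]

/-- The strand at `p` crosses the `n` strands to the right of it virtually. -/
def passR (p : ℕ) : ℕ → LWord V E
  | 0 => []
  | n + 1 => ⟨p, .virt⟩ :: passR (p + 1) n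

theorem passR_toWord (p n : ℕ) :
    LWord.toWord (passR p n : LWord V E) = passRight .virtual p n := by
  induction n generalizing p with
  | zero => rfl
  | succ n ih =>
    have := ih (p + 1)
    simp only [LWord.toWord, passRight] at this ⊢
    rw [passR, List.map_cons, this, List.range_succ_eq_map]
    simp only [List.map_cons, List.map_map]
    refine List.cons_eq_cons.2 ⟨rfl, List.map_congr_left fun i _ => ?_⟩
    simp; omega

/-- The local relations: planar isotopies and virtual moves. -/
inductive Rule : LWord V E → LWord V E → Prop
  | interchange (p r : ℕ) (x y : LEvent V E) :
      Rule [⟨p, x⟩, ⟨p + x.top + r, y⟩] [⟨p + x.bot + r, y⟩, ⟨p, x⟩]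
  | zigzag_left (p : ℕ) : Rule [⟨p + 1, .cup⟩, ⟨p, .cap⟩] []
  | zigzag_right (p : ℕ) : Rule [⟨p, .cup⟩, ⟨p + 1, .cap⟩] []
  | rotate_virt (p : ℕ) : Rule [⟨p + 2, .cup⟩, ⟨p + 1, .virt⟩, ⟨p, .cap⟩] [⟨p, .virt⟩]
  | rotate_virt' (p : ℕ) : Rule [⟨p, .cup⟩, ⟨p + 1, .virt⟩, ⟨p + 2, .cap⟩] [⟨p, .virt⟩]
  | rotate_cross (p c : ℕ) (r : Fin 4) :
      Rule [⟨p + 2, .cup⟩, ⟨p + 1, .cross c r⟩, ⟨p, .cap⟩] [⟨p, .cross c (r + 1)⟩]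
  | rotate_vertex (p : ℕ) (v : V) (h : HalfEdge E) (hs : List (HalfEdge E)) :
      Rule [⟨p, .cup⟩, ⟨p + 1, .vertex v (h :: hs)⟩, ⟨p, .cap⟩] [⟨p, .vertex v (hs ++ [h])⟩]
  | kink_right (p : ℕ) : Rule [⟨p + 1, .cup⟩, ⟨p, .virt⟩, ⟨p + 1, .cap⟩] []
  | kink_left (p : ℕ) : Rule [⟨p, .cup⟩, ⟨p + 1, .virt⟩, ⟨p, .cap⟩] []
  | double (p : ℕ) : Rule [⟨p, .virt⟩, ⟨p, .virt⟩] []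
  | triple (p : ℕ) :
      Rule [⟨p, .virt⟩, ⟨p + 1, .virt⟩, ⟨p, .virt⟩] [⟨p + 1, .virt⟩, ⟨p, .virt⟩, ⟨p + 1, .virt⟩]
  | slide_vertex (p : ℕ) (v : V) (legs : List (HalfEdge E)) :
      Rule (⟨p + 1, .vertex v legs⟩ :: passR p legs.length) [⟨p, .vertex v legs⟩]
  | slide_cross (p c : ℕ) (r : Fin 4) :
      Rule [⟨p, .cross c r⟩, ⟨p + 1, .virt⟩, ⟨p, .virt⟩]
        [⟨p + 1, .virt⟩, ⟨p, .virt⟩, ⟨p + 1, .cross c r⟩]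

/-- The classical moves do not occur: the nodes of a word only change their position, never their
over/under structure. -/
theorem Rule.move {L R : LWord V E} (h : Rule L R) :
    PlanarMove L.toWord R.toWord ∨ VirtualMove L.toWord R.toWord := by
  cases h with
  | interchange p r x y =>
    left
    have := PlanarMove.interchange p r x.toEvent y.toEvent
    simpa [LWord.toWord, LSlice.toSlice] using this
  | zigzag_left p => exact .inl (.zigzag_left p)
  | zigzag_right p => exact .inl (.zigzag_right p)
  | rotate_virt p => exact .inl (.rotate_cross p .virtual)
  | rotate_virt' p => exact .inl (.rotate_cross' p .virtual)
  | rotate_cross p c r =>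
    left
    have := PlanarMove.rotate_cross (V := V) (E := E) p (kindOf r)
    rw [← kindOf_succ] at this
    exact this
  | rotate_vertex p v h hs => exact .inl (.rotate_vertex' p v h hs)
  | kink_right p => exact .inr (.I_right p)
  | kink_left p => exact .inr (.I_left p)
  | double p => exact .inr (.II p)
  | triple p => exact .inr (.III p)
  | slide_vertex p v legs =>
    right
    have := VirtualMove.IV p v legs
    rw [← passR_toWord] at this
    exact this
  | slide_cross p c r => exact .inr (.V p (kindOf r) (kindOf_ne r))

@[simp] theorem out_passR (n p m : ℕ) (h : p + m < n) : out n (passR p m : LWord V E) = n := by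
  induction m generalizing p with
  | zero => rfl
  | succ m ih =>
    have : n - 2 + 2 = n := by omega
    simp [passR, this, ih (p + 1) (by omega)]

/-- Subtraction of widths is truncated, so the two sides agree only on words that fit. Both
hypotheses are needed in general, since an empty side fits on any number of strands. -/
theorem Rule.out_eq {L R : LWord V E} (h : Rule L R) {n : ℕ} (hL : Fits n L) (hR : Fits n R) :
    out n L = out n R := by
  cases h <;> simp at hL hR ⊢ <;> try omega
  case slide_vertex p v legs =>
    rw [out_passR _ _ _ (by omega)]

/-! ### Counting colourings -/

/-- The colours above an event, given the colours `A` below it and the colours `h` of the ports. -/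
def LEvent.opts (h : Port E → Bool) (x : LEvent V E) (A : List Bool) : List (List Bool) :=
  match x, A with
  | cup, [] => [[true, true], [false, false]]
  | cap, [a, b] => if a = b then [[]] else []
  | virt, [a, b] => [[b, a]]
  | cross c r, [a, b] =>
      if a = h (.inr (c, r)) ∧ b = h (.inr (c, r + 3)) then
        [[h (.inr (c, r + 1)), h (.inr (c, r + 2))]] else []
  | vertex _ legs, [] => [legs.map fun l => h (.inl l)]
  | _, _ => []

section
variable (h : Port E → Bool)

@[simp] theorem opts_cup : (LEvent.cup : LEvent V E).opts h [] = [[true, true], [false, false]] :=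
  rfl
@[simp] theorem opts_cap (a b : Bool) :
    (LEvent.cap : LEvent V E).opts h [a, b] = if a = b then [[]] else [] := rfl
@[simp] theorem opts_virt (a b : Bool) : (LEvent.virt : LEvent V E).opts h [a, b] = [[b, a]] := rfl
@[simp] theorem opts_cross (c : ℕ) (r : Fin 4) (a b : Bool) :
    (LEvent.cross c r : LEvent V E).opts h [a, b] =
      if a = h (.inr (c, r)) ∧ b = h (.inr (c, r + 3)) then
        [[h (.inr (c, r + 1)), h (.inr (c, r + 2))]] else [] := rfl
@[simp] theorem opts_vertex (v : V) (legs : List (HalfEdge E)) :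
    (LEvent.vertex v legs).opts h [] = [legs.map fun l => h (.inl l)] := rfl

end

theorem LEvent.length_of_mem_opts {h : Port E → Bool} {x : LEvent V E} {A B : List Bool}
    (hB : B ∈ x.opts h A) : B.length = x.top := by
  unfold opts at hB
  split at hB <;> simp at hB <;> rcases hB with hB | hB <;> simp_all

/-- The operator of a word on functions of the colours of the strands. -/
def Op (h : Port E → Bool) : LWord V E → (List Bool → ℕ) → List Bool → ℕ
  | [], F, l => F l
  | s :: w, F, l =>
      ((s.ev.opts h ((l.drop s.pos).take s.ev.bot)).map fun B =>
        Op h w F (l.take s.pos ++ B ++ l.drop (s.pos + s.ev.bot))).sum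

theorem Op_append (h : Port E → Bool) (a b : LWord V E) (F : List Bool → ℕ) (l : List Bool) :
    Op h (a ++ b) F l = Op h a (Op h b F) l := by
  induction a generalizing l with
  | nil => rfl
  | cons s a ih => simp [Op, ih]

/-- The form in which `Op` is computed: the colours are cut at the event, so that no `take` or
`drop` remains. -/
theorem Op_split (h : Port E → Bool) {p : ℕ} {x : LEvent V E} (w : LWord V E)
    (F : List Bool → ℕ) {l₁ A : List Bool} (l₂ : List Bool) (hp : l₁.length = p)
    (hA : A.length = x.bot) :
    Op h (⟨p, x⟩ :: w) F (l₁ ++ A ++ l₂) =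
      ((x.opts h A).map fun B => Op h w F (l₁ ++ B ++ l₂)).sum := by
  subst hp
  have e1 : (l₁ ++ A ++ l₂).drop l₁.length = A ++ l₂ := by simp
  have e2 : (l₁ ++ A ++ l₂).take l₁.length = l₁ := by simp
  have e3 : (l₁ ++ A ++ l₂).drop (l₁.length + x.bot) = l₂ := by
    rw [← List.drop_drop, e1, ← hA, List.drop_left]
  have e4 : (A ++ l₂).take x.bot = A := by rw [← hA, List.take_left]
  simp only [Op, e1, e2, e3, e4]

/-- Move a word to the right by `p` strands. -/
def shift (p : ℕ) (w : LWord V E) : LWord V E := w.map fun s => ⟨p + s.pos, s.ev⟩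

/-- Strands to the left of a word are spectators. This reduces the check of a local relation at
position `p` to position `0`. -/
theorem Op_shift (h : Port E → Bool) (w : LWord V E) (F : List Bool → ℕ) (l₁ l : List Bool) :
    Op h (shift l₁.length w) F (l₁ ++ l) = Op h w (fun m => F (l₁ ++ m)) l := by
  induction w generalizing l with
  | nil => rfl
  | cons s w ih =>
    have e1 : (l₁ ++ l).drop (l₁.length + s.pos) = l.drop s.pos := by
      rw [← List.drop_drop, List.drop_left]
    have e2 : (l₁ ++ l).take (l₁.length + s.pos) = l₁ ++ l.take s.pos := by
      simp [List.take_append]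
    have e3 : (l₁ ++ l).drop (l₁.length + s.pos + s.ev.bot) = l.drop (s.pos + s.ev.bot) := by
      rw [add_assoc, ← List.drop_drop, List.drop_left]
    change Op h (⟨l₁.length + s.pos, s.ev⟩ :: shift l₁.length w) F _ = _
    simp only [Op, e1, e2, e3, List.append_assoc]
    simp only [← ih]

theorem exists_split {n p : ℕ} (l : List Bool) (hl : l.length = n) (k : ℕ) (h : p + k ≤ n) :
    ∃ l₁ A l₂, l = l₁ ++ A ++ l₂ ∧ l₁.length = p ∧ A.length = k := by
  refine ⟨l.take p, (l.drop p).take k, (l.drop p).drop k, ?_, ?_, ?_⟩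
  · simp
  · simp; omega
  · simp; omega

theorem Op_passR (h : Port E → Bool) (F : List Bool → ℕ) (p : ℕ) (l₁ : List Bool) (a : Bool)
    (B l₂ : List Bool) (hp : l₁.length = p) :
    Op h (passR p B.length : LWord V E) F (l₁ ++ a :: B ++ l₂) = F (l₁ ++ B ++ a :: l₂) := by
  induction B generalizing p l₁ with
  | nil => simp [passR, Op]
  | cons b B ih =>
    have e : l₁ ++ a :: b :: B ++ l₂ = l₁ ++ [a, b] ++ (B ++ l₂) := by simp
    have := ih (p + 1) (l₁ ++ [b]) (by simp [hp])
    rw [List.length_cons, passR, e, Op_split _ _ _ _ hp rfl]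
    simpa using this

theorem sum_map_sum_map_comm {α β : Type*} (s : List α) (t : List β) (f : α → β → ℕ) :
    (s.map fun a => (t.map fun b => f a b).sum).sum =
      (t.map fun b => (s.map fun a => f a b).sum).sum := by
  induction s with
  | nil => simp
  | cons a s ih => simp [ih, List.sum_map_add]

-- Each relation keeps the way in which the ends of its strands are connected, with each other and
-- with ports, and creates no circle. After removing the spectators, most relations become a finite
-- check on at most three colours. The interchange and the slide past a vertex, where numbers of
-- strands are arbitrary, are treated through `Op_split`.
set_option maxHeartbeats 1000000 in
theorem Rule.Op_eq {L R : LWord V E} (H : Rule L R) {n : ℕ} (hL : Fits n L) (hR : Fits n R)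
    (h : Port E → Bool) (F : List Bool → ℕ) (l : List Bool) (hl : l.length = n) :
    Op h L F l = Op h R F l := by
  cases H with
  | interchange p r x y =>
    simp at hL hR
    obtain ⟨l₁, A, l', rfl, h1, h2⟩ := exists_split l hl x.bot hL.1
    obtain ⟨l₂, C, l₃, rfl, h3, h4⟩ := exists_split (p := r) (n := n - (p + x.bot)) l'
      (by simp at hl; omega) y.bot (by omega)
    have e : l₁ ++ A ++ (l₂ ++ C ++ l₃) = (l₁ ++ A ++ l₂) ++ C ++ l₃ := by simp
    rw [Op_split _ _ _ _ h1 h2]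
    conv_rhs => rw [e, Op_split _ _ _ _ (by simp; omega) h4]
    have e1 : ∀ B ∈ x.opts h A, Op h [⟨p + x.top + r, y⟩] F (l₁ ++ B ++ (l₂ ++ C ++ l₃)) =
        ((y.opts h C).map fun D => F (l₁ ++ B ++ l₂ ++ D ++ l₃)).sum := by
      intro B hB
      have hB := LEvent.length_of_mem_opts hB
      have e : l₁ ++ B ++ (l₂ ++ C ++ l₃) = (l₁ ++ B ++ l₂) ++ C ++ l₃ := by simp
      rw [e, Op_split _ _ _ _ (by simp; omega) h4]
      rfl
    have e2 : ∀ D ∈ y.opts h C, Op h [⟨p, x⟩] F (l₁ ++ A ++ l₂ ++ D ++ l₃) =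
        ((x.opts h A).map fun B => F (l₁ ++ B ++ l₂ ++ D ++ l₃)).sum := by
      intro D hD
      have e : l₁ ++ A ++ l₂ ++ D ++ l₃ = l₁ ++ A ++ (l₂ ++ D ++ l₃) := by simp
      rw [e, Op_split _ _ _ _ h1 h2]
      simp [Op]
    rw [List.map_congr_left e1, List.map_congr_left e2]
    -- The two events choose their upper colours independently, so only the order of summation
    -- differs.
    exact sum_map_sum_map_comm _ _ _
  | zigzag_left p =>
    simp at hL
    obtain ⟨l₁, A, l₂, rfl, h1, h2⟩ := exists_split (p := p) l hl 1 (by omega)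
    obtain ⟨a, rfl⟩ := List.length_eq_one_iff.1 h2
    subst h1
    rw [List.append_assoc]
    change Op h (shift l₁.length [⟨1, .cup⟩, ⟨0, .cap⟩]) F _ = Op h (shift l₁.length []) F _
    rw [Op_shift, Op_shift]
    cases a <;> simp [Op]
  | zigzag_right p =>
    simp at hL
    obtain ⟨l₁, A, l₂, rfl, h1, h2⟩ := exists_split (p := p) l hl 1 (by omega)
    obtain ⟨a, rfl⟩ := List.length_eq_one_iff.1 h2
    subst h1
    rw [List.append_assoc]
    change Op h (shift l₁.length [⟨0, .cup⟩, ⟨1, .cap⟩]) F _ = Op h (shift l₁.length []) F _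
    rw [Op_shift, Op_shift]
    cases a <;> simp [Op]
  | rotate_virt p =>
    simp at hR
    obtain ⟨l₁, A, l₂, rfl, h1, h2⟩ := exists_split (p := p) l hl 2 (by omega)
    obtain ⟨a, b, rfl⟩ := List.length_eq_two.1 h2
    subst h1
    rw [List.append_assoc]
    change Op h (shift l₁.length [⟨2, .cup⟩, ⟨1, .virt⟩, ⟨0, .cap⟩]) F _ = Op h (shift l₁.length [⟨0, .virt⟩]) F _
    rw [Op_shift, Op_shift]
    cases a <;> cases b <;> simp [Op]
  | rotate_virt' p =>
    simp at hR
    obtain ⟨l₁, A, l₂, rfl, h1, h2⟩ := exists_split (p := p) l hl 2 (by omega)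
    obtain ⟨a, b, rfl⟩ := List.length_eq_two.1 h2
    subst h1
    rw [List.append_assoc]
    change Op h (shift l₁.length [⟨0, .cup⟩, ⟨1, .virt⟩, ⟨2, .cap⟩]) F _ = Op h (shift l₁.length [⟨0, .virt⟩]) F _
    rw [Op_shift, Op_shift]
    cases a <;> cases b <;> simp [Op]
  | rotate_cross p c r =>
    simp at hR
    obtain ⟨l₁, A, l₂, rfl, h1, h2⟩ := exists_split (p := p) l hl 2 (by omega)
    obtain ⟨a, b, rfl⟩ := List.length_eq_two.1 h2
    subst h1
    rw [List.append_assoc]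
    change Op h (shift l₁.length [⟨2, .cup⟩, ⟨1, .cross c r⟩, ⟨0, .cap⟩]) F _ = Op h (shift l₁.length [⟨0, .cross c (r + 1)⟩]) F _
    rw [Op_shift, Op_shift]
    have e1 : r + 1 + 3 = r := by fin_cases r <;> rfl
    have e2 : r + 1 + 1 = r + 2 := by fin_cases r <;> rfl
    have e3 : r + 1 + 2 = r + 3 := by fin_cases r <;> rfl
    cases h3 : h (.inr (c, r + 3)) <;> by_cases hb : b = h (.inr (c, r)) <;>
      by_cases ha : a = h (.inr (c, r + 1)) <;> simp [Op, e1, e2, e3, h3, hb, ha]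
  | rotate_vertex p v k hs =>
    simp at hR
    obtain ⟨l₁, A, l₂, rfl, h1, h2⟩ := exists_split (p := p) l hl 0 (by omega)
    obtain rfl := List.length_eq_zero_iff.1 h2
    subst h1
    rw [List.append_assoc]
    change Op h (shift l₁.length [⟨0, .cup⟩, ⟨1, .vertex v (k :: hs)⟩, ⟨0, .cap⟩]) F _ = Op h (shift l₁.length [⟨0, .vertex v (hs ++ [k])⟩]) F _
    rw [Op_shift, Op_shift]
    cases hk : h (.inl k) <;> simp [Op, hk]
  | kink_right p =>
    simp at hL
    obtain ⟨l₁, A, l₂, rfl, h1, h2⟩ := exists_split (p := p) l hl 1 (by omega)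
    obtain ⟨a, rfl⟩ := List.length_eq_one_iff.1 h2
    subst h1
    rw [List.append_assoc]
    change Op h (shift l₁.length [⟨1, .cup⟩, ⟨0, .virt⟩, ⟨1, .cap⟩]) F _ = Op h (shift l₁.length []) F _
    rw [Op_shift, Op_shift]
    cases a <;> simp [Op]
  | kink_left p =>
    simp at hL
    obtain ⟨l₁, A, l₂, rfl, h1, h2⟩ := exists_split (p := p) l hl 1 (by omega)
    obtain ⟨a, rfl⟩ := List.length_eq_one_iff.1 h2
    subst h1
    rw [List.append_assoc]
    change Op h (shift l₁.length [⟨0, .cup⟩, ⟨1, .virt⟩, ⟨0, .cap⟩]) F _ = Op h (shift l₁.length []) F _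
    rw [Op_shift, Op_shift]
    cases a <;> simp [Op]
  | double p =>
    simp at hL
    obtain ⟨l₁, A, l₂, rfl, h1, h2⟩ := exists_split (p := p) l hl 2 (by omega)
    obtain ⟨a, b, rfl⟩ := List.length_eq_two.1 h2
    subst h1
    rw [List.append_assoc]
    change Op h (shift l₁.length [⟨0, .virt⟩, ⟨0, .virt⟩]) F _ = Op h (shift l₁.length []) F _
    rw [Op_shift, Op_shift]
    simp [Op]
  | triple p =>
    simp at hL
    obtain ⟨l₁, A, l₂, rfl, h1, h2⟩ := exists_split (p := p) l hl 3 (by omega)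
    obtain ⟨a, b, c, rfl⟩ := List.length_eq_three.1 h2
    subst h1
    rw [List.append_assoc]
    change Op h (shift l₁.length [⟨0, .virt⟩, ⟨1, .virt⟩, ⟨0, .virt⟩]) F _ = Op h (shift l₁.length [⟨1, .virt⟩, ⟨0, .virt⟩, ⟨1, .virt⟩]) F _
    rw [Op_shift, Op_shift]
    simp [Op]
  | slide_vertex p v legs =>
    simp at hL
    obtain ⟨l₁, A, l₂, rfl, h1, h2⟩ := exists_split (p := p) l hl 1 (by omega)
    obtain ⟨a, rfl⟩ := List.length_eq_one_iff.1 h2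
    have e : l₁ ++ [a] ++ l₂ = (l₁ ++ [a]) ++ [] ++ l₂ := by simp
    have e' : l₁ ++ [a] ++ l₂ = l₁ ++ [] ++ a :: l₂ := by simp
    rw [e, Op_split _ _ _ _ (by simp; omega) rfl]
    conv_rhs => rw [← e, e', Op_split _ _ _ _ h1 rfl]
    have := Op_passR (V := V) h F p l₁ a (legs.map fun l => h (.inl l)) l₂ h1
    simpa [Op] using this
  | slide_cross p c r =>
    simp at hL
    obtain ⟨l₁, A, l₂, rfl, h1, h2⟩ := exists_split (p := p) l hl 3 (by omega)
    obtain ⟨a, b, d, rfl⟩ := List.length_eq_three.1 h2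
    subst h1
    rw [List.append_assoc]
    change Op h (shift l₁.length [⟨0, .cross c r⟩, ⟨1, .virt⟩, ⟨0, .virt⟩]) F _ = Op h (shift l₁.length [⟨1, .virt⟩, ⟨0, .virt⟩, ⟨1, .cross c r⟩]) F _
    rw [Op_shift, Op_shift]
    have e : [a, b, d] ++ l₂ = [] ++ [a, b] ++ d :: l₂ := rfl
    have e' : Op (V := V) h [⟨1, .virt⟩, ⟨0, .virt⟩, ⟨1, .cross c r⟩] (fun m => F (l₁ ++ m))
        ([a, b, d] ++ l₂) =
          Op (V := V) h [⟨1, .cross c r⟩] (fun m => F (l₁ ++ m)) ([d] ++ [a, b] ++ l₂) := by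
      simp [Op]
    rw [e', e, Op_split (p := 0) (x := .cross c r) _ _ _ _ rfl rfl,
      Op_split (p := 1) (x := .cross c r) _ _ _ _ rfl rfl, opts_cross]
    split_ifs <;> simp [Op]

/-! ### Equivalence of labelled words -/

/-- One application of a local relation in a word with `n` strands at the bottom. -/
inductive Step : ℕ → LWord V E → LWord V E → Prop
  | rule {n : ℕ} {L R : LWord V E} (b : LWord V E) :
      Rule L R → Fits n L → Fits n R → Step n (L ++ b) (R ++ b)
  | cons {n : ℕ} {s : LSlice V E} {w w' : LWord V E} :
      s.pos + s.ev.bot ≤ n → Step (n - s.ev.bot + s.ev.top) w w' → Step n (s :: w) (s :: w')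

/-- The equivalence of words with `n` strands at the bottom generated by the local relations. -/
def Eqv (n : ℕ) : LWord V E → LWord V E → Prop := Relation.EqvGen (Step n)

namespace Eqv

variable {n : ℕ} {w w' w'' L R : LWord V E}

theorem refl (n : ℕ) (w : LWord V E) : Eqv n w w := Relation.EqvGen.refl w
theorem symm (h : Eqv n w w') : Eqv n w' w := Relation.EqvGen.symm _ _ h
theorem trans (h : Eqv n w w') (h' : Eqv n w' w'') : Eqv n w w'' := Relation.EqvGen.trans _ _ _ h h'

instance : Trans (Eqv n : LWord V E → LWord V E → Prop) (Eqv n) (Eqv n) := ⟨trans⟩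

theorem of_rule (h : Rule L R)
    (hL : Fits n L := by first | (simp; done) | (simp; omega) | omega)
    (hR : Fits n R := by first | (simp; done) | (simp; omega) | omega) : Eqv n L R := by
  have := Step.rule [] h hL hR
  simp only [List.append_nil] at this
  exact .rel _ _ this

theorem append_right (h : Eqv n w w') (b : LWord V E) : Eqv n (w ++ b) (w' ++ b) := by
  induction h with
  | rel w w' h =>
    refine .rel _ _ ?_
    induction h with
    | rule b' h hL hR =>
      have := Step.rule (b' ++ b) h hL hR
      simpa using this
    | cons h _ ih => exact .cons h ih
  | refl w => exact .refl _ _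
  | symm _ _ _ ih => exact ih.symm
  | trans _ _ _ _ _ ih ih' => exact ih.trans ih'

theorem cons {s : LSlice V E} (hs : s.pos + s.ev.bot ≤ n)
    (h : Eqv (n - s.ev.bot + s.ev.top) w w') : Eqv n (s :: w) (s :: w') := by
  induction h with
  | rel w w' h => exact .rel _ _ (.cons hs h)
  | refl w => exact .refl _ _
  | symm _ _ _ ih => exact ih.symm
  | trans _ _ _ _ _ ih ih' => exact ih.trans ih'

theorem append_left (a : LWord V E) (h : Eqv (out n a) w w')
    (ha : Fits n a := by first | (simp; done) | (simp; omega) | omega) :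
    Eqv n (a ++ w) (a ++ w') := by
  induction a generalizing n with
  | nil => exact h
  | cons s a ih => exact cons ha.1 (ih h ha.2)

theorem ctx (a b : LWord V E) (h : Eqv (out n a) L R)
    (ha : Fits n a := by first | (simp; done) | (simp; omega) | omega) :
    Eqv n (a ++ (L ++ b)) (a ++ (R ++ b)) :=
  append_left a (append_right h b) ha

/-- An event at `q` is moved up past an event to the left of it. -/
theorem comm (p q q' : ℕ) (x y : LEvent V E)
    (h : p + x.bot ≤ q := by first | (simp; done) | (simp; omega) | omega)
    (h' : q' + x.bot = q + x.top := by first | (simp; done) | (simp; omega) | omega)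
    (hq : q + y.bot ≤ n := by first | (simp; done) | (simp; omega) | omega) :
    Eqv n [⟨q, y⟩, ⟨p, x⟩] [⟨p, x⟩, ⟨q', y⟩] := by
  obtain ⟨r, rfl⟩ := Nat.exists_eq_add_of_le h
  obtain rfl : q' = p + x.top + r := by omega
  exact (of_rule (.interchange p r x y)).symm

end Eqv

theorem Step.fits_out {n : ℕ} {w w' : LWord V E} (h : Step n w w') :
    (Fits n w ↔ Fits n w') ∧ out n w = out n w' := by
  induction h with
  | rule b h hL hR => simp [Fits_append, out_append, hL, hR, h.out_eq hL hR]
  | cons h _ ih => simp [h, ih.1, ih.2]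

theorem Eqv.fits_iff {n : ℕ} {w w' : LWord V E} (h : Eqv n w w') : Fits n w ↔ Fits n w' := by
  induction h with
  | rel w w' h => exact h.fits_out.1
  | refl w => rfl
  | symm _ _ _ ih => exact ih.symm
  | trans _ _ _ _ _ ih ih' => exact ih.trans ih'

theorem Eqv.out_eq {n : ℕ} {w w' : LWord V E} (h : Eqv n w w') : out n w = out n w' := by
  induction h with
  | rel w w' h => exact h.fits_out.2
  | refl w => rfl
  | symm _ _ _ ih => exact ih.symm
  | trans _ _ _ _ _ ih ih' => exact ih.trans ih'

/-- A relation higher up in the word acts on the colour lists reached through the slices below it,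
and all of these have the right length. -/
theorem Step.Op_eq {n : ℕ} {w w' : LWord V E} (H : Step n w w') (h : Port E → Bool)
    (F : List Bool → ℕ) (l : List Bool) (hl : l.length = n) : Op h w F l = Op h w' F l := by
  induction H generalizing l with
  | rule b r hL hR => rw [Op_append, Op_append, r.Op_eq hL hR h _ l hl]
  | @cons n s w w' hs _ ih =>
    obtain ⟨p, x⟩ := s
    obtain ⟨l₁, A, l₂, rfl, h1, h2⟩ := exists_split l hl x.bot hs
    rw [Op_split _ _ _ _ h1 h2, Op_split _ _ _ _ h1 h2]
    congr 1
    refine List.map_congr_left fun B hB => ih _ ?_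
    have := LEvent.length_of_mem_opts hB
    simp at hl ⊢
    omega

theorem Eqv.Op_eq {n : ℕ} {w w' : LWord V E} (H : Eqv n w w') (h : Port E → Bool)
    (F : List Bool → ℕ) (l : List Bool) (hl : l.length = n) : Op h w F l = Op h w' F l := by
  induction H with
  | rel w w' H => exact H.Op_eq h F l hl
  | refl w => rfl
  | symm _ _ _ ih => exact ih.symm
  | trans _ _ _ _ _ ih ih' => exact ih.trans ih'

/-! ### Derived relations -/

local notation "𝐱" p:max => LSlice.mk p LEvent.virt
local notation "𝐮" p:max => LSlice.mk p LEvent.cup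
local notation "𝐧" p:max => LSlice.mk p LEvent.cap

/-- The crossing is replaced by its rotated form. The minimum that this introduces then straightens
out against the given maximum. -/
theorem virt_cap_succ {n p : ℕ} (h : p + 3 ≤ n) :
    Eqv n ([𝐱 p, 𝐧 (p + 1)] : LWord V E) [𝐱 (p + 1), 𝐧 p] := calc
  Eqv n [𝐱 p, 𝐧 (p + 1)] [𝐮 (p + 2), 𝐱 (p + 1), 𝐧 p, 𝐧 (p + 1)] :=
    .ctx [] [𝐧 (p + 1)] (.symm (.of_rule (.rotate_virt p)))
  Eqv n _ [𝐮 (p + 2), 𝐱 (p + 1), 𝐧 (p + 3), 𝐧 p] :=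
    .ctx [𝐮 (p + 2), 𝐱 (p + 1)] [] (.symm (.comm p (p + 3) (p + 1) .cap .cap))
  Eqv n _ [𝐮 (p + 2), 𝐧 (p + 3), 𝐱 (p + 1), 𝐧 p] :=
    .ctx [𝐮 (p + 2)] [𝐧 p] (.symm (.comm (p + 1) (p + 3) (p + 3) .virt .cap))
  Eqv n _ [𝐱 (p + 1), 𝐧 p] := .ctx [] [𝐱 (p + 1), 𝐧 p] (.of_rule (.zigzag_right (p + 2)))

/-- A crossing just below the maximum of its own two strands is a virtual kink. Rotating the
crossing gives it the form of `kink_right`. -/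
theorem virt_cap {n p : ℕ} (h : p + 2 ≤ n) : Eqv n ([𝐱 p, 𝐧 p] : LWord V E) [𝐧 p] := calc
  Eqv n [𝐱 p, 𝐧 p] [𝐮 (p + 2), 𝐱 (p + 1), 𝐧 p, 𝐧 p] :=
    .ctx [] [𝐧 p] (.symm (.of_rule (.rotate_virt p)))
  Eqv n _ [𝐮 (p + 2), 𝐱 (p + 1), 𝐧 (p + 2), 𝐧 p] :=
    .ctx [𝐮 (p + 2), 𝐱 (p + 1)] [] (.symm (.comm p (p + 2) p .cap .cap))
  Eqv n _ [𝐧 p] := .ctx [] [𝐧 p] (.of_rule (.kink_right (p + 1)))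

/-- A pair of cancelling crossings is inserted, and the maximum is pulled across the second one. -/
theorem cap_succ {n p : ℕ} (h : p + 3 ≤ n) :
    Eqv n ([𝐧 (p + 1)] : LWord V E) [𝐱 p, 𝐱 (p + 1), 𝐧 p] := calc
  Eqv n [𝐧 (p + 1)] [𝐱 p, 𝐱 p, 𝐧 (p + 1)] := .ctx [] [𝐧 (p + 1)] (.symm (.of_rule (.double p)))
  Eqv n _ [𝐱 p, 𝐱 (p + 1), 𝐧 p] :=
    .ctx [𝐱 p] [] (virt_cap_succ (by simp; omega))

theorem cup_virt_succ {n p : ℕ} (h : p + 1 ≤ n) :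
    Eqv n ([𝐮 (p + 1), 𝐱 p] : LWord V E) [𝐮 p, 𝐱 (p + 1)] := calc
  Eqv n [𝐮 (p + 1), 𝐱 p] [𝐮 (p + 1), 𝐮 p, 𝐱 (p + 1), 𝐧 (p + 2)] :=
    .ctx [𝐮 (p + 1)] [] (.symm (.of_rule (.rotate_virt' p)))
  Eqv n _ [𝐮 p, 𝐮 (p + 3), 𝐱 (p + 1), 𝐧 (p + 2)] :=
    .ctx [] [𝐱 (p + 1), 𝐧 (p + 2)] (.comm p (p + 1) (p + 3) .cup .cup)
  Eqv n _ [𝐮 p, 𝐱 (p + 1), 𝐮 (p + 3), 𝐧 (p + 2)] :=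
    .ctx [𝐮 p] [𝐧 (p + 2)] (.comm (p + 1) (p + 3) (p + 3) .virt .cup)
  Eqv n _ [𝐮 p, 𝐱 (p + 1)] := .ctx [𝐮 p, 𝐱 (p + 1)] [] (.of_rule (.zigzag_left (p + 2)))

theorem cup_succ {n p : ℕ} (h : p + 1 ≤ n) :
    Eqv n ([𝐮 (p + 1)] : LWord V E) [𝐮 p, 𝐱 (p + 1), 𝐱 p] := calc
  Eqv n [𝐮 (p + 1)] [𝐮 (p + 1), 𝐱 p, 𝐱 p] := .ctx [𝐮 (p + 1)] [] (.symm (.of_rule (.double p)))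
  Eqv n _ [𝐮 p, 𝐱 (p + 1), 𝐱 p] := .ctx [] [𝐱 p] (cup_virt_succ h)

/-- Two nested maxima in the shape of `nf [2, 0]`: the outer partner is first led to the strand `0`,
then the inner pair closes. -/
theorem cap_cap {n : ℕ} (h : 4 ≤ n) :
    Eqv n ([𝐧 1, 𝐧 0] : LWord V E) [𝐱 2, 𝐱 1, 𝐧 0, 𝐧 0] := calc
  Eqv n [𝐧 1, 𝐧 0] [𝐱 0, 𝐱 1, 𝐧 0, 𝐧 0] := .ctx [] [𝐧 0] (cap_succ (by simp; omega))
  Eqv n _ [𝐱 0, 𝐱 1, 𝐧 2, 𝐧 0] := .ctx [𝐱 0, 𝐱 1] [] (.symm (.comm 0 2 0 .cap .cap))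
  Eqv n _ [𝐱 0, 𝐱 2, 𝐧 1, 𝐧 0] := .ctx [𝐱 0] [𝐧 0] (virt_cap_succ (by simp; omega))
  Eqv n _ [𝐱 2, 𝐱 0, 𝐧 1, 𝐧 0] := .ctx [] [𝐧 1, 𝐧 0] (.symm (.comm 0 2 2 .virt .virt))
  Eqv n _ [𝐱 2, 𝐱 1, 𝐧 0, 𝐧 0] := .ctx [𝐱 2] [𝐧 0] (virt_cap_succ (by simp; omega))

/-- The strand at `p + k` is moved to `p` by virtual crossings. -/
def desc (p : ℕ) : ℕ → LWord V E
  | 0 => []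
  | k + 1 => 𝐱 (p + k) :: desc p k

/-- The definition splits off the first crossing of the moving strand; here the last one is split
off. -/
theorem desc_succ' (p k : ℕ) : (desc p (k + 1) : LWord V E) = desc (p + 1) k ++ [𝐱 p] := by
  induction k with
  | zero => rfl
  | succ k ih =>
    rw [desc, ih]
    conv_rhs => rw [desc]
    simp; omega

theorem fits_desc {n p k : ℕ} (h : p + k + 1 ≤ n) : Fits n (desc p k : LWord V E) := by
  induction k with
  | zero => trivial
  | succ k ih =>
    have e : n - 2 + 2 = n := by omega
    simp [desc, e]
    exact ⟨by omega, ih (by omega)⟩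

theorem out_desc {n p k : ℕ} (h : p + k + 1 ≤ n) : out n (desc p k : LWord V E) = n := by
  induction k with
  | zero => rfl
  | succ k ih =>
    have e : n - 2 + 2 = n := by omega
    simp [desc, e]
    exact ih (by omega)

/-- A strand that goes to the right and comes back: the crossings cancel in pairs, from the turning
point outwards. -/
theorem passR_desc {n p k : ℕ} (h : p + k + 1 ≤ n) :
    Eqv n (passR p k ++ desc p k : LWord V E) [] := by
  induction k generalizing p with
  | zero => exact .refl _ _
  | succ k ih =>
    rw [passR, desc_succ']
    have e : n - 2 + 2 = n := by omega
    have := Eqv.ctx (n := n) [𝐱 p] [𝐱 p] (L := passR (p + 1) k ++ desc (p + 1) k) (R := [])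
      (by simpa [e] using ih (p := p + 1) (by omega))
    refine .trans ?_ (.of_rule (.double p))
    simpa using this

theorem virt_desc_far {n p q k : ℕ} (hq : p + k + 1 ≤ q ) (h : q + 2 ≤ n) :
    Eqv n (𝐱 q :: desc p k : LWord V E) (desc p k ++ [𝐱 q]) := by
  induction k with
  | zero => exact .refl _ _
  | succ k ih =>
    refine .trans (.ctx [] (desc p k) (.comm (p + k) q q .virt .virt)) ?_
    refine .cons (by simp; omega) ?_
    have e : n - 2 + 2 = n := by omega
    simpa [e] using ih (by omega)

theorem virt_desc_low {n p q k : ℕ} (hq : q + 2 ≤ p) (h : p + k + 1 ≤ n) :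
    Eqv n (𝐱 q :: desc p k : LWord V E) (desc p k ++ [𝐱 q]) := by
  induction k with
  | zero => exact .refl _ _
  | succ k ih =>
    refine .trans (.ctx [] (desc p k) (.symm (.comm q (p + k) (p + k) .virt .virt))) ?_
    refine .cons (by simp; omega) ?_
    have e : n - 2 + 2 = n := by omega
    simpa [e] using ih (by omega)

/-- The moving strand displaces the strands `p, …, p + k - 1` by one to the right, so a crossing of
two of them reappears one position further right. -/
theorem virt_desc_mid {n p q k : ℕ} (hp : p ≤ q) (hq : q + 1 < p + k) (h : p + k + 1 ≤ n) :
    Eqv n (𝐱 q :: desc p k : LWord V E) (desc p k ++ [𝐱 (q + 1)]) := by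
  have e : n - 2 + 2 = n := by omega
  induction k with
  | zero => omega
  | succ k ih =>
    rcases Nat.lt_or_ge (q + 1) (p + k) with h1 | h1
    · refine .trans (.ctx [] (desc p k) (.symm (.comm q (p + k) (p + k) .virt .virt))) ?_
      refine .cons (by simp; omega) ?_
      simpa [e] using ih h1 (by omega)
    · obtain ⟨k, rfl⟩ : ∃ j, k = j + 1 := ⟨k - 1, by omega⟩
      obtain rfl : q = p + k := by omega
      -- Here the moving strand passes the two crossing strands themselves, and move (III*) is
      -- needed. The rest of its path is far from the crossing.
      refine .trans (.ctx [] (desc p k) (.of_rule (.triple (p + k)))) ?_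
      refine .cons (by simp; omega) (.cons (by simp; omega) ?_)
      simpa [e, add_assoc] using virt_desc_far (V := V) (E := E) (n := n) (p := p) (q := p + k + 1) (k := k)
        (by omega) (by omega)

/-! ### Normal form of pairings -/

/-- The standard drawing of a pairing by virtual crossings and maxima: the leftmost strand is
paired with the strand `k + 1`, and so on for the other strands. -/
def nf : List ℕ → LWord V E
  | [] => []
  | k :: c => desc 1 k ++ 𝐧 0 :: nf c

/-- The entry `k` counts the strands between the leftmost strand and its partner, so it is at most
the number `2 * c.length` of the strands paired by the remaining code. -/
def CodeOK : List ℕ → Prop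
  | [] => True
  | k :: c => k ≤ 2 * c.length ∧ CodeOK c

theorem fits_nf {c : List ℕ} (h : CodeOK c) :
    Fits (2 * c.length) (nf c : LWord V E) ∧ out (2 * c.length) (nf c : LWord V E) = 0 := by
  induction c with
  | nil => exact ⟨trivial, rfl⟩
  | cons k c ih =>
    have h1 : 1 + k + 1 ≤ 2 * (c.length + 1) := by have := h.1; omega
    have e : 2 * (c.length + 1) - 2 = 2 * c.length := by omega
    simp only [nf, List.length_cons, Fits_append, out_append, out_desc h1, Fits_cons, out_cons,
      bot_cap, top_cap, e, add_zero]
    exact ⟨⟨fits_desc h1, by omega, (ih h.2).1⟩, (ih h.2).2⟩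

/-- `w` can be absorbed into some normal form on `2 * N` strands. -/
def Absorbed (N : ℕ) (w : LWord V E) : Prop :=
  ∃ c, CodeOK c ∧ c.length = N ∧ Eqv (2 * N) w (nf c)

theorem Absorbed.of_eqv {N : ℕ} {w w' : LWord V E} (h : Eqv (2 * N) w w') (h' : Absorbed N w') :
    Absorbed N w := by
  obtain ⟨c, h1, h2, h3⟩ := h'
  exact ⟨c, h1, h2, h.trans h3⟩

theorem absorbed_desc_cap {m k : ℕ} {w : LWord V E} (hk : k ≤ 2 * m) (h : Absorbed m w) :
    Absorbed (m + 1) (desc 1 k ++ 𝐧 0 :: w) := by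
  obtain ⟨c, h1, h2, h3⟩ := h
  refine ⟨k :: c, ⟨by omega, h1⟩, by simp [h2], .append_left _ (.cons ?_ ?_) ?_⟩
  · rw [out_desc (by omega)]; simp
  · rw [out_desc (by omega)]; simpa [mul_add] using h3
  · exact fits_desc (by omega)

/-- A crossing that avoids the leftmost strand either avoids its partner too, or involves it. In the
first case it slides past the first maximum into the smaller pairing, where induction applies; in
the second it moves the partner by one place, so that `k` changes by one. -/
theorem absorbed_virt_pos {m : ℕ}
    (ih : ∀ c p, CodeOK c → c.length = m → p + 2 ≤ 2 * m →
      Absorbed m (𝐱 p :: nf c : LWord V E)) (c : List ℕ) (p : ℕ) (hp : 1 ≤ p) (hc : CodeOK c)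
    (hm : c.length = m + 1) (h : p + 2 ≤ 2 * (m + 1)) :
    Absorbed (m + 1) (𝐱 p :: nf c : LWord V E) := by
  obtain _ | ⟨k, c⟩ := c
  · simp at hm
  replace hm : c.length = m := by simpa using hm
  have hk : k ≤ 2 * m := hm ▸ hc.1
  have e : 2 * (m + 1) - 2 + 2 = 2 * (m + 1) := by omega
  have od : out (2 * (m + 1)) (desc 1 k : LWord V E) = 2 * (m + 1) := out_desc (by omega)
  have fd : Fits (2 * (m + 1)) (desc 1 k : LWord V E) := fits_desc (by omega)
  -- The crossing leaves the path of the partner at `q ≥ 2`, to the right of the first maximum. That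
  -- maximum removes two strands, so the crossing reaches the smaller pairing at `q - 2`.
  have move : ∀ q, 2 ≤ q → q + 2 ≤ 2 * (m + 1) →
      Eqv (2 * (m + 1)) (𝐱 p :: desc 1 k : LWord V E) (desc 1 k ++ [𝐱 q]) →
      Absorbed (m + 1) (𝐱 p :: nf (k :: c) : LWord V E) := by
    intro q hq hq' H
    refine .of_eqv ?_ (absorbed_desc_cap hk (ih c (q - 2) hc.2 hm (by omega)))
    have h1 := H.append_right (𝐧 0 :: nf c)
    refine .trans (by simpa [nf] using h1) ?_
    refine .append_left _ ?_ fd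
    rw [od]
    exact .append_right (.comm 0 q (q - 2) .cap .virt) (nf c)
  rcases Nat.lt_or_ge p k with h1 | h1
  · exact move (p + 1) (by omega) (by omega) (virt_desc_mid hp (by omega) (by omega))
  rcases Nat.eq_or_lt_of_le h1 with rfl | h1
  · obtain ⟨j, rfl⟩ : ∃ j, k = j + 1 := ⟨k - 1, by omega⟩
    -- The crossing cancels the first crossing of the partner's path.
    refine ⟨j :: c, ⟨by omega, hc.2⟩, by simp [hm], ?_⟩
    rw [nf, nf, desc, add_comm 1 j]
    exact .append_right (.of_rule (n := 2 * (m + 1)) (.double (j + 1))) (desc 1 j ++ 𝐧 0 :: nf c)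
  rcases Nat.eq_or_lt_of_le h1 with rfl | h1
  · refine ⟨(k + 1) :: c, ⟨by omega, hc.2⟩, by simp [hm], ?_⟩
    rw [nf, nf, desc, add_comm 1 k]
    exact .refl _ _
  · exact move p (by omega) (by omega) (virt_desc_far (by omega) (by omega))

/-! ### Absorption of virtual crossings, maxima and minima into a pairing -/

def IsVirt (a : ℕ) (n : ℕ) (w : LWord V E) : Prop :=
  ∀ s ∈ w, s.ev = .virt ∧ a ≤ s.pos ∧ s.pos + 2 ≤ n

theorem IsVirt.fits {a n : ℕ} {w : LWord V E} (h : IsVirt a n w) : Fits n w ∧ out n w = n := by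
  induction w with
  | nil => exact ⟨trivial, rfl⟩
  | cons s w ih =>
    obtain ⟨p, x⟩ := s
    obtain ⟨rfl, h1, h2⟩ := h _ List.mem_cons_self
    have e : n - 2 + 2 = n := by simp at h2; omega
    have := ih fun s hs => h s (List.mem_cons_of_mem _ hs)
    simpa [e, this] using h2

theorem IsVirt.append {a n : ℕ} {w w' : LWord V E} (h : IsVirt a n w) (h' : IsVirt a n w') :
    IsVirt a n (w ++ w') := fun s hs => (List.mem_append.1 hs).elim (h s) (h' s)

theorem isVirt_desc {a n p k : ℕ} (h : p + k + 1 ≤ n) (ha : a ≤ p) :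
    IsVirt a n (desc p k : LWord V E) := by
  induction k with
  | zero => intro s hs; simp [desc] at hs
  | succ k ih =>
    intro s hs
    rcases List.mem_cons.1 hs with rfl | hs
    · exact ⟨rfl, by simp; omega, by simp; omega⟩
    · exact ih (by omega) s hs

/-- The bound `a` serves two uses. With `a = 1` the crossings avoid the leftmost strand, and the
lemma is available inside the induction for `absorbed_virt`; with `a = 0` it is the final form. -/
theorem absorbed_virts {N a : ℕ}
    (ih : ∀ c p, a ≤ p → CodeOK c → c.length = N → p + 2 ≤ 2 * N →
      Absorbed N (𝐱 p :: nf c : LWord V E)) (w : LWord V E) (hw : IsVirt a (2 * N) w)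
    {u : LWord V E} (hu : Absorbed N u) : Absorbed N (w ++ u) := by
  induction w with
  | nil => exact hu
  | cons s w ih' =>
    obtain ⟨c, h1, h2, h3⟩ := ih' fun s hs => hw s (List.mem_cons_of_mem _ hs)
    obtain ⟨p, x⟩ := s
    obtain ⟨rfl, h4, h5⟩ := hw _ List.mem_cons_self
    have e : 2 * N - 2 + 2 = 2 * N := by simp at h5; omega
    exact .of_eqv (.cons h5 (by simpa [e] using h3)) (ih c p h4 h1 h2 h5)

/-- The case left open by `absorbed_virt_pos` is a crossing of the two leftmost strands. If they are
partners it is a kink. Otherwise the two strands exchange their partners; the word is rewritten as a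
pairing below which only crossings away from the leftmost strand remain, and these are absorbed by
the case already known. -/
theorem absorbed_virt (N : ℕ) (c : List ℕ) (p : ℕ) (hc : CodeOK c) (hN : c.length = N)
    (hp : p + 2 ≤ 2 * N) : Absorbed N (𝐱 p :: nf c : LWord V E) := by
  induction N generalizing c p with
  | zero => omega
  | succ m ih =>
    have pos := absorbed_virt_pos (V := V) (E := E) fun c p hc hm h => ih c p hc hm h
    rcases Nat.eq_zero_or_pos p with rfl | h0
    swap
    · exact pos c p h0 hc hN hp
    obtain _ | ⟨k, c⟩ := c
    · simp at hN
    have hm : c.length = m := by simpa using hN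
    have hk : k ≤ 2 * m := hm ▸ hc.1
    obtain _ | j := k
    · exact ⟨0 :: c, hc, hN, .ctx [] (nf c) (virt_cap (by simp))⟩
    obtain _ | ⟨i, c⟩ := c
    · simp at hm; omega
    have hm : c.length + 1 = m := by simpa using hm
    have hi : i ≤ 2 * c.length := hc.2.1
    have v2 : IsVirt 1 (2 * (m + 1)) (desc 2 j : LWord V E) := isVirt_desc (by omega) (by omega)
    -- Here `x₀` denotes the virtual crossing at position `0`, and so on. It commutes with `desc 2
    -- j` and then meets `x₁` and the maximum, which together are a maximum at `1`. That maximum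
    -- slides over `desc 1 i`, making it `desc 3 i`, and is left nested inside the next maximum. By
    -- `cap_cap` this gives the code `(i + 2) :: 0 :: c`.
    refine .of_eqv (w' := desc 2 j ++ nf ((i + 2) :: 0 :: c)) ?_
      (absorbed_virts (a := 1) (fun c p h1 h2 h3 h4 => pos c p h1 h2 h3 h4) _ v2
        ⟨(i + 2) :: 0 :: c, ⟨by simp; omega, by simp, hc.2.2⟩, by simp [hm], .refl _ _⟩)
    have e1 : (𝐱 0 :: nf ((j + 1) :: i :: c) : LWord V E) =
        [] ++ ((𝐱 0 :: desc 2 j) ++ ([𝐱 1, 𝐧 0] ++ nf (i :: c))) := by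
      rw [nf, desc_succ']; simp
    have e2 : (nf ((i + 2) :: 0 :: c) : LWord V E) =
        desc 3 i ++ ([𝐱 2, 𝐱 1, 𝐧 0, 𝐧 0] ++ nf c) := by
      rw [nf, desc_succ', desc_succ', nf]; simp [desc]
    have o2 : out (2 * (m + 1)) (desc 2 j : LWord V E) = 2 * (m + 1) := v2.fits.2
    have slide : ∀ k n, 1 + k + 2 < n → Eqv n (𝐧 1 :: desc 1 k : LWord V E) (desc 3 k ++ [𝐧 1]) := by
      intro k
      induction k with
      | zero => intro n _; exact .refl _ _
      | succ k ih =>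
        intro n hn
        have e : n - 2 + 2 = n := by omega
        refine .trans (.ctx [] (desc 1 k) (.symm (.comm 1 (3 + k) (1 + k) .cap .virt))) ?_
        refine .cons (by simp; omega) ?_
        simpa [e] using ih n (by omega)
    rw [e1, e2]
    refine .trans (.ctx [] _ (virt_desc_low (by omega) (by simp; omega))) ?_
    simp only [List.nil_append, List.append_assoc]
    refine .append_left _ ?_ v2.fits.1
    rw [o2]
    refine .trans (.ctx [] (nf (i :: c)) (L := [𝐱 0, 𝐱 1, 𝐧 0]) (R := [𝐧 1])
      (.symm (cap_succ (by simp; omega)))) ?_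
    rw [nf]
    refine .trans (.ctx [] (𝐧 0 :: nf c) (L := 𝐧 1 :: desc 1 i) (slide i _ (by simp; omega))) ?_
    simp only [List.nil_append, List.append_assoc]
    refine .append_left _ ?_ (fits_desc (by omega))
    rw [out_desc (by omega)]
    exact .append_right (cap_cap (by omega)) (nf c)

theorem absorbed_isVirt {N : ℕ} {w u : LWord V E} (hw : IsVirt 0 (2 * N) w) (hu : Absorbed N u) :
    Absorbed N (w ++ u) :=
  absorbed_virts (fun c p _ hc hN hp => absorbed_virt N c p hc hN hp) w hw hu

theorem cap_eqv {n p : ℕ} (h : p + 2 ≤ n) :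
    ∃ w : LWord V E, IsVirt 0 n w ∧ Eqv n [𝐧 p] (w ++ [𝐧 0]) := by
  induction p with
  | zero => exact ⟨[], by intro s hs; simp at hs, .refl _ _⟩
  | succ p ih =>
    obtain ⟨w, h1, h2⟩ := ih (by omega)
    refine ⟨[𝐱 p, 𝐱 (p + 1)] ++ w, .append ?_ h1, .trans (cap_succ (by omega)) ?_⟩
    · intro s hs; rcases List.mem_pair.1 hs with rfl | rfl <;> simp <;> omega
    · have e : n - 2 + 2 = n := by omega
      exact .append_left [𝐱 p, 𝐱 (p + 1)] (by simpa [e] using h2)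

theorem cup_eqv {n p : ℕ} (h : p ≤ n) :
    ∃ w : LWord V E, IsVirt 0 (n + 2) w ∧ Eqv n [𝐮 p] ([𝐮 0] ++ w) := by
  induction p with
  | zero => exact ⟨[], by intro s hs; simp at hs, .refl _ _⟩
  | succ p ih =>
    obtain ⟨w, h1, h2⟩ := ih (by omega)
    refine ⟨w ++ [𝐱 (p + 1), 𝐱 p], .append h1 ?_, .trans (cup_succ (by omega)) ?_⟩
    · intro s hs; rcases List.mem_pair.1 hs with rfl | rfl <;> simp <;> omega
    · simpa using h2.append_right [𝐱 (p + 1), 𝐱 p]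

theorem absorbed_cap {N p : ℕ} {u : LWord V E} (h : p ≤ 2 * N) (hu : Absorbed N u) :
    Absorbed (N + 1) (𝐧 p :: u) := by
  obtain ⟨w, h1, h2⟩ := cap_eqv (V := V) (E := E) (n := 2 * (N + 1)) (p := p) (by omega)
  refine .of_eqv (h2.append_right u) ?_
  rw [List.append_assoc]
  exact absorbed_isVirt h1 (absorbed_desc_cap (k := 0) (by omega) hu)

/-- A minimum below a pairing joins two strands or creates a circle. -/
theorem absorbed_cup {N p : ℕ} {u : LWord V E} (h : p ≤ 2 * N) (hu : Absorbed (N + 1) u) :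
    Absorbed N (𝐮 p :: u) ∨ ∃ c, CodeOK c ∧ c.length = N ∧
      Eqv (2 * N) (𝐮 p :: u) (𝐮 0 :: 𝐧 0 :: nf c) := by
  obtain ⟨w, h1, h2⟩ := cup_eqv (V := V) (E := E) h
  obtain ⟨c, hc, hN, hc'⟩ := absorbed_isVirt (N := N + 1) h1 hu
  obtain _ | ⟨k, c⟩ := c
  · simp at hN
  replace hN : c.length = N := by simpa using hN
  have hk : k ≤ 2 * N := hN ▸ hc.1
  have H : Eqv (2 * N) (𝐮 p :: u) (𝐮 0 :: nf (k :: c)) := by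
    refine .trans (h2.append_right u) ?_
    exact .cons (by simp) hc'
  obtain _ | j := k
  · exact .inr ⟨c, hc.2, hN, H⟩
  left
  -- The minimum slides up past all crossings of the partner's path but the last, lowering their
  -- positions by two. With the last crossing and the maximum it forms a kink, which is removed.
  refine .of_eqv (w' := desc 0 j ++ nf c) (.trans H ?_)
    (absorbed_isVirt (isVirt_desc (by omega) le_rfl) ⟨c, hc.2, hN, .refl _ _⟩)
  have slide : ∀ k n, k + 1 ≤ n → Eqv n (𝐮 0 :: desc 2 k : LWord V E) (desc 0 k ++ [𝐮 0]) := by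
    intro k
    induction k with
    | zero => intro n _; exact .refl _ _
    | succ k ih =>
      intro n hn
      have e : n - 2 + 2 = n := by omega
      refine .trans (.ctx [] (desc 2 k) (.symm (.comm 0 (0 + k) (2 + k) .cup .virt))) ?_
      refine .cons (by simp; omega) ?_
      simpa [e] using ih n (by omega)
  rw [nf, desc_succ']
  have := slide j (2 * N) (by omega)
  have := this.append_right ([𝐱 1, 𝐧 0] ++ nf c)
  refine .trans (by simpa using this) ?_
  refine .append_left _ ?_ (fits_desc (by omega))
  rw [out_desc (by omega)]
  exact .ctx [] (nf c) (.of_rule (.kink_left 0))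

/-! ### Normal form of diagrams -/

/-- A classical crossing or a vertex, as a box whose half-edges all leave upwards. -/
inductive Node (V E : Type*)
  | cross (c : ℕ) (r : Fin 4)
  | vertex (v : V) (legs : List (HalfEdge E))

def LEvent.node : LEvent V E → Option (Node V E)
  | cross c r => some (.cross c r)
  | vertex v legs => some (.vertex v legs)
  | _ => none

def nodes (w : LWord V E) : List (Node V E) := w.filterMap fun s => s.ev.node

@[simp] theorem nodes_nil : nodes ([] : LWord V E) = [] := rfl
@[simp] theorem nodes_append (a b : LWord V E) : nodes (a ++ b) = nodes a ++ nodes b :=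
  List.filterMap_append
@[simp] theorem nodes_virt (p : ℕ) (w : LWord V E) : nodes (𝐱 p :: w) = nodes w := rfl
@[simp] theorem nodes_cup (p : ℕ) (w : LWord V E) : nodes (𝐮 p :: w) = nodes w := rfl
@[simp] theorem nodes_cap (p : ℕ) (w : LWord V E) : nodes (𝐧 p :: w) = nodes w := rfl
@[simp] theorem nodes_cross (p c : ℕ) (r : Fin 4) (w : LWord V E) :
    nodes (⟨p, .cross c r⟩ :: w) = .cross c r :: nodes w := rfl
@[simp] theorem nodes_vertex (p : ℕ) (v : V) (legs : List (HalfEdge E)) (w : LWord V E) :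
    nodes (⟨p, .vertex v legs⟩ :: w) = .vertex v legs :: nodes w := rfl

theorem nodes_desc (p k : ℕ) : nodes (desc p k : LWord V E) = [] := by
  induction k with
  | zero => rfl
  | succ k ih => simp [desc, ih]

theorem nodes_nf (c : List ℕ) : nodes (nf c : LWord V E) = [] := by
  induction c with
  | nil => rfl
  | cons k c ih => simp [nf, ih, nodes_desc]

def Node.size : Node V E → ℕ
  | cross _ _ => 4
  | vertex _ legs => legs.length

/-- The two minima bend the lower ends of the crossing upwards, so that its ends leave in the order
`r`, `r + 1`, `r + 2`, `r + 3` from left to right. -/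
def Node.box (p : ℕ) : Node V E → LWord V E
  | cross c r => [𝐮 p, 𝐮 (p + 2), ⟨p + 1, .cross c r⟩]
  | vertex v legs => [⟨p, .vertex v legs⟩]

theorem nodes_box (p : ℕ) (b : Node V E) : nodes (b.box p) = [b] := by cases b <;> rfl

theorem fits_box {n p : ℕ} (b : Node V E) (h : p ≤ n) :
    Fits n (b.box p) ∧ out n (b.box p) = n + b.size := by
  cases b <;> simp [Node.box, Node.size] <;> omega

/-- All boxes in a row, the first box on the right. -/
def boxes (B : List (Node V E)) : LWord V E := B.flatMap (Node.box 0)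

def size (B : List (Node V E)) : ℕ := (B.map Node.size).sum

@[simp] theorem boxes_nil : boxes ([] : List (Node V E)) = [] := rfl
@[simp] theorem boxes_cons (b : Node V E) (B : List (Node V E)) :
    boxes (b :: B) = b.box 0 ++ boxes B := rfl
@[simp] theorem size_nil : size ([] : List (Node V E)) = 0 := rfl
@[simp] theorem size_cons (b : Node V E) (B : List (Node V E)) :
    size (b :: B) = b.size + size B := by simp [size]

theorem nodes_boxes (B : List (Node V E)) : nodes (boxes B) = B := by
  induction B with
  | nil => rfl
  | cons b B ih => simp [ih, nodes_box]

theorem fits_boxes (n : ℕ) (B : List (Node V E)) :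
    Fits n (boxes B) ∧ out n (boxes B) = n + size B := by
  induction B generalizing n with
  | nil => simp
  | cons b B ih =>
    have := fits_box (n := n) b (Nat.zero_le _)
    simp [Fits_append, out_append, this, ih, add_assoc]

theorem slide_box {n p q : ℕ} (y : LEvent V E) (b : Node V E) (h : p ≤ q) (hq : q + y.bot ≤ n) :
    Eqv n (⟨q, y⟩ :: b.box p) (b.box p ++ [⟨q + b.size, y⟩]) := by
  cases b with
  | vertex v legs => exact .comm p q (q + legs.length) (.vertex v legs) y
  | cross c r => calc
      Eqv n [⟨q, y⟩, 𝐮 p, 𝐮 (p + 2), ⟨p + 1, .cross c r⟩]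
          [𝐮 p, ⟨q + 2, y⟩, 𝐮 (p + 2), ⟨p + 1, .cross c r⟩] :=
        .ctx [] [𝐮 (p + 2), ⟨p + 1, .cross c r⟩] (.comm p q (q + 2) .cup y)
      Eqv n _ [𝐮 p, 𝐮 (p + 2), ⟨q + 4, y⟩, ⟨p + 1, .cross c r⟩] :=
        .ctx [𝐮 p] [⟨p + 1, .cross c r⟩] (.comm (p + 2) (q + 2) (q + 4) .cup y)
      Eqv n _ [𝐮 p, 𝐮 (p + 2), ⟨p + 1, .cross c r⟩, ⟨q + 4, y⟩] :=
        .ctx [𝐮 p, 𝐮 (p + 2)] [] (.comm (p + 1) (q + 4) (q + 4) (.cross c r) y)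

/-- All boxes are inserted at the far left, hence to the left of any event below them. Such an event
therefore rises past them and only has its position shifted. -/
theorem slide_boxes {n q : ℕ} (y : LEvent V E) (B : List (Node V E)) (hq : q + y.bot ≤ n) :
    Eqv n (⟨q, y⟩ :: boxes B) (boxes B ++ [⟨q + size B, y⟩]) := by
  induction B generalizing n q with
  | nil => exact .refl _ _
  | cons b B ih =>
    have h1 := (slide_box y b (Nat.zero_le q) hq).append_right (boxes B)
    refine .trans h1 ?_
    have hb := fits_box (n := n) b (Nat.zero_le _)
    have h2 := ih (n := n + b.size) (q := q + b.size) (by omega)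
    have := Eqv.append_left (n := n) (b.box 0) (by rw [hb.2]; exact h2) hb.1
    simpa [add_assoc] using this

theorem fits_passR {n p k : ℕ} (h : p + k + 1 ≤ n) : Fits n (passR p k : LWord V E) := by
  induction k generalizing p with
  | zero => trivial
  | succ k ih =>
    have e : n - 2 + 2 = n := by omega
    exact ⟨by simp; omega, by simpa [e] using ih (p := p + 1) (by omega)⟩

/-- The strand to the left of the box is moved below it to the other side by virtual moves. For a
vertex this is (IV*), with the crossings brought to the other side of the equation by `passR_desc`.
For a crossing the strand passes two minima and then the crossing itself, by (V*). -/
theorem box_succ {n p : ℕ} (b : Node V E) (h : p + 1 ≤ n) :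
    Eqv n (b.box (p + 1)) (b.box p ++ desc p b.size) := by
  cases b with
  | vertex v legs =>
    have h1 := Eqv.append_left (n := n) [⟨p + 1, .vertex v legs⟩]
      (passR_desc (V := V) (E := E) (n := out n [⟨p + 1, .vertex v legs⟩]) (p := p)
        (k := legs.length) (by simp; omega))
    refine .trans (.symm h1) ?_
    refine .append_right (w := ⟨p + 1, .vertex v legs⟩ :: passR p legs.length) ?_ (desc p legs.length)
    exact .of_rule (.slide_vertex p v legs) ⟨by simp; omega, fits_passR (by simp; omega)⟩
      ⟨by simp; omega, trivial⟩
  | cross c r => calc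
      Eqv n [𝐮 (p + 1), 𝐮 (p + 3), ⟨p + 2, .cross c r⟩]
          [𝐮 p, 𝐱 (p + 1), 𝐱 p, 𝐮 (p + 3), ⟨p + 2, .cross c r⟩] :=
        .ctx [] [𝐮 (p + 3), ⟨p + 2, .cross c r⟩] (cup_succ (by simp; omega))
      Eqv n _ [𝐮 p, 𝐱 (p + 1), 𝐮 (p + 3), 𝐱 p, ⟨p + 2, .cross c r⟩] :=
        .ctx [𝐮 p, 𝐱 (p + 1)] [⟨p + 2, .cross c r⟩] (.symm (.comm p (p + 3) (p + 3) .virt .cup))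
      Eqv n _ [𝐮 p, 𝐮 (p + 3), 𝐱 (p + 1), 𝐱 p, ⟨p + 2, .cross c r⟩] :=
        .ctx [𝐮 p] [𝐱 p, ⟨p + 2, .cross c r⟩]
          (.symm (.comm (p + 1) (p + 3) (p + 3) .virt .cup))
      Eqv n _ [𝐮 p, 𝐮 (p + 2), 𝐱 (p + 3), 𝐱 (p + 2), 𝐱 (p + 1), 𝐱 p, ⟨p + 2, .cross c r⟩] :=
        .ctx [𝐮 p] [𝐱 (p + 1), 𝐱 p, ⟨p + 2, .cross c r⟩] (cup_succ (by simp; omega))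
      Eqv n _ [𝐮 p, 𝐮 (p + 2), 𝐱 (p + 3), 𝐱 (p + 2), 𝐱 (p + 1), ⟨p + 2, .cross c r⟩, 𝐱 p] :=
        .ctx [𝐮 p, 𝐮 (p + 2), 𝐱 (p + 3), 𝐱 (p + 2), 𝐱 (p + 1)] []
          (.symm (.comm p (p + 2) (p + 2) .virt (.cross c r)))
      Eqv n _ [𝐮 p, 𝐮 (p + 2), 𝐱 (p + 3), ⟨p + 1, .cross c r⟩, 𝐱 (p + 2), 𝐱 (p + 1), 𝐱 p] :=
        .ctx [𝐮 p, 𝐮 (p + 2), 𝐱 (p + 3)] [𝐱 p] (.symm (.of_rule (.slide_cross (p + 1) c r)))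
      Eqv n _ [𝐮 p, 𝐮 (p + 2), ⟨p + 1, .cross c r⟩, 𝐱 (p + 3), 𝐱 (p + 2), 𝐱 (p + 1), 𝐱 p] :=
        .ctx [𝐮 p, 𝐮 (p + 2)] [𝐱 (p + 2), 𝐱 (p + 1), 𝐱 p]
          (.comm (p + 1) (p + 3) (p + 3) (.cross c r) .virt)

theorem box_eqv {n p : ℕ} (b : Node V E) (h : p ≤ n) :
    ∃ w : LWord V E, IsVirt 0 (n + b.size) w ∧ Eqv n (b.box p) (b.box 0 ++ w) := by
  induction p with
  | zero => exact ⟨[], by intro s hs; simp at hs, by simpa using .refl _ _⟩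
  | succ p ih =>
    obtain ⟨w, h1, h2⟩ := ih (by omega)
    refine ⟨w ++ desc p b.size, .append h1 (isVirt_desc (by omega) (by omega)), ?_⟩
    refine .trans (box_succ b h) ?_
    simpa using h2.append_right (desc p b.size)

/-- The word `w` on `n` strands is equivalent to a word in normal form with the boxes `B`. -/
def Normal (n : ℕ) (B : List (Node V E)) (w : LWord V E) : Prop :=
  ∃ c, CodeOK c ∧ n + size B = 2 * c.length ∧ Eqv n w (boxes B ++ nf c)

theorem Normal.of_eqv {n : ℕ} {B : List (Node V E)} {w w' : LWord V E} (h : Eqv n w w')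
    (h' : Normal n B w') : Normal n B w := by
  obtain ⟨c, h1, h2, h3⟩ := h'
  exact ⟨c, h1, h2, h.trans h3⟩

theorem normal_of_absorbed {n N : ℕ} {B : List (Node V E)} {u : LWord V E}
    (hN : n + size B = 2 * N) (h : Absorbed N u) : Normal n B (boxes B ++ u) := by
  obtain ⟨c, h1, rfl, h3⟩ := h
  have hB := fits_boxes n B
  exact ⟨c, h1, hN, .append_left _ (by rw [hB.2, hN]; exact h3) hB.1⟩

/-- Here and for maxima and minima, a slice put below a normal form rises past the boxes and is
absorbed by the pairing. -/
theorem Normal.virts {n : ℕ} {B : List (Node V E)} {w v : LWord V E} (hw : Normal n B w)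
    (hv : IsVirt 0 n v) : Normal n B (v ++ w) := by
  induction v with
  | nil => exact hw
  | cons s v ih =>
    obtain ⟨c, h1, h2, h3⟩ := ih fun s hs => hv s (List.mem_cons_of_mem _ hs)
    obtain ⟨p, x⟩ := s
    obtain ⟨rfl, -, h5⟩ := hv _ List.mem_cons_self
    have e : n - 2 + 2 = n := by simp at h5; omega
    refine .of_eqv (.cons h5 (by simpa [e] using h3)) ?_
    refine .of_eqv ((slide_boxes .virt B h5).append_right (nf c)) ?_
    rw [List.append_assoc]
    exact normal_of_absorbed h2 (absorbed_virt _ c _ h1 rfl (by simp at h5 ⊢; omega))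

theorem Normal.cap {n p : ℕ} {B : List (Node V E)} {w : LWord V E} (hw : Normal n B w)
    (hp : p ≤ n) : Normal (n + 2) B (𝐧 p :: w) := by
  obtain ⟨c, h1, h2, h3⟩ := hw
  refine .of_eqv (.cons (by simpa using hp) (by simpa using h3)) ?_
  refine .of_eqv ((slide_boxes .cap B (by simpa using hp)).append_right (nf c)) ?_
  rw [List.append_assoc]
  exact normal_of_absorbed (N := c.length + 1) (by omega)
    (absorbed_cap (by omega) ⟨c, h1, rfl, .refl _ _⟩)

theorem Normal.box {n p : ℕ} {B : List (Node V E)} {w : LWord V E} {b : Node V E}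
    (hw : Normal (n + b.size) B w) (hp : p ≤ n) : Normal n (b :: B) (b.box p ++ w) := by
  obtain ⟨v, hv, h⟩ := box_eqv b hp
  obtain ⟨c, h1, h2, h3⟩ := hw.virts hv
  have hb := fits_box (n := n) b (Nat.zero_le _)
  refine ⟨c, h1, by simp; omega, .trans (h.append_right w) ?_⟩
  simp only [List.append_assoc, boxes_cons]
  exact .append_left _ (by rw [hb.2]; exact h3) hb.1

theorem Normal.cup {n p : ℕ} {B : List (Node V E)} {w : LWord V E} (hw : Normal (n + 2) B w)
    (hp : p ≤ n) : Normal n B (𝐮 p :: w) ∨ ∃ c, CodeOK c ∧ n + size B = 2 * c.length ∧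
      Eqv n (𝐮 p :: w) (boxes B ++ 𝐮 0 :: 𝐧 0 :: nf c) := by
  obtain ⟨c, h1, h2, h3⟩ := hw
  obtain ⟨N, hN⟩ : ∃ N, c.length = N + 1 := ⟨c.length - 1, by omega⟩
  have H : Eqv n (𝐮 p :: w) (boxes B ++ (𝐮 (p + size B) :: nf c)) := by
    refine .trans (.cons (by simpa using hp) (by simpa using h3)) ?_
    simpa using (slide_boxes .cup B (by simpa using hp)).append_right (nf c)
  rcases absorbed_cup (N := N) (p := p + size B) (by omega) ⟨c, h1, hN, .refl _ _⟩ with h | h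
  · exact .inl (.of_eqv H (normal_of_absorbed (by omega) h))
  · obtain ⟨c', h4, h5, h6⟩ := h
    have hB := fits_boxes n B
    have hn : n + size B = 2 * N := by omega
    exact .inr ⟨c', h4, by omega, H.trans (.append_left _ (by rw [hB.2, hn]; exact h6) hB.1)⟩

/-- The outer ends of the box are bent down again by two maxima, and the resulting wiggles
straighten. -/
theorem cross_eqv {n p : ℕ} (c : ℕ) (r : Fin 4) (h : p + 2 ≤ n) :
    Eqv n [(⟨p, .cross c r⟩ : LSlice V E)]
      ((Node.cross c r).box (p + 1) ++ [𝐧 p, 𝐧 (p + 2)]) := .symm <| calc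
  Eqv n [𝐮 (p + 1), 𝐮 (p + 3), ⟨p + 2, .cross c r⟩, 𝐧 p, 𝐧 (p + 2)]
      [𝐮 (p + 1), 𝐮 (p + 3), 𝐧 p, ⟨p, .cross c r⟩, 𝐧 (p + 2)] :=
    .ctx [𝐮 (p + 1), 𝐮 (p + 3)] [𝐧 (p + 2)] (.comm p (p + 2) p .cap (.cross c r))
  Eqv n _ [𝐮 (p + 1), 𝐧 p, 𝐮 (p + 1), ⟨p, .cross c r⟩, 𝐧 (p + 2)] :=
    .ctx [𝐮 (p + 1)] [⟨p, .cross c r⟩, 𝐧 (p + 2)] (.comm p (p + 3) (p + 1) .cap .cup)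
  Eqv n _ [𝐮 (p + 1), ⟨p, .cross c r⟩, 𝐧 (p + 2)] :=
    .ctx [] [𝐮 (p + 1), ⟨p, .cross c r⟩, 𝐧 (p + 2)] (.of_rule (.zigzag_left p))
  Eqv n _ [𝐮 (p + 1), 𝐧 (p + 2), ⟨p, .cross c r⟩] :=
    .ctx [𝐮 (p + 1)] [] (.symm (.comm p (p + 2) (p + 2) (.cross c r) .cap))
  Eqv n _ [⟨p, .cross c r⟩] := .ctx [] [⟨p, .cross c r⟩] (.of_rule (.zigzag_right (p + 1)))

/-- The number of colourings of a word all of whose strands end below it or at a port. -/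
def emptyTop (l : List Bool) : ℕ := if l = [] then 1 else 0

/-- The number of colourings of the strands of `w` with the colours `h` at the ports and `l` at the
bottom; `emptyTop` requires that no strand is left above. -/
def Z (h : Port E → Bool) (w : LWord V E) (l : List Bool) : ℕ := Op h w emptyTop l

theorem replicate_mem_opts (x : LEvent V E) :
    List.replicate x.top false ∈ x.opts (fun _ => false) (List.replicate x.bot false) := by
  cases x <;> simp [LEvent.opts, List.replicate, List.map_const']

/-- With white ports the all-white colouring is always admissible. Its contribution alone bounds the
sum from below, which also passes bounds on the count from a word to its upper part. -/
theorem le_Op_append {n : ℕ} (a : LWord V E) (ha : Fits n a) (F : List Bool → ℕ) :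
    F (List.replicate (out n a) false) ≤ Op (fun _ => false) a F (List.replicate n false) := by
  induction a generalizing n with
  | nil => exact le_rfl
  | cons s a ih =>
    obtain ⟨p, x⟩ := s
    have h1 : p + x.bot ≤ n := ha.1
    have e : List.replicate n false =
        List.replicate p false ++ List.replicate x.bot false ++
          List.replicate (n - (p + x.bot)) false := by
      simp only [List.replicate_append_replicate]; congr 1; omega
    rw [e, Op_split _ _ _ _ (by simp) (by simp)]
    refine le_trans (ih ha.2) (List.single_le_sum (by simp) _ ?_)
    refine List.mem_map.2 ⟨_, replicate_mem_opts x, ?_⟩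
    simp only [List.replicate_append_replicate]
    congr 2
    omega

theorem one_le_Z {n : ℕ} {w : LWord V E} (hw : Fits n w) (ho : out n w = 0) :
    1 ≤ Z (fun _ => false) w (List.replicate n false) := by
  have := le_Op_append w hw emptyTop
  rw [ho] at this
  exact this

/-- Every word without circles is equivalent to a word in normal form. -/
theorem normal_of_Z_le {n : ℕ} (w : LWord V E) (hw : Fits n w) (ho : out n w = 0)
    (hZ : Z (fun _ => false) w (List.replicate n false) ≤ 1) : Normal n (nodes w) w := by
  induction w generalizing n with
  | nil =>
    obtain rfl : n = 0 := ho
    exact ⟨[], trivial, rfl, .refl _ _⟩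
  | cons s w ih =>
    obtain ⟨p, x⟩ := s
    have hp : p + x.bot ≤ n := hw.1
    have hZ' := (le_Op_append [⟨p, x⟩] ⟨hw.1, trivial⟩ (Z (fun _ => false) w)).trans hZ
    have IH : Normal (n - x.bot + x.top) (nodes w) w := ih hw.2 ho hZ'
    cases x with
    | virt =>
      have e : n - 2 + 2 = n := by simp at hp; omega
      simp only [bot_virt, top_virt, e] at IH
      exact IH.virts (v := [𝐱 p]) (by intro s hs; obtain rfl := List.mem_singleton.1 hs; simpa using hp)
    | cap =>
      obtain ⟨m, rfl⟩ : ∃ m, n = m + 2 := ⟨n - 2, by simp at hp; omega⟩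
      exact IH.cap (by simpa using hp)
    | vertex v legs =>
      exact Normal.box (b := .vertex v legs) IH hp
    | cross c r =>
      obtain ⟨m, rfl⟩ : ∃ m, n = m + 2 := ⟨n - 2, by simp at hp; omega⟩
      have hp : p ≤ m := by simpa using hp
      have h1 := (IH.cap (p := p + 2) (by simp; omega)).cap (p := p) (by simp; omega)
      have h2 := Normal.box (b := .cross c r) (p := p + 1) (n := m + 2) h1 (by omega)
      refine .of_eqv ((cross_eqv c r (by omega)).append_right w) ?_
      simpa using h2
    | cup =>
      have hp : p ≤ n := by simpa using hp
      rcases Normal.cup (n := n) IH hp with h | ⟨c, hc, hn, h⟩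
      · exact h
      -- The split-off circle can be black or white independently of the rest, so the count would be
      -- at least 2.
      · exfalso
        have h1 := h.Op_eq (fun _ => false) emptyTop (List.replicate n false) (by simp)
        have hB := fits_boxes n (nodes w)
        have h2 := le_Op_append (n := n) (boxes (nodes w)) hB.1
          (Op (V := V) (E := E) (fun _ => false) (𝐮 0 :: 𝐧 0 :: nf c) emptyTop)
        rw [← Op_append, ← h1, hB.2, hn] at h2
        have h3 := one_le_Z (V := V) (E := E) (fits_nf hc).1 (fits_nf hc).2
        have h4 : Op (fun _ : Port E => false) (𝐮 0 :: 𝐧 0 :: nf c : LWord V E) emptyTop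
            (List.replicate (2 * c.length) false) =
              2 * Z (fun _ => false) (nf c : LWord V E) (List.replicate (2 * c.length) false) := by
          simp [Op, Z, two_mul]
        have : Op (fun _ => false) (𝐮 p :: w) emptyTop (List.replicate n false) ≤ 1 := hZ
        omega

/-! ### Rearranging the boxes -/

@[simp] theorem nodes_shift (k : ℕ) (w : LWord V E) : nodes (shift k w) = nodes w := by
  simp [nodes, shift, List.filterMap_map]

theorem slide_word {n : ℕ} (a : LWord V E) (b : Node V E) (ha : Fits n a) :
    Eqv n (a ++ b.box 0) (b.box 0 ++ shift b.size a) := by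
  induction a generalizing n with
  | nil => simpa [shift] using .refl _ _
  | cons s a ih =>
    refine .trans (.cons ha.1 (ih ha.2)) ?_
    have := (slide_box s.ev b (Nat.zero_le s.pos) ha.1).append_right (shift b.size a)
    simpa [shift, add_comm] using this

/-- Some boxes are replaced by an equivalent word, and the result is normalised again from the
beginning. This is possible because the count, and with it the absence of circles, has not changed.
Only the list of nodes has to be followed; the new pairing is left unspecified. -/
theorem Normal.of_box_eqv {A B B' : List (Node V E)} {w u u' : LWord V E}
    (hw : Fits 0 w) (ho : out 0 w = 0) (hZ : Z (fun _ => false) w [] ≤ 1)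
    (hN : Normal 0 (A ++ B) w) {C : List (Node V E)} (hB : B = B' ++ C)
    (hu : boxes B' = u) (h : Eqv (size A) u u') : Normal 0 (A ++ nodes u' ++ C) w := by
  obtain ⟨c, -, -, h3⟩ := hN
  subst hB hu
  have hA := fits_boxes 0 A
  have H : Eqv 0 w (boxes A ++ (u' ++ (boxes C ++ nf c))) := by
    refine .trans h3 ?_
    simp only [boxes, List.flatMap_append, List.append_assoc]
    refine .append_left _ (.append_right ?_ _) hA.1
    rw [show List.flatMap (Node.box 0) A = boxes A from rfl, hA.2, zero_add]
    exact h
  have := normal_of_Z_le _ (H.fits_iff.1 hw) (H.out_eq ▸ ho)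
    (by rw [Z, ← H.Op_eq _ _ _ (by rfl)]; exact hZ)
  simp only [nodes_append, nodes_boxes, nodes_nf, List.append_nil] at this
  rw [List.append_assoc]
  exact .of_eqv H this

theorem Normal.perm {w : LWord V E} (hw : Fits 0 w) (ho : out 0 w = 0)
    (hZ : Z (fun _ => false) w [] ≤ 1) {B B' : List (Node V E)} (h : B.Perm B')
    {A : List (Node V E)} (hN : Normal 0 (A ++ B) w) : Normal 0 (A ++ B') w := by
  induction h generalizing A with
  | nil => exact hN
  | cons b _ ih =>
    have := ih (A := A ++ [b]) (by simpa using hN)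
    simpa using this
  | swap b b' B =>
    have := hN.of_box_eqv hw ho hZ (B' := [b', b]) (C := B) (by simp) rfl
      (u' := b.box 0 ++ shift b.size (b'.box 0))
      (by simpa using slide_word (n := size A) _ b (fits_box b' (Nat.zero_le _)).1)
    simpa [nodes_box] using this
  | trans _ _ ih ih' => exact ih' (ih hN)

/-- The same node, with its half-edges listed from another one. -/
inductive Node.Turn : Node V E → Node V E → Prop
  | cross (c : ℕ) (r r' : Fin 4) : Turn (.cross c r) (.cross c r')
  | vertex (v : V) {l l' : List (HalfEdge E)} : l ~r l' → Turn (.vertex v l) (.vertex v l')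

/-- A rotation relation introduces a minimum and a maximum around the node, and normalising again
absorbs them. One direction of rotation is enough, because repeated rotation reaches every starting
end. -/
theorem Normal.turn_one {w : LWord V E} (hw : Fits 0 w) (ho : out 0 w = 0)
    (hZ : Z (fun _ => false) w [] ≤ 1) {b b' : Node V E} (h : b.Turn b') {A B : List (Node V E)}
    (hN : Normal 0 (A ++ b :: B) w) : Normal 0 (A ++ b' :: B) w := by
  cases h with
  | cross c r r' =>
    have one : ∀ r, Normal 0 (A ++ .cross c (r + 1) :: B) w →
        Normal 0 (A ++ .cross c r :: B) w := by
      intro r hN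
      have := hN.of_box_eqv hw ho hZ (B' := [.cross c (r + 1)]) (C := B) rfl rfl
        (u' := [𝐮 0, 𝐮 2, 𝐮 3, ⟨2, .cross c r⟩, 𝐧 1])
        (.append_left [𝐮 0, 𝐮 2] (.symm (.of_rule (.rotate_cross 1 c r))))
      simpa using this
    -- Each application of `one` lowers the number of the first end by one. Since these numbers are
    -- taken modulo 4, the difference `r - r'` tells how often to apply it.
    have many : ∀ k : ℕ, Normal 0 (A ++ .cross c (r' + Fin.ofNat 4 k) :: B) w →
        Normal 0 (A ++ .cross c r' :: B) w := by
      intro k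
      induction k with
      | zero => intro h; simpa using h
      | succ k ih =>
        intro h
        refine ih (one _ ?_)
        have e : r' + Fin.ofNat 4 (k + 1) = r' + Fin.ofNat 4 k + 1 := by
          ext; simp [Fin.val_add]; omega
        rwa [e] at h
    refine many (r - r').val ?_
    simpa using hN
  | vertex v h =>
    rename_i l l'
    obtain ⟨k, rfl⟩ := h.symm
    clear h
    induction k with
    | zero => simpa using hN
    | succ k ih =>
      refine ih ?_
      rw [← List.rotate_rotate] at hN
      generalize l'.rotate k = l at hN
      obtain _ | ⟨a, l⟩ := l
      · simpa using hN
      rw [List.rotate_cons_succ, List.rotate_zero] at hN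
      have := hN.of_box_eqv hw ho hZ (B' := [.vertex v (l ++ [a])]) (C := B) rfl rfl
        (u' := [𝐮 0, ⟨1, .vertex v (a :: l)⟩, 𝐧 0])
        (.symm (.of_rule (.rotate_vertex 0 v a l) (by simp; omega) ⟨by simp, trivial⟩))
      simpa using this

theorem Normal.turn {w : LWord V E} (hw : Fits 0 w) (ho : out 0 w = 0)
    (hZ : Z (fun _ => false) w [] ≤ 1) {B B' : List (Node V E)} (h : List.Forall₂ Node.Turn B B')
    {A : List (Node V E)} (hN : Normal 0 (A ++ B) w) : Normal 0 (A ++ B') w := by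
  induction h generalizing A with
  | nil => exact hN
  | @cons b b' _ _ h1 _ ih =>
    have := ih (A := A ++ [b']) (by simpa using hN.turn_one hw ho hZ h1)
    simpa using this

/-! ### The normal form is determined by its colourings -/

theorem Op_congr_of_nodes_eq_nil (h h' : Port E → Bool) (w : LWord V E) (hw : nodes w = []) :
    Op h w = Op h' w := by
  induction w with
  | nil => rfl
  | cons s w ih =>
    obtain ⟨p, x⟩ := s
    have e : ∀ A, x.opts h A = x.opts h' A := by
      intro A
      cases x <;> simp at hw <;> rcases A with _ | ⟨_, _ | ⟨_, _ | _⟩⟩ <;> rfl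
    have hw : nodes w = [] := by cases x <;> first | exact hw | simp at hw
    funext F l
    simp only [Op, ih hw, e]

theorem Op_desc (h : Port E → Bool) (F : List Bool → ℕ) (p : ℕ) (l A R : List Bool) (b : Bool)
    (hp : l.length = p) :
    Op h (desc p A.length : LWord V E) F (l ++ A ++ b :: R) = F (l ++ b :: A ++ R) := by
  induction A generalizing p l F with
  | nil => simp [desc, Op]
  | cons a A ih =>
    have e : l ++ a :: A ++ b :: R = (l ++ [a]) ++ A ++ b :: R := by simp
    have e' : l ++ [a] ++ b :: A ++ R = l ++ [a, b] ++ (A ++ R) := by simp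
    rw [List.length_cons, desc_succ', Op_append, e, ih _ _ _ (by simp [hp]), e',
      Op_split _ _ _ _ hp rfl]
    simp [Op]

/-- The partner is led past the strands with the colours `A` to the leftmost strand, and the maximum
joining them admits only equal colours. -/
theorem Z_nf_cons (h : Port E → Bool) (c : List ℕ) (a b : Bool) (A R : List Bool) :
    Z h (nf (A.length :: c) : LWord V E) (a :: A ++ b :: R) =
      if a = b then Z h (nf c : LWord V E) (A ++ R) else 0 := by
  have := Op_desc (V := V) h (Op h (𝐧 0 :: nf c : LWord V E) emptyTop) 1 [a] A R b rfl
  simp only [List.cons_append, List.nil_append] at this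
  rw [Z, nf, Op_append, List.cons_append, this]
  split_ifs with hab <;> simp [Op, Z, hab]

/-- A pairing is recognised by the colourings it admits. Colouring only the leftmost strand and its
partner black is admissible for exactly one position of the partner, so the first entries agree.
Giving these two strands the same colour leaves the colourings of the remaining pairings to be
compared. -/
theorem code_eq {c c' : List ℕ} (hc : CodeOK c) (hc' : CodeOK c') (hl : c.length = c'.length)
    (h : Port E → Bool)
    (H : ∀ l : List Bool, l.length = 2 * c.length →
      (0 < Z h (nf c : LWord V E) l ↔ 0 < Z h (nf c' : LWord V E) l)) : c = c' := by
  induction c generalizing c' with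
  | nil => exact (List.length_eq_zero_iff.1 hl.symm).symm
  | cons k c ih =>
    obtain _ | ⟨k', c'⟩ := c'
    · simp at hl
    replace hl : c.length = c'.length := by simpa using hl
    obtain rfl : k = k' := by
      by_contra hk
      have hk1 := hc.1
      have hk1' := hc'.1
      -- Apart from the leftmost strand, only the partner prescribed by `k` is black; the pairing
      -- with `k'` would join the leftmost strand to a white one.
      set l : List Bool := List.replicate k false ++ true :: List.replicate (2 * c.length - k) false
        with hldef
      have hlen : l.length = 2 * c.length + 1 := by simp [l]; omega
      have h1 : 0 < Z h (nf (k :: c) : LWord V E) (true :: l) := by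
        have := Z_nf_cons (V := V) h c true true (List.replicate k false)
          (List.replicate (2 * c.length - k) false)
        rw [List.length_replicate] at this
        rw [hldef, ← List.cons_append, this, if_pos rfl, List.replicate_append_replicate,
          Nat.add_sub_cancel' hk1, Z,
          Op_congr_of_nodes_eq_nil h (fun _ => false) _ (nodes_nf c)]
        exact one_le_Z (fits_nf hc.2).1 (fits_nf hc.2).2
      have h2 := (H (true :: l) (by simp [hlen]; omega)).1 h1
      have hk2 : k' < l.length := by omega
      have e : l = l.take k' ++ l[k'] :: l.drop (k' + 1) := by simp
      have e0 : l[k'] = false := by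
        simp only [l]
        rcases Nat.lt_or_gt_of_ne hk with h3 | h3
        · obtain ⟨j, hj⟩ : ∃ j, k' - k = j + 1 := ⟨k' - k - 1, by omega⟩
          rw [List.getElem_append_right (by simp; omega)]
          simp [hj]
        · rw [List.getElem_append_left (by simpa using h3)]
          simp
      have hk3 : (l.take k').length = k' := by simp; omega
      have := Z_nf_cons (V := V) h c' true false (l.take k') (l.drop (k' + 1))
      rw [hk3, List.cons_append, ← e0, ← e, e0] at this
      simp [this] at h2
    refine congrArg _ (ih hc.2 hc'.2 hl fun l hlen => ?_)
    have hk : k ≤ l.length := hlen ▸ hc.1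
    have := H (true :: l.take k ++ true :: l.drop k) (by simp; omega)
    have e := Z_nf_cons (V := V) h c true true (l.take k) (l.drop k)
    have e' := Z_nf_cons (V := V) h c' true true (l.take k) (l.drop k)
    simp only [List.length_take, Nat.min_eq_left hk, if_true, List.take_append_drop] at e e'
    rwa [e, e'] at this

/-- The half-edges at a box, from left to right. -/
def Node.ports : Node V E → List (Port E)
  | cross c r => [.inr (c, r), .inr (c, r + 1), .inr (c, r + 2), .inr (c, r + 3)]
  | vertex _ legs => legs.map .inl

theorem Node.length_ports (b : Node V E) : b.ports.length = b.size := by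
  cases b <;> simp [ports, size]

theorem Op_box (h : Port E → Bool) (b : Node V E) (F : List Bool → ℕ) (l : List Bool) :
    Op h (b.box 0) F l = F (b.ports.map h ++ l) := by
  cases b with
  | vertex v legs => simp [Node.box, Op, Node.ports, Function.comp_def]
  | cross c r =>
    cases h0 : h (.inr (c, r)) <;> cases h3 : h (.inr (c, r + 3)) <;>
      simp [Node.box, Op, Node.ports, h0, h3]

/-- The order is reversed because later boxes are inserted to the left of earlier ones. -/
def ports (B : List (Node V E)) : List (Port E) := B.reverse.flatMap Node.ports

theorem length_ports (B : List (Node V E)) : (ports B).length = size B := by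
  simp [ports, List.length_flatMap, size, Node.length_ports, List.sum_reverse]

theorem Op_boxes (h : Port E → Bool) (B : List (Node V E)) (F : List Bool → ℕ) (l : List Bool) :
    Op h (boxes B) F l = F ((ports B).map h ++ l) := by
  induction B generalizing l with
  | nil => rfl
  | cons b B ih =>
    rw [boxes_cons, Op_append, Op_box, ih]
    simp [ports]

theorem exists_map_eq {α : Type*} {P : List α} (hP : P.Nodup) (l : List Bool)
    (hl : P.length = l.length) : ∃ h : α → Bool, P.map h = l := by
  classical
  refine ⟨fun x => l.getD (P.idxOf x) false, List.ext_getElem (by simpa using hl) fun i h1 h2 => ?_⟩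
  simp [hP.idxOf_getElem, h2]

/-- Words in normal form with the same boxes and the same colourings are equal. -/
theorem normal_unique {B : List (Node V E)} (hB : (ports B).Nodup) {c c' : List ℕ}
    (hc : CodeOK c) (hc' : CodeOK c') (hl : size B = 2 * c.length) (hl' : size B = 2 * c'.length)
    (H : ∀ h, 0 < Z h (boxes B ++ nf c) [] ↔ 0 < Z h (boxes B ++ nf c') []) : c = c' := by
  refine code_eq (V := V) (E := E) hc hc' (by omega) (fun _ => false) fun l hlen => ?_
  -- Since the ports are distinct they can be coloured independently, and every list of colours
  -- reaches the pairing above the boxes.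
  obtain ⟨h, e⟩ := exists_map_eq hB l (by rw [length_ports]; omega)
  have := H h
  rw [Z, Z, Op_append, Op_append, Op_boxes, Op_boxes, List.append_nil, e,
    Op_congr_of_nodes_eq_nil h (fun _ => false) _ (nodes_nf c),
    Op_congr_of_nodes_eq_nil h (fun _ => false) _ (nodes_nf c')] at this
  exact this

/-! ### Colourings of the strands -/

/-- The colours `f` below and `g` above a slice fit together; there are `n` strands below it. -/
def StepOK (h : Port E → Bool) (s : LSlice V E) (n : ℕ) (f g : ℕ → Bool) : Prop :=
  (∀ i < s.pos, g i = f i) ∧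
    (∀ i < n - (s.pos + s.ev.bot), g (s.pos + s.ev.top + i) = f (s.pos + s.ev.bot + i)) ∧
    ((List.range s.ev.top).map fun i => g (s.pos + i)) ∈
      s.ev.opts h ((List.range s.ev.bot).map fun i => f (s.pos + i))

/-- The colours `g t i` of the strands `i` at the levels `t` of a word fit together. -/
def Coloring (h : Port E → Bool) : ℕ → LWord V E → (ℕ → ℕ → Bool) → Prop
  | n, [], _ => n = 0
  | n, s :: w, g => StepOK h s n (g 0) (g 1) ∧
      Coloring h (n - s.ev.bot + s.ev.top) w fun t => g (t + 1)

def colors (n : ℕ) (f : ℕ → Bool) : List Bool := (List.range n).map f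

theorem colors_add (a b : ℕ) (f : ℕ → Bool) :
    colors (a + b) f = colors a f ++ colors b fun i => f (a + i) := by
  simp [colors, List.range_add, Function.comp_def]

theorem Z_cons (h : Port E → Bool) {s : LSlice V E} {w : LWord V E} {n : ℕ} {f : ℕ → Bool}
    (hs : s.pos + s.ev.bot ≤ n) :
    Z h (s :: w) (colors n f) = ((s.ev.opts h (colors s.ev.bot fun i => f (s.pos + i))).map fun B =>
      Z h w (colors s.pos f ++ B ++
        colors (n - (s.pos + s.ev.bot)) fun i => f (s.pos + s.ev.bot + i))).sum := by
  obtain ⟨m, rfl⟩ := Nat.exists_eq_add_of_le hs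
  obtain ⟨p, x⟩ := s
  rw [colors_add, colors_add]
  simp only [Nat.add_sub_cancel_left]
  exact Op_split h w _ _ (by simp [colors]) (by simp [colors])

theorem StepOK.colors_eq {h : Port E → Bool} {s : LSlice V E} {n : ℕ} {f g : ℕ → Bool}
    (H : StepOK h s n f g) (hs : s.pos + s.ev.bot ≤ n) :
    colors (n - s.ev.bot + s.ev.top) g = colors s.pos f ++
      colors s.ev.top (fun i => g (s.pos + i)) ++
        colors (n - (s.pos + s.ev.bot)) fun i => f (s.pos + s.ev.bot + i) := by
  have e : n - s.ev.bot + s.ev.top = s.pos + s.ev.top + (n - (s.pos + s.ev.bot)) := by omega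
  rw [e, colors_add, colors_add]
  congr 1
  · congr 1
    exact List.map_congr_left fun i hi => H.1 i (List.mem_range.1 hi)
  · exact List.map_congr_left fun i hi => H.2.1 i (List.mem_range.1 hi)

theorem StepOK.congr {h : Port E → Bool} {s : LSlice V E} {n : ℕ} {f g f' g' : ℕ → Bool}
    (H : StepOK h s n f g) (hs : s.pos + s.ev.bot ≤ n) (hf : ∀ i < n, f' i = f i)
    (hg : ∀ i < n - s.ev.bot + s.ev.top, g' i = g i) : StepOK h s n f' g' := by
  refine ⟨fun i hi => ?_, fun i hi => ?_, ?_⟩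
  · rw [hf i (by omega), hg i (by omega), H.1 i hi]
  · rw [hf _ (by omega), hg _ (by omega), H.2.1 i hi]
  · have e : ((List.range s.ev.top).map fun i => g' (s.pos + i)) =
        (List.range s.ev.top).map fun i => g (s.pos + i) :=
      List.map_congr_left fun i hi => hg _ (by have := List.mem_range.1 hi; omega)
    have e' : ((List.range s.ev.bot).map fun i => f' (s.pos + i)) =
        (List.range s.ev.bot).map fun i => f (s.pos + i) :=
      List.map_congr_left fun i hi => hf _ (by have := List.mem_range.1 hi; omega)
    rw [e, e']
    exact H.2.2

/-- The colours `g` above the slice select one summand of the count below it. -/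
theorem Coloring.le_Z {h : Port E → Bool} {s : LSlice V E} {n : ℕ} {f g : ℕ → Bool}
    (H : StepOK h s n f g) (hs : s.pos + s.ev.bot ≤ n) (w : LWord V E) :
    Z h w (colors (n - s.ev.bot + s.ev.top) g) ≤ Z h (s :: w) (colors n f) := by
  rw [Z_cons h hs, H.colors_eq hs]
  exact List.single_le_sum (by simp) _ (List.mem_map.2 ⟨_, H.2.2, rfl⟩)

theorem Coloring.Z_pos {h : Port E → Bool} {n : ℕ} {w : LWord V E} {g : ℕ → ℕ → Bool}
    (H : Coloring h n w g) (hw : Fits n w) : 0 < Z h w (colors n (g 0)) := by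
  induction w generalizing n g with
  | nil => obtain rfl : n = 0 := H; exact Nat.one_pos
  | cons s w ih => exact (ih H.2 hw.2).trans_le (le_Z H.1 hw.1 w)

theorem exists_colors (l : List Bool) : ∃ f, colors l.length f = l :=
  ⟨fun i => l.getD i false, List.ext_getElem (by simp [colors]) fun i h1 h2 => by
    simp [colors, h2]⟩

theorem exists_stepOK {h : Port E → Bool} {s : LSlice V E} {n : ℕ} {f : ℕ → Bool} {B : List Bool}
    (hB : B ∈ s.ev.opts h (colors s.ev.bot fun i => f (s.pos + i))) :
    ∃ g, StepOK h s n f g ∧ colors s.ev.top (fun i => g (s.pos + i)) = B := by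
  have hl := LEvent.length_of_mem_opts hB
  obtain ⟨b, hb⟩ := exists_colors B
  set g : ℕ → Bool := fun i => if i < s.pos then f i else if i < s.pos + s.ev.top then b (i - s.pos)
    else f (i - s.ev.top + s.ev.bot)
  have e : colors s.ev.top (fun i => g (s.pos + i)) = B := by
    rw [← hl]
    conv_rhs => rw [← hb]
    refine List.map_congr_left fun i hi => ?_
    have := List.mem_range.1 hi
    simp [g, ← hl, this]
  refine ⟨g, ⟨fun i hi => by simp [g, hi], fun i _ => ?_, ?_⟩, e⟩
  · simp only [g]
    rw [if_neg (by omega), if_neg (by omega)]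
    congr 1; omega
  · change colors s.ev.top (fun i => g (s.pos + i)) ∈ _
    rw [e]; exact hB

/-- Extend a colouring downwards. -/
def consColor (f : ℕ → Bool) (g : ℕ → ℕ → Bool) : ℕ → ℕ → Bool
  | 0 => f
  | t + 1 => g t

/-- A positive count has a nonzero summand at each slice; following these summands upwards builds
the colouring. -/
theorem exists_coloring {h : Port E → Bool} {n : ℕ} {w : LWord V E} (hw : Fits n w)
    (ho : out n w = 0) {f : ℕ → Bool} (hZ : 0 < Z h w (colors n f)) :
    ∃ g, Coloring h n w g ∧ g 0 = f := by
  induction w generalizing n f with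
  | nil => exact ⟨fun _ => f, ho, rfl⟩
  | cons s w ih =>
    rw [Z_cons h hw.1] at hZ
    obtain ⟨y, hy, hy0⟩ := List.exists_mem_ne_zero_of_sum_ne_zero hZ.ne'
    obtain ⟨B, hB, rfl⟩ := List.mem_map.1 hy
    obtain ⟨g₁, h1, h2⟩ := exists_stepOK (n := n) hB
    rw [← h2, ← h1.colors_eq hw.1] at hy0
    obtain ⟨g, h3, h4⟩ := ih hw.2 ho (Nat.pos_of_ne_zero hy0)
    refine ⟨consColor f g, ⟨?_, h3⟩, rfl⟩
    change StepOK h s n f (g 0)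
    rw [h4]; exact h1

theorem colors_false (n : ℕ) : colors n (fun _ => false) = List.replicate n false := by
  simp [colors, List.map_const']

theorem stepOK_false (s : LSlice V E) (n : ℕ) :
    StepOK (fun _ => false) s n (fun _ => false) fun _ => false := by
  refine ⟨fun _ _ => rfl, fun _ _ => rfl, ?_⟩
  have := replicate_mem_opts s.ev
  simpa [List.map_const'] using this

theorem add_le_sum_map {α : Type*} {l : List α} {f : α → ℕ} {a b : α} (ha : a ∈ l) (hb : b ∈ l)
    (hab : a ≠ b) : f a + f b ≤ (l.map f).sum := by
  induction l with
  | nil => simp at ha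
  | cons c l ih =>
    have le : ∀ x ∈ l, f x ≤ (l.map f).sum := fun x hx =>
      List.single_le_sum (by simp) _ (List.mem_map.2 ⟨x, hx, rfl⟩)
    rcases List.mem_cons.1 ha with h1 | h1 <;> rcases List.mem_cons.1 hb with h2 | h2
    · exact absurd (h1.trans h2.symm) hab
    · subst h1; have := le b h2; simp; omega
    · subst h2; have := le a h1; simp; omega
    · have := ih h1 h2; simp; omega

/-- If there is at most one colouring with white ports then every such colouring is white. -/
theorem Coloring.eq_false {n : ℕ} {w : LWord V E} (hw : Fits n w) (ho : out n w = 0)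
    (hZ : Z (fun _ => false) w (List.replicate n false) ≤ 1) {g : ℕ → ℕ → Bool}
    (H : Coloring (fun _ => false) n w g) (h0 : ∀ i < n, g 0 i = false) (t i : ℕ)
    (ht : t ≤ w.length) (hi : i < out n (w.take t)) : g t i = false := by
  induction w generalizing n g t with
  | nil =>
    obtain rfl : n = 0 := ho
    simp at hi
  | cons s w ih =>
    obtain _ | t := t
    · exact h0 i hi
    have hc : colors n (g 0) = List.replicate n false := by
      rw [← colors_false]
      exact List.map_congr_left fun i hi => h0 i (List.mem_range.1 hi)
    have hle := le_Z H.1 hw.1 w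
    rw [hc] at hle
    have h1 : ∀ i < n - s.ev.bot + s.ev.top, g 1 i = false := by
      -- A row that is not white directly above a white row would contribute a second summand
      -- besides the white one. Both summands are positive, so the count would be at least 2.
      by_contra hne
      have e : colors s.ev.bot (fun i => g 0 (s.pos + i)) =
          colors s.ev.bot (fun _ => false) := by
        refine List.map_congr_left fun i hi => h0 _ ?_
        have := List.mem_range.1 hi; have := hw.1; omega
      have f1 := H.1.2.2
      change colors _ (fun i => g 1 (s.pos + i)) ∈ LEvent.opts _ _ (colors _ _) at f1
      rw [e] at f1
      have f2 := (stepOK_false s n).2.2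
      change colors _ (fun _ => false) ∈ LEvent.opts _ _ (colors _ _) at f2
      have ne : colors s.ev.top (fun i => g 1 (s.pos + i)) ≠ colors s.ev.top (fun _ => false) := by
        intro hEq
        apply hne
        have hc1 := H.1.colors_eq hw.1
        have hc2 := (stepOK_false s n).colors_eq hw.1
        intro i hi
        have e1 : colors s.pos (g 0) = colors s.pos fun _ => false :=
          List.map_congr_left fun i hi => h0 i (by
            have := List.mem_range.1 hi; have := hw.1; omega)
        have e2 : (colors (n - (s.pos + s.ev.bot)) fun i => g 0 (s.pos + s.ev.bot + i)) =
            colors (n - (s.pos + s.ev.bot)) fun _ => false :=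
          List.map_congr_left fun i hi => h0 _ (by
            have := List.mem_range.1 hi; have := hw.1; omega)
        rw [hEq, e1, e2] at hc1
        exact List.map_inj_left.1 (hc1.trans hc2.symm) i (List.mem_range.2 hi)
      have key := add_le_sum_map f1 f2 ne (f := fun B => Z (fun _ => false) w
        (colors s.pos (fun _ => false) ++ B ++
        colors (n - (s.pos + s.ev.bot)) fun _ => false))
      rw [← Z_cons _ hw.1, colors_false n, ← (stepOK_false s n).colors_eq hw.1] at key
      have g1 := one_le_Z hw.2 ho
      have g2 : 0 < Z _ w (colors _ (g 1)) := H.2.Z_pos hw.2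
      rw [H.1.colors_eq hw.1] at g2
      have e1 : colors s.pos (g 0) = colors s.pos fun _ => false :=
        List.map_congr_left fun i hi => h0 i (by
          have := List.mem_range.1 hi; have := hw.1; omega)
      have e2 : (colors (n - (s.pos + s.ev.bot)) fun i => g 0 (s.pos + s.ev.bot + i)) =
          colors (n - (s.pos + s.ev.bot)) fun _ => false :=
        List.map_congr_left fun i hi => h0 _ (by
          have := List.mem_range.1 hi; have := hw.1; omega)
      rw [e1, e2] at g2
      simp only [colors_false] at key g2
      omega
    refine ih hw.2 ho ?_ H.2 h1 t (by simpa using ht) hi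
    have := (le_Z (stepOK_false s n) hw.1 w).trans
      ((le_of_eq (by rw [colors_false])).trans hZ)
    rwa [colors_false] at this

/-- If every colouring with white ports is white then there is at most one. -/
theorem Z_le_one {n : ℕ} {w : LWord V E} (hw : Fits n w) (ho : out n w = 0)
    (H : ∀ g, Coloring (fun _ => false) n w g → (∀ i < n, g 0 i = false) →
      ∀ t i, t ≤ w.length → i < out n (w.take t) → g t i = false) :
    Z (fun _ => false) w (List.replicate n false) ≤ 1 := by
  induction w generalizing n with
  | nil => obtain rfl : n = 0 := ho; exact le_rfl
  | cons s w ih =>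
    have IH := ih hw.2 ho fun g hg h0 t i ht hi => by
      refine H (consColor (fun _ => false) g) ⟨?_, hg⟩ (fun _ _ => rfl) (t + 1) i
        (by simpa using ht) hi
      exact (stepOK_false s n).congr hw.1 (fun _ _ => rfl) h0
    rw [← colors_false, Z_cons _ hw.1]
    obtain ⟨p, x⟩ := s
    have key : ∀ B, B ∈ x.opts (fun _ => false) (colors x.bot fun _ => false) →
        B ≠ List.replicate x.top false →
        Z (fun _ => false) w (colors p (fun _ => false) ++ B ++
          colors (n - (p + x.bot)) fun _ => false) = 0 := by
      intro B hB hne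
      by_contra hZ
      obtain ⟨g₁, h1, h2⟩ := exists_stepOK (s := ⟨p, x⟩) (n := n) (f := fun _ => false) hB
      have hZ' := hZ
      rw [← h2] at hZ'
      simp only at hZ'
      have h1e := h1.colors_eq hw.1
      simp only at h1e
      rw [← h1e] at hZ'
      obtain ⟨g, h3, h4⟩ := exists_coloring hw.2 ho (Nat.pos_of_ne_zero hZ')
      apply hne
      rw [← h2]
      refine List.eq_replicate_iff.2 ⟨by simp [colors], fun b hb => ?_⟩
      obtain ⟨i, hi, rfl⟩ := List.mem_map.1 hb
      have h5 := List.mem_range.1 hi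
      have := H (consColor (fun _ => false) g) ⟨by change StepOK _ _ _ _ (g 0); rw [h4]; exact h1, h3⟩
        (fun _ _ => rfl) 1 (p + i) (by simp) (by have := hw.1; simp at this h5 ⊢; omega)
      rw [← this]
      change g₁ _ = g 0 _
      rw [h4]
    have main : Z (fun _ => false) w (colors p (fun _ => false) ++ List.replicate x.top false ++
          colors (n - (p + x.bot)) fun _ => false) ≤ 1 := by
      have := (stepOK_false (⟨p, x⟩ : LSlice V E) n).colors_eq hw.1
      simp only [colors_false] at this ⊢
      rw [← this]
      exact IH
    -- Over a white row only a minimum leaves a choice, and its black option contributes nothing by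
    -- `key`. All other events force the next row.
    cases x with
    | cup =>
      have := key [true, true] (by simp [colors]) (by simp [List.replicate])
      simp only [bot_cup, colors, List.range_zero, List.map_nil, opts_cup, List.map_cons,
        List.sum_cons, List.sum_nil] at *
      simp only [top_cup, List.replicate] at main
      omega
    | cap => simpa [colors, List.range_succ] using main
    | virt => simpa [colors, List.range_succ, List.replicate] using main
    | cross c r => simpa [colors, List.range_succ, List.replicate] using main
    | vertex v legs => simpa [colors, List.map_const', add_assoc] using main

/-! ### Travelling along strands -/

/-- The same place, looking in the opposite direction. -/
def Loc.rev (l : Loc) : Loc := ⟨l.level, l.pos, !l.up⟩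

@[simp] theorem Loc.rev_rev (l : Loc) : l.rev.rev = l := by simp [Loc.rev]
@[simp] theorem Loc.rev_level (l : Loc) : l.rev.level = l.level := rfl
@[simp] theorem Loc.rev_pos (l : Loc) : l.rev.pos = l.pos := rfl

/-- Every step can be reversed. -/
theorem Word.next_rev (w : Word V E) {l l' : Loc} {es : List (ℕ × Bool)}
    (h : w.next l = .go l' es) : w.next l'.rev = .go l.rev es := by
  obtain ⟨t, i, _ | _⟩ := l
  · obtain _ | t := t
    · simp [Word.next] at h
    simp only [Word.next] at h
    split at h
    · rename_i s hs
      simp only [Slice.goDown] at h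
      split_ifs at h with h1 h2
      · cases h
        simp [Loc.rev, Word.next, hs, Slice.goUp, h1]
      · cases h
        have e1 : ¬ i - s.ev.top + s.ev.bot < s.pos := by omega
        have e2 : s.pos + s.ev.bot ≤ i - s.ev.top + s.ev.bot := by omega
        have e3 : s.ev.top ≤ i := by omega
        simp [Loc.rev, Word.next, hs, Slice.goUp, e1, e2, e3]
      · obtain ⟨p, x⟩ := s
        simp only at h1 h2 h
        split at h
        · cases h
          simp only [Event.top] at h2
          have e1 : ¬ 2 * p + 1 - i < p := by omega
          have e2 : ¬ p + 2 ≤ 2 * p + 1 - i := by omega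
          simp [Loc.rev, Word.next, hs, Slice.goDown, e1, e2, Event.top]
          omega
        · rename_i k
          cases h
          simp only [Event.top] at h2
          have e1 : ¬ 2 * p + 1 - i < p := by omega
          have e2 : ¬ p + 2 ≤ 2 * p + 1 - i := by omega
          have e3 : (2 * p + 1 - i == p) = (i == p + 1) := by
            rw [Bool.eq_iff_iff]; simp; omega
          simp [Loc.rev, Word.next, hs, Slice.goUp, e1, e2, e3, Event.bot]
          omega
        · split at h <;> cases h
        · cases h
    · cases h
  · simp only [Word.next] at h
    split at h
    · rename_i s hs
      simp only [Slice.goUp] at h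
      split_ifs at h with h1 h2
      · cases h
        simp [Loc.rev, Word.next, hs, Slice.goDown, h1]
      · cases h
        have e1 : ¬ i - s.ev.bot + s.ev.top < s.pos := by omega
        have e2 : s.pos + s.ev.top ≤ i - s.ev.bot + s.ev.top := by omega
        have e3 : s.ev.bot ≤ i := by omega
        simp [Loc.rev, Word.next, hs, Slice.goDown, e1, e2, e3]
      · obtain ⟨p, x⟩ := s
        simp only at h1 h2 h
        split at h
        · cases h
          simp only [Event.bot] at h2
          have e1 : ¬ 2 * p + 1 - i < p := by omega
          have e2 : ¬ p + 2 ≤ 2 * p + 1 - i := by omega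
          simp [Loc.rev, Word.next, hs, Slice.goUp, e1, e2, Event.bot]
          omega
        · rename_i k
          cases h
          simp only [Event.bot] at h2
          have e1 : ¬ 2 * p + 1 - i < p := by omega
          have e2 : ¬ p + 2 ≤ 2 * p + 1 - i := by omega
          have e3 : (2 * p + 1 - i == p + 1) = (i == p) := by
            rw [Bool.eq_iff_iff]; simp; omega
          simp [Loc.rev, Word.next, hs, Slice.goDown, e1, e2, e3, Event.top]
          omega
        · cases h
    · cases h

theorem Word.next_eq_arrive_iff (w : Word V E) {l : Loc} {h : HalfEdge E} :
    w.next l = .arrive h ↔ ∃ t p v legs j, w[t]? = some ⟨p, .vertex v legs⟩ ∧ legs[j]? = some h ∧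
      l = ⟨t + 1, p + j, false⟩ := by
  constructor
  · intro H
    obtain ⟨t, i, _ | _⟩ := l
    · obtain _ | t := t
      · simp [Word.next] at H
      simp only [Word.next] at H
      split at H
      · rename_i s hs
        simp only [Slice.goDown] at H
        split_ifs at H with h1 h2
        obtain ⟨p, x⟩ := s
        simp only at h1 h2 H
        split at H
        · cases H
        · cases H
        · rename_i v legs
          split at H
          · rename_i h' hj
            cases H
            exact ⟨t, p, v, legs, i - p, hs, hj, by simp; omega⟩
          · cases H
        · cases H
      · cases H
    · simp only [Word.next] at H
      split at H
      · rename_i s hs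
        simp only [Slice.goUp] at H
        split_ifs at H with h1 h2
        split at H <;> cases H
      · cases H
  · rintro ⟨t, p, v, legs, j, hs, hj, rfl⟩
    have h1 : ¬ p + j < p := by omega
    have h2 : ¬ p + legs.length ≤ p + j := by
      have := (List.getElem?_eq_some_iff.1 hj).1; omega
    simp only [Word.next, hs, Slice.goDown, Event.top, if_neg h1, if_neg h2,
      Nat.add_sub_cancel_left, hj]

theorem Word.isStart_iff (w : Word V E) {l : Loc} {h : HalfEdge E} :
    w.IsStart h l ↔ w.next l.rev = .arrive h := by
  rw [w.next_eq_arrive_iff]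
  refine exists_congr fun t => exists_congr fun p => exists_congr fun v => exists_congr fun legs =>
    exists_congr fun j => and_congr_right fun _ => and_congr_right fun _ => ?_
  obtain ⟨a, b, c⟩ := l
  simp [Loc.rev]

/-- The next thing met by a traveller at `l` is the port `z`. -/
inductive Arrives (w : LWord V E) : Loc → Port E → Prop
  | half {l : Loc} {h : HalfEdge E} : w.toWord.next l = .arrive h → Arrives w l (.inl h)
  | bl {t p c : ℕ} {r : Fin 4} : w[t]? = some ⟨p, .cross c r⟩ →
      Arrives w ⟨t, p, true⟩ (.inr (c, r))
  | br {t p c : ℕ} {r : Fin 4} : w[t]? = some ⟨p, .cross c r⟩ →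
      Arrives w ⟨t, p + 1, true⟩ (.inr (c, r + 3))
  | tl {t p c : ℕ} {r : Fin 4} : w[t]? = some ⟨p, .cross c r⟩ →
      Arrives w ⟨t + 1, p, false⟩ (.inr (c, r + 1))
  | tr {t p c : ℕ} {r : Fin 4} : w[t]? = some ⟨p, .cross c r⟩ →
      Arrives w ⟨t + 1, p + 1, false⟩ (.inr (c, r + 2))

theorem toWord_getElem? (w : LWord V E) (t : ℕ) :
    w.toWord[t]? = (w[t]?).map LSlice.toSlice := by simp [LWord.toWord]

theorem kindOf_record (r : Fin 4) (t : ℕ) (b : Bool) :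
    (kindOf r).record t b = [(t, if r.val % 2 = 0 then b else !b)] := by
  unfold kindOf; split <;> rfl

/-- The ends of the strands at a crossing in slice `t`, for travellers that arrive there. -/
def corner (t p : ℕ) (k : Fin 4) : Loc :=
  match k with
  | 0 => ⟨t, p, true⟩
  | 1 => ⟨t + 1, p, false⟩
  | 2 => ⟨t + 1, p + 1, false⟩
  | 3 => ⟨t, p + 1, true⟩

/-- The four ways of arriving at a crossing become one, with the end number computed modulo 4. -/
theorem arrives_cross_iff {w : LWord V E} {l : Loc} {c : ℕ} {i : Fin 4} :
    Arrives w l (.inr (c, i)) ↔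
      ∃ t p r, w[t]? = some ⟨p, .cross c r⟩ ∧ l = corner t p (i - r) := by
  constructor
  · intro H
    cases H with
    | bl hs => exact ⟨_, _, _, hs, by simp [corner]⟩
    | br hs => exact ⟨_, _, _, hs, by simp [corner]⟩
    | tl hs => exact ⟨_, _, _, hs, by simp [corner]⟩
    | tr hs => exact ⟨_, _, _, hs, by simp [corner]⟩
  · rintro ⟨t, p, r, hs, rfl⟩
    obtain ⟨k, rfl⟩ : ∃ k, i = r + k := ⟨i - r, by simp⟩
    rw [add_sub_cancel_left]
    fin_cases k
    · simpa [corner] using Arrives.bl hs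
    · exact Arrives.tl hs
    · exact Arrives.tr hs
    · exact Arrives.br hs

/-- A strand goes straight through, hence leaves by the opposite corner `k + 2`. The ends with even
number belong to the upper strand. -/
theorem next_corner {w : LWord V E} {t p c : ℕ} {r : Fin 4} (hs : w[t]? = some ⟨p, .cross c r⟩)
    (k : Fin 4) : w.toWord.next (corner t p k) =
      .go (corner t p (k + 2)).rev [(t, decide ((r + k).val % 2 = 0))] := by
  have f1 (p : ℕ) : (p + 1 == p) = false := by simp
  have f2 (p : ℕ) : (p == p + 1) = false := by simp
  have f3 (p : ℕ) : 2 * p + 1 - p = p + 1 := by omega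
  have f4 (p : ℕ) : 2 * p + 1 - (p + 1) = p := by omega
  fin_cases k <;>
    simp only [corner, Loc.rev, Word.next, toWord_getElem?, hs, LSlice.toSlice, Slice.goUp,
      Slice.goDown, LEvent.toEvent, Event.bot, Event.top, kindOf_record, Option.map_some, f1, f2,
      f3, f4, beq_self_eq_true] <;>
    simp <;> fin_cases r <;> simp

theorem Arrives.pass {w : LWord V E} {l : Loc} {c : ℕ} {i : Fin 4}
    (H : Arrives w l (.inr (c, i))) :
    ∃ t p r l', w[t]? = some ⟨p, .cross c r⟩ ∧ l = corner t p (i - r) ∧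
      w.toWord.next l = .go l' [(t, decide (i.val % 2 = 0))] ∧
        Arrives w l'.rev (.inr (c, i + 2)) := by
  obtain ⟨t, p, r, hs, rfl⟩ := arrives_cross_iff.1 H
  refine ⟨t, p, r, _, hs, rfl, by simpa using next_corner hs (i - r), ?_⟩
  rw [Loc.rev_rev]
  exact arrives_cross_iff.2 ⟨t, p, r, hs, by rw [add_sub_right_comm]⟩

theorem Arrives.not_go {w : LWord V E} {l l' : Loc} {z : Port E} (H : Arrives w l z) :
    w.toWord.next l ≠ .go l' [] := by
  obtain h | ⟨c, i⟩ := z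
  · cases H with
    | half H => rw [H]; simp
  · obtain ⟨t, p, r, l', -, -, h, -⟩ := H.pass
    rw [h]; simp

theorem Arrives.det {w : LWord V E} {l : Loc} {z z' : Port E} (H : Arrives w l z)
    (H' : Arrives w l z') : z = z' := by
  obtain h | z := z <;> obtain h' | z' := z'
  · cases H with
    | half H =>
      cases H' with
      | half H' => rw [H] at H'; cases H'; rfl
  · cases H with
    | half H => obtain ⟨t, p, r, l', -, -, h, -⟩ := H'.pass; rw [H] at h; cases h
  · cases H' with
    | half H' => obtain ⟨t, p, r, l', -, -, h, -⟩ := H.pass; rw [H'] at h; cases h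
  · cases H with
    | bl hs => cases H' with
      | bl hs' => rw [hs] at hs'; cases hs'; rfl
      | br hs' => rw [hs] at hs'; simp at hs'
    | br hs => cases H' with
      | bl hs' => rw [hs] at hs'; simp at hs'
      | br hs' => rw [hs] at hs'; cases hs'; rfl
    | tl hs => cases H' with
      | tl hs' => rw [hs] at hs'; cases hs'; rfl
      | tr hs' => rw [hs] at hs'; simp at hs'
    | tr hs => cases H' with
      | tl hs' => rw [hs] at hs'; simp at hs'
      | tr hs' => rw [hs] at hs'; cases hs'; rfl

/-- The number of strands at the level `t`. -/
def W (w : LWord V E) (t : ℕ) : ℕ := out 0 (w.take t)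

theorem W_succ {w : LWord V E} {t : ℕ} {s : LSlice V E} (hs : w[t]? = some s) :
    W w (t + 1) = W w t - s.ev.bot + s.ev.top := by
  rw [W, List.take_add_one, out_append, hs]
  rfl

theorem fits_getElem? {n : ℕ} {w : LWord V E} (hw : Fits n w) {t : ℕ} {s : LSlice V E}
    (hs : w[t]? = some s) : s.pos + s.ev.bot ≤ out n (w.take t) := by
  induction w generalizing n t with
  | nil => simp at hs
  | cons s' w ih =>
    obtain _ | t := t
    · simp at hs; subst hs; exact hw.1
    · exact ih hw.2 (by simpa using hs)

theorem W_of_length_le {w : LWord V E} (ho : out 0 w = 0) {t : ℕ} (ht : w.length ≤ t) :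
    W w t = 0 := by rw [W, List.take_of_length_le ht, ho]

@[simp] theorem W_zero (w : LWord V E) : W w 0 = 0 := by simp [W]

/-- Each step from a strand of the diagram leads to a strand or to a vertex. -/
theorem next_cases {w : LWord V E} (hw : Fits 0 w) (ho : out 0 w = 0) {l : Loc}
    (hl : l.pos < W w l.level) :
    (∃ l', w.toWord.next l = .go l' [] ∧ l'.pos < W w l'.level) ∨ ∃ z, Arrives w l z := by
  obtain ⟨t, i, _ | _⟩ := l
  · obtain _ | t := t
    · simp at hl
    simp only at hl
    have ht : t < w.length := by
      by_contra h
      rw [W_of_length_le ho (by omega)] at hl; omega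
    have hs : ∃ s, w[t]? = some s := ⟨_, List.getElem?_eq_getElem ht⟩
    obtain ⟨⟨p, x⟩, hs⟩ := hs
    have h1 := W_succ hs
    have h2 : p + x.bot ≤ W w t := fits_getElem? hw hs
    simp only at h1
    by_cases h3 : i < p
    · left
      exact ⟨⟨t, i, false⟩, by
        simp [Word.next, toWord_getElem?, hs, LSlice.toSlice, Slice.goDown, h3], by simp; omega⟩
    by_cases h4 : p + x.top ≤ i
    · left
      exact ⟨⟨t, i - x.top + x.bot, false⟩, by
        simp [Word.next, toWord_getElem?, hs, LSlice.toSlice, Slice.goDown, h3, h4],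
        by simp; omega⟩
    cases x with
    | cup =>
      left
      simp only [top_cup] at *
      exact ⟨⟨t + 1, 2 * p + 1 - i, true⟩, by
        simp [Word.next, toWord_getElem?, hs, LSlice.toSlice, Slice.goDown, h3, h4,
          LEvent.toEvent, Event.top], by simp; omega⟩
    | cap => simp at h4; omega
    | virt =>
      left
      simp only [top_virt, bot_virt] at *
      exact ⟨⟨t, 2 * p + 1 - i, false⟩, by
        simp [Word.next, toWord_getElem?, hs, LSlice.toSlice, Slice.goDown, h3, h4,
          LEvent.toEvent, Event.top, Kind.record], by simp; omega⟩
    | cross c r =>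
      right
      simp only [top_cross] at h4
      obtain rfl | rfl : i = p ∨ i = p + 1 := by omega
      · exact ⟨_, .tl hs⟩
      · exact ⟨_, .tr hs⟩
    | vertex v legs =>
      right
      simp only [top_vertex] at h4
      obtain ⟨j, rfl⟩ := Nat.exists_eq_add_of_le (not_lt.1 h3)
      have hj : j < legs.length := by omega
      refine ⟨_, .half ((Word.next_eq_arrive_iff _).2
        ⟨t, p, v, legs, j, by simp [toWord_getElem?, hs, LSlice.toSlice, LEvent.toEvent],
          List.getElem?_eq_getElem hj, rfl⟩)⟩
  · simp only at hl
    have ht : t < w.length := by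
      by_contra h
      rw [W_of_length_le ho (by omega)] at hl; omega
    have hs : ∃ s, w[t]? = some s := ⟨_, List.getElem?_eq_getElem ht⟩
    obtain ⟨⟨p, x⟩, hs⟩ := hs
    have h1 := W_succ hs
    have h2 : p + x.bot ≤ W w t := fits_getElem? hw hs
    simp only at h1
    by_cases h3 : i < p
    · left
      exact ⟨⟨t + 1, i, true⟩, by
        simp [Word.next, toWord_getElem?, hs, LSlice.toSlice, Slice.goUp, h3], by simp; omega⟩
    by_cases h4 : p + x.bot ≤ i
    · left
      exact ⟨⟨t + 1, i - x.bot + x.top, true⟩, by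
        simp [Word.next, toWord_getElem?, hs, LSlice.toSlice, Slice.goUp, h3, h4],
        by simp; omega⟩
    cases x with
    | cup => simp at h4; omega
    | cap =>
      left
      simp only [bot_cap] at *
      exact ⟨⟨t, 2 * p + 1 - i, false⟩, by
        simp [Word.next, toWord_getElem?, hs, LSlice.toSlice, Slice.goUp, h3, h4,
          LEvent.toEvent, Event.bot], by simp; omega⟩
    | virt =>
      left
      simp only [top_virt, bot_virt] at *
      exact ⟨⟨t + 1, 2 * p + 1 - i, true⟩, by
        simp [Word.next, toWord_getElem?, hs, LSlice.toSlice, Slice.goUp, h3, h4,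
          LEvent.toEvent, Event.bot, Kind.record], by simp; omega⟩
    | cross c r =>
      right
      simp only [bot_cross] at h4
      obtain rfl | rfl : i = p ∨ i = p + 1 := by omega
      · exact ⟨_, .bl hs⟩
      · exact ⟨_, .br hs⟩
    | vertex v legs => simp at h4; omega

/-- A colouring of the strands, described from the point of view of a traveller. -/
structure Valid (w : LWord V E) (h : Port E → Bool) (g : ℕ → ℕ → Bool) : Prop where
  go : ∀ l l' : Loc, l.pos < W w l.level → w.toWord.next l = .go l' [] →
    g l.level l.pos = g l'.level l'.pos
  port : ∀ (l : Loc) (z : Port E), l.pos < W w l.level → Arrives w l z → g l.level l.pos = h z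

theorem coloring_iff {h : Port E → Bool} {n : ℕ} {w : LWord V E} {g : ℕ → ℕ → Bool}
    (ho : out n w = 0) : Coloring h n w g ↔
      ∀ t s, w[t]? = some s → StepOK h s (out n (w.take t)) (g t) (g (t + 1)) := by
  induction w generalizing n g with
  | nil => simpa [Coloring] using ho
  | cons s w ih =>
    rw [Coloring, ih ho]
    constructor
    · rintro ⟨h1, h2⟩ (_ | t) s' hs
      · simp at hs; subst hs; exact h1
      · exact h2 t s' (by simpa using hs)
    · exact fun H => ⟨H 0 s rfl, fun t s' hs => H (t + 1) s' (by simpa using hs)⟩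

/-- Together with `Coloring.valid` this identifies two descriptions of a colouring: by rows, as used
for counting, and along the path of a traveller, as used for following edges. -/
theorem Valid.coloring {h : Port E → Bool} {w : LWord V E} {g : ℕ → ℕ → Bool} (hw : Fits 0 w)
    (ho : out 0 w = 0) (H : Valid w h g) : Coloring h 0 w g := by
  refine (coloring_iff ho).2 fun t s hs => ?_
  obtain ⟨p, x⟩ := s
  have h1 := W_succ hs
  have h2 : p + x.bot ≤ W w t := fits_getElem? hw hs
  change StepOK h _ (W w t) _ _
  refine ⟨fun i hi => ?_, fun i hi => ?_, ?_⟩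
  · simp only at hi
    refine (H.go ⟨t, i, true⟩ ⟨t + 1, i, true⟩ (by simp; omega) ?_).symm
    simp [Word.next, toWord_getElem?, hs, LSlice.toSlice, Slice.goUp, hi]
  · simp only at hi
    refine (H.go ⟨t, p + x.bot + i, true⟩ ⟨t + 1, p + x.top + i, true⟩ (by simp; omega) ?_).symm
    have e1 : ¬ p + x.bot + i < p := by omega
    simp [Word.next, toWord_getElem?, hs, LSlice.toSlice, Slice.goUp, e1]
    omega
  · simp only
    cases x with
    | cup =>
      have := H.go ⟨t + 1, p, false⟩ ⟨t + 1, p + 1, true⟩ (by simp at *; omega) (by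
        simp [Word.next, toWord_getElem?, hs, LSlice.toSlice, Slice.goDown, LEvent.toEvent,
          Event.top]; omega)
      simp only at this
      cases hg : g (t + 1) p <;> simp [List.range_succ, hg, ← this]
    | cap =>
      have := H.go ⟨t, p, true⟩ ⟨t, p + 1, false⟩ (by simp at *; omega) (by
        simp [Word.next, toWord_getElem?, hs, LSlice.toSlice, Slice.goUp, LEvent.toEvent,
          Event.bot]; omega)
      simp only at this
      simp [List.range_succ, this]
    | virt =>
      have e1 := H.go ⟨t, p, true⟩ ⟨t + 1, p + 1, true⟩ (by simp at *; omega) (by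
        simp [Word.next, toWord_getElem?, hs, LSlice.toSlice, Slice.goUp, LEvent.toEvent,
          Event.bot, Kind.record]; omega)
      have e2 := H.go ⟨t, p + 1, true⟩ ⟨t + 1, p, true⟩ (by simp at *; omega) (by
        simp [Word.next, toWord_getElem?, hs, LSlice.toSlice, Slice.goUp, LEvent.toEvent,
          Event.bot, Kind.record]; omega)
      simp only at e1 e2
      simp [List.range_succ, e1, e2]
    | cross c r =>
      have e1 := H.port _ _ (by simp at *; omega) (.bl hs)
      have e2 := H.port _ _ (by simp at *; omega) (.br hs)
      have e3 := H.port _ _ (by simp at *; omega) (.tl hs)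
      have e4 := H.port _ _ (by simp at *; omega) (.tr hs)
      simp only at e1 e2 e3 e4
      simp [List.range_succ, e1, e2, e3, e4]
    | vertex v legs =>
      simp only [top_vertex, bot_vertex, List.range_zero, List.map_nil, opts_vertex,
        List.mem_singleton] at *
      refine List.ext_getElem (by simp) fun j h3 h4 => ?_
      have hj : j < legs.length := by simpa using h3
      have := H.port ⟨t + 1, p + j, false⟩ (.inl legs[j]) (by simp; omega)
        (.half ((Word.next_eq_arrive_iff _).2 ⟨t, p, v, legs, j, by
          simp [toWord_getElem?, hs, LSlice.toSlice, LEvent.toEvent],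
          List.getElem?_eq_getElem hj, rfl⟩))
      simpa using this

theorem Coloring.go_up {h : Port E → Bool} {w : LWord V E} {g : ℕ → ℕ → Bool}
    (ho : out 0 w = 0) (H : Coloring h 0 w g) {t i : ℕ} {l' : Loc} (hi : i < W w t)
    (hl : w.toWord.next ⟨t, i, true⟩ = .go l' []) : g t i = g l'.level l'.pos := by
  simp only [Word.next, toWord_getElem?] at hl
  cases hs : w[t]? with
  | none => simp [hs] at hl
  | some s =>
    obtain ⟨p, x⟩ := s
    obtain ⟨c1, c2, c3⟩ := (coloring_iff ho).1 H t _ hs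
    change i < out 0 (w.take t) at hi
    simp only at c1 c2 c3
    simp only [hs, Option.map_some, LSlice.toSlice, Slice.goUp, LEvent.toEvent_bot,
      LEvent.toEvent_top] at hl
    split_ifs at hl with h1 h2
    · cases hl
      exact (c1 i h1).symm
    · cases hl
      obtain ⟨j, rfl⟩ := Nat.exists_eq_add_of_le h2
      have := c2 j (by omega)
      simp only
      rw [← this]
      congr 1; omega
    · have h3 : i = p ∨ i = p + 1 → i < p + 2 := by omega
      cases x with
      | cap =>
        simp [LEvent.toEvent] at hl
        simp [List.range_succ] at c3
        subst hl
        have : i = p ∨ i = p + 1 := by simp at h2; omega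
        have f3 : 2 * p + 1 - p = p + 1 := by omega
        have f4 : 2 * p + 1 - (p + 1) = p := by omega
        rcases this with rfl | rfl
        · simp only [f3, c3]
        · simp only [f4, c3]
      | virt =>
        simp [LEvent.toEvent, Kind.record] at hl
        simp [List.range_succ] at c3
        subst hl
        have : i = p ∨ i = p + 1 := by simp at h2; omega
        have f3 : 2 * p + 1 - p = p + 1 := by omega
        have f4 : 2 * p + 1 - (p + 1) = p := by omega
        rcases this with rfl | rfl
        · simp only [f3, c3]
        · simp only [f4, c3]
      | cross c r => simp [LEvent.toEvent, kindOf_record] at hl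
      | cup => simp [LEvent.toEvent] at hl
      | vertex v legs => simp [LEvent.toEvent] at hl

theorem Coloring.go_down {h : Port E → Bool} {w : LWord V E} {g : ℕ → ℕ → Bool}
    (hw : Fits 0 w) (ho : out 0 w = 0) (H : Coloring h 0 w g) {t i : ℕ} {l' : Loc} (hi : i < W w t)
    (hl : w.toWord.next ⟨t, i, false⟩ = .go l' []) : g t i = g l'.level l'.pos := by
  obtain _ | t := t
  · simp [Word.next] at hl
  simp only [Word.next, toWord_getElem?] at hl
  cases hs : w[t]? with
  | none => simp [hs] at hl
  | some s =>
    have f1 := W_succ hs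
    have f2 : s.pos + s.ev.bot ≤ W w t := fits_getElem? hw hs
    obtain ⟨p, x⟩ := s
    obtain ⟨c1, c2, c3⟩ := (coloring_iff ho).1 H t _ hs
    change ∀ i < W w t - (p + x.bot), _ at c2
    simp only at c1 c2 c3 f1 f2
    simp only [hs, Option.map_some, LSlice.toSlice, Slice.goDown, LEvent.toEvent_bot,
      LEvent.toEvent_top] at hl
    split_ifs at hl with h1 h2
    · cases hl
      exact c1 i h1
    · cases hl
      obtain ⟨j, rfl⟩ := Nat.exists_eq_add_of_le h2
      have := c2 j (by omega)
      simp only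
      rw [this]
      congr 1; omega
    · cases x with
      | cup =>
        simp [LEvent.toEvent] at hl
        simp [List.range_succ] at c3
        subst hl
        have : i = p ∨ i = p + 1 := by simp at h2; omega
        have f3 : 2 * p + 1 - p = p + 1 := by omega
        have f4 : 2 * p + 1 - (p + 1) = p := by omega
        have c3 : g (t + 1) p = g (t + 1) (p + 1) := by
          rcases c3 with c3 | c3 <;> rw [c3.1, c3.2]
        rcases this with rfl | rfl
        · simp only [f3, c3]
        · simp only [f4, c3]
      | virt =>
        simp [LEvent.toEvent, Kind.record] at hl
        simp [List.range_succ] at c3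
        subst hl
        have : i = p ∨ i = p + 1 := by simp at h2; omega
        have f3 : 2 * p + 1 - p = p + 1 := by omega
        have f4 : 2 * p + 1 - (p + 1) = p := by omega
        rcases this with rfl | rfl
        · simp only [f3, c3]
        · simp only [f4, c3]
      | cross c r => simp [LEvent.toEvent, kindOf_record] at hl
      | cap => simp [LEvent.toEvent] at hl
      | vertex v legs =>
        simp only [LEvent.toEvent] at hl
        split at hl <;> cases hl

theorem Coloring.valid {h : Port E → Bool} {w : LWord V E} {g : ℕ → ℕ → Bool} (hw : Fits 0 w)
    (ho : out 0 w = 0) (H : Coloring h 0 w g) : Valid w h g := by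
  refine ⟨fun l l' hl hn => ?_, fun l z hl hz => ?_⟩
  · obtain ⟨t, i, _ | _⟩ := l
    · exact H.go_down hw ho hl hn
    · exact H.go_up ho hl hn
  · have key {t p c : ℕ} {r : Fin 4} (hs : w[t]? = some ⟨p, .cross c r⟩) :
        (g t p = h (.inr (c, r)) ∧ g t (p + 1) = h (.inr (c, r + 3))) ∧
          g (t + 1) p = h (.inr (c, r + 1)) ∧ g (t + 1) (p + 1) = h (.inr (c, r + 2)) := by
      have c3 := ((coloring_iff ho).1 H t _ hs).2.2
      simp [List.range_succ] at c3
      exact c3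
    cases hz with
    | half hn =>
      obtain ⟨t, p, v, legs, j, hs, hj, rfl⟩ := (Word.next_eq_arrive_iff _).1 hn
      rw [toWord_getElem?] at hs
      obtain ⟨⟨p', x⟩, hs', hx⟩ := Option.map_eq_some_iff.1 hs
      cases x <;> simp [LSlice.toSlice, LEvent.toEvent] at hx
      obtain ⟨rfl, rfl, rfl⟩ := hx
      have c3 := ((coloring_iff ho).1 H t _ hs').2.2
      simp only [top_vertex, bot_vertex, List.range_zero, List.map_nil, opts_vertex,
        List.mem_singleton] at c3
      have := congrArg (fun l => l[j]?) c3
      obtain ⟨hj', rfl⟩ := List.getElem?_eq_some_iff.1 hj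
      simp only [List.getElem?_map, List.getElem?_range hj', List.getElem?_eq_getElem hj'] at this
      simpa using this
    | bl hs => exact (key hs).1.1
    | br hs => exact (key hs).1.2
    | tl hs => exact (key hs).2.1
    | tr hs => exact (key hs).2.2

/-! ### Colourings and the count of colourings -/

theorem Valid.Z_pos {h : Port E → Bool} {w : LWord V E} {g : ℕ → ℕ → Bool} (hw : Fits 0 w)
    (ho : out 0 w = 0) (H : Valid w h g) : 0 < Z h w [] :=
  (H.coloring hw ho).Z_pos hw

theorem exists_valid {h : Port E → Bool} {w : LWord V E} (hw : Fits 0 w)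
    (ho : out 0 w = 0) (hZ : 0 < Z h w []) : ∃ g, Valid w h g := by
  obtain ⟨g, hg, -⟩ := exists_coloring (f := fun _ => false) hw ho hZ
  exact ⟨g, hg.valid hw ho⟩

theorem Valid.eq_false {w : LWord V E} {g : ℕ → ℕ → Bool} (hw : Fits 0 w)
    (ho : out 0 w = 0) (hZ : Z (fun _ => false) w [] ≤ 1) (H : Valid w (fun _ => false) g) {t i : ℕ}
    (hi : i < W w t) : g t i = false := by
  refine (H.coloring hw ho).eq_false hw ho hZ (by simp) t i ?_ hi
  by_contra ht
  rw [W_of_length_le ho (by omega)] at hi; omega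

theorem Z_le_one_of_valid {w : LWord V E} (hw : Fits 0 w) (ho : out 0 w = 0)
    (H : ∀ g, Valid w (fun _ => false) g → ∀ t i, i < W w t → g t i = false) :
    Z (fun _ => false) w [] ≤ 1 :=
  Z_le_one hw ho fun g hg _ t i _ hi => H g (hg.valid hw ho) t i hi

/-! ### Paths between ports -/

/-- The steps of a traveller which does not pass crossings. -/
def Cut (w : LWord V E) : Loc → Loc → Prop :=
  Relation.ReflTransGen fun l l' => w.toWord.next l = .go l' []

theorem Cut.rev {w : LWord V E} {l l' : Loc} (H : Cut w l l') : Cut w l'.rev l.rev := by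
  induction H with
  | refl => exact .refl
  | tail _ h ih => exact .head (Word.next_rev _ h) ih

/-- A traveller that looks back sees its last step. -/
theorem Cut.rev_cases {w : LWord V E} {l₀ l : Loc} (H : Cut w l₀ l.rev) :
    l₀ = l.rev ∨ ∃ l', w.toWord.next l = .go l' [] ∧ Cut w l₀ l'.rev := by
  rcases Relation.ReflTransGen.cases_tail H with h | ⟨m, h1, h2⟩
  · exact .inl h.symm
  · exact .inr ⟨m.rev, by simpa using Word.next_rev _ h2, by rwa [Loc.rev_rev]⟩

/-- The steps are deterministic, and at a port no step without a crossing is possible, so both paths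
stop at the same port. -/
theorem Cut.det {w : LWord V E} {l m m' : Loc} {z z' : Port E} (H : Cut w l m) (h : Arrives w m z)
    (H' : Cut w l m') (h' : Arrives w m' z') : z = z' := by
  induction H using Relation.ReflTransGen.head_induction_on with
  | refl =>
    rcases Relation.ReflTransGen.cases_head H' with rfl | ⟨m'', h1, h2⟩
    · exact h.det h'
    · exact (h.not_go h1).elim
  | head h1 _ ih =>
    rcases Relation.ReflTransGen.cases_head H' with rfl | ⟨m'', h2, h3⟩
    · exact (h'.not_go h1).elim
    · rw [h1] at h2; cases h2; exact ih h3

/-- The ports `x` and `y` are joined by a strand without crossings. -/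
def Joined (w : LWord V E) (x y : Port E) : Prop :=
  ∃ l l', Arrives w l.rev x ∧ Cut w l l' ∧ Arrives w l' y

theorem Joined.symm {w : LWord V E} {x y : Port E} (H : Joined w x y) : Joined w y x := by
  obtain ⟨l, l', h1, h2, h3⟩ := H
  exact ⟨l'.rev, l.rev, by simpa using h3, h2.rev, h1⟩

/-- Each port is reached in only one way. -/
def Separated (w : LWord V E) : Prop :=
  ∀ l l' z, Arrives w l z → Arrives w l' z → l = l'

theorem Joined.det {w : LWord V E} (hw : Separated w) {x y y' : Port E} (H : Joined w x y)
    (H' : Joined w x y') : y = y' := by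
  obtain ⟨l, m, h1, h2, h3⟩ := H
  obtain ⟨l', m', h1', h2', h3'⟩ := H'
  have := congrArg Loc.rev (hw _ _ _ h1 h1')
  simp only [Loc.rev_rev] at this
  subst this
  exact h2.det h3 h2' h3'

theorem Arrives.lt_W {w : LWord V E} (hw : Fits 0 w) {l : Loc} {z : Port E} (H : Arrives w l z) :
    l.pos < W w l.level := by
  have key {t : ℕ} {s : LSlice V E} (hs : w[t]? = some s) :
      s.pos + s.ev.bot ≤ W w t ∧ W w (t + 1) = W w t - s.ev.bot + s.ev.top :=
    ⟨fits_getElem? hw hs, W_succ hs⟩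
  cases H with
  | half hn =>
    obtain ⟨t, p, v, legs, j, hs, hj, rfl⟩ := (Word.next_eq_arrive_iff _).1 hn
    rw [toWord_getElem?] at hs
    obtain ⟨⟨p', x⟩, hs', hx⟩ := Option.map_eq_some_iff.1 hs
    cases x <;> simp [LSlice.toSlice, LEvent.toEvent] at hx
    obtain ⟨rfl, rfl, rfl⟩ := hx
    have := key hs'
    have := (List.getElem?_eq_some_iff.1 hj).1
    simp at *; omega
  | bl hs => have := key hs; simp at *; omega
  | br hs => have := key hs; simp at *; omega
  | tl hs => have := key hs; simp at *; omega
  | tr hs => have := key hs; simp at *; omega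

theorem next_lt_W {w : LWord V E} (hw : Fits 0 w) (ho : out 0 w = 0) {l l' : Loc}
    {es : List (ℕ × Bool)} (hl : l.pos < W w l.level) (h : w.toWord.next l = .go l' es) :
    l'.pos < W w l'.level := by
  rcases next_cases hw ho hl with ⟨m, h1, h2⟩ | ⟨h' | ⟨c, i⟩, hz⟩
  · rw [h] at h1; cases h1; exact h2
  · cases hz with
    | half hz => rw [h] at hz; cases hz
  · obtain ⟨t, p, r, m, -, -, h1, h2⟩ := hz.pass
    rw [h] at h1; cases h1
    exact h2.lt_W hw

theorem Valid.eq_of_cut {w : LWord V E} (hw : Fits 0 w) (ho : out 0 w = 0) {h : Port E → Bool}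
    {g : ℕ → ℕ → Bool} (H : Valid w h g) {l l' : Loc} (hl : l.pos < W w l.level)
    (hc : Cut w l l') : l'.pos < W w l'.level ∧ g l.level l.pos = g l'.level l'.pos := by
  induction hc with
  | refl => exact ⟨hl, rfl⟩
  | tail _ h1 ih => exact ⟨next_lt_W hw ho ih.1 h1, ih.2.trans (H.go _ _ ih.1 h1)⟩

theorem Valid.eq_of_joined {w : LWord V E} (hw : Fits 0 w) (ho : out 0 w = 0) {h : Port E → Bool}
    {g : ℕ → ℕ → Bool} (H : Valid w h g) {x y : Port E} (hj : Joined w x y) : h x = h y := by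
  obtain ⟨l, l', h1, h2, h3⟩ := hj
  have hl : l.pos < W w l.level := h1.lt_W hw
  obtain ⟨h4, h5⟩ := H.eq_of_cut hw ho hl h2
  rw [← H.port _ _ h4 h3, ← h5]
  exact (H.port l.rev x hl h1).symm

open Classical in
/-- A set of ports which is a union of strands is a colouring. -/
theorem exists_valid_of_joined {w : LWord V E} (h : Port E → Bool)
    (H : ∀ x y, h x = true → Joined w x y → h y = true) : ∃ g, Valid w h g := by
  -- The places on a strand that starts at a black port, looked at in either direction; these are
  -- coloured black.
  let P (l : Loc) : Prop := ∃ x l₀, h x = true ∧ Arrives w l₀.rev x ∧ (Cut w l₀ l ∨ Cut w l₀ l.rev)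
  have hrev {t i : ℕ} {b : Bool} : P ⟨t, i, b⟩ ↔ P ⟨t, i, true⟩ := by
    cases b
    · simp only [P, Loc.rev, Bool.not_true, Bool.not_false]
      simp only [or_comm]
    · rfl
  have step {l l' : Loc} (hl : w.toWord.next l = .go l' []) (hP : P l) : P l' := by
    obtain ⟨x, l₀, h1, h2, h3 | h3⟩ := hP
    · exact ⟨x, l₀, h1, h2, .inl (h3.tail hl)⟩
    · rcases h3.rev_cases with rfl | ⟨m, h4, h5⟩
      · exact (h2.not_go (by rwa [Loc.rev_rev])).elim
      · rw [hl] at h4; cases h4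
        exact ⟨x, l₀, h1, h2, .inr h5⟩
  refine ⟨fun t i => decide (P ⟨t, i, true⟩), ⟨fun l l' _ hl => ?_, fun l z _ hz => ?_⟩⟩
  · rw [decide_eq_decide]
    obtain ⟨t, i, b⟩ := l
    obtain ⟨t', i', b'⟩ := l'
    constructor
    · intro hP
      exact hrev.1 (step hl (hrev.2 hP))
    · intro hP
      exact hrev.1 (step (Word.next_rev _ hl) (hrev.2 hP))
  · rw [Bool.eq_iff_iff, decide_eq_true_iff]
    obtain ⟨t, i, b⟩ := l
    rw [← hrev (b := b)]
    constructor
    · rintro ⟨x, l₀, h1, h2, h3 | h3⟩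
      · exact H x z h1 ⟨l₀, _, h2, h3, hz⟩
      · rcases h3.rev_cases with rfl | ⟨m, h4, h5⟩
        · rw [Loc.rev_rev] at h2; rwa [← h2.det hz]
        · exact (hz.not_go h4).elim
    · intro h1
      exact ⟨z, Loc.rev ⟨t, i, b⟩, h1, by simpa using hz, .inr .refl⟩

open Classical in
/-- Ports that are joined in one word are joined in every other word with the same colourings. -/
theorem Joined.transfer {w w' : LWord V E} (hw : Fits 0 w) (ho : out 0 w = 0) (hw' : Fits 0 w')
    (ho' : out 0 w' = 0) (hs' : Separated w')
    (hZ : ∀ h, 0 < Z h w' [] → 0 < Z h w []) {x y : Port E} (hxy : x ≠ y) (H : Joined w x y) :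
    Joined w' x y := by
  -- Black are `x` and the ports joined to it in `w'`. Joining is a partial matching because `w'` is
  -- separated, so this set is a union of strands of `w'` and extends to a colouring there, hence
  -- also in `w`. In `w` the strand from `x` forces `y` to be black, and `x ≠ y` leaves only that it
  -- is joined to `x` in `w'`.
  let h (z : Port E) : Bool := decide (z = x ∨ Joined w' x z)
  obtain ⟨g, hg⟩ := exists_valid_of_joined (w := w') h fun a b ha hab => by
    simp only [h, decide_eq_true_iff] at ha ⊢
    rcases ha with rfl | ha
    · exact .inr hab
    · exact .inl (hab.det hs' ha.symm)
  obtain ⟨g', hg'⟩ := exists_valid hw ho (hZ h (hg.Z_pos hw' ho'))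
  have := hg'.eq_of_joined hw ho H
  simp only [h, true_or, decide_true] at this
  simpa [hxy.symm] using this.symm

/-! ### The nodes of equivalent words -/

/-- A node up to rotation. -/
def Node.class : Node V E → ℕ ⊕ (V × Cycle (HalfEdge E))
  | cross c _ => .inl c
  | vertex v legs => .inr (v, legs)

theorem Node.class_eq_iff {b b' : Node V E} : b.class = b'.class ↔ b.Turn b' := by
  constructor
  · intro h
    cases b <;> cases b' <;> simp [Node.class] at h
    · subst h; exact .cross _ _ _
    · obtain ⟨rfl, h⟩ := h; exact .vertex _ h
  · rintro (_ | ⟨_, h⟩)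
    · rfl
    · simp [Node.class, h]

def classes (B : List (Node V E)) : List (ℕ ⊕ (V × Cycle (HalfEdge E))) := B.map Node.class

/-- Equality of the classes up to order is realised in two stages, a permutation of the nodes and
then a rotation of each. These are the operations that `Normal.perm` and `Normal.turn` allow. -/
theorem exists_turn {B B' : List (Node V E)} (h : (classes B).Perm (classes B')) :
    ∃ C, B.Perm C ∧ List.Forall₂ Node.Turn C B' := by
  have h1 : Relation.Comp (List.Forall₂ fun (b : Node V E) a => b.class = a) List.Perm B
      (classes B') := ⟨classes B, by simp [classes, List.forall₂_map_right_iff], h⟩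
  rw [List.forall₂_comp_perm_eq_perm_comp_forall₂] at h1
  obtain ⟨C, h2, h3⟩ := h1
  refine ⟨C, h2, ?_⟩
  rw [classes, List.forall₂_map_right_iff] at h3
  exact h3.imp fun _ _ => Node.class_eq_iff.1

theorem Node.Turn.ports_perm {b b' : Node V E} (h : b.Turn b') : b.ports.Perm b'.ports := by
  cases h with
  | cross c r r' =>
    refine (List.perm_ext_iff_of_nodup ?_ ?_).2 fun z => ?_
    · simp [Node.ports]
    · simp [Node.ports]
    · obtain z | ⟨d, i⟩ := z
      · simp [Node.ports]
      · simp only [Node.ports, List.mem_cons, Sum.inr.injEq, Prod.mk.injEq, List.not_mem_nil,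
          or_false, ← and_or_left]
        have : ∀ r : Fin 4, i = r ∨ i = r + 1 ∨ i = r + 2 ∨ i = r + 3 := by decide +revert
        simp [this]
  | vertex v h => exact h.perm.map _

theorem ports_perm {B B' : List (Node V E)} (h : (classes B).Perm (classes B')) :
    (ports B).Perm (ports B') := by
  obtain ⟨C, h1, h2⟩ := exists_turn h
  refine ((List.reverse_perm _).trans (h1.trans (List.reverse_perm _).symm)).flatMap_right _
    |>.trans ?_
  clear h1 h
  induction h2 with
  | nil => rfl
  | cons h _ ih =>
    simp only [ports, List.reverse_cons, List.flatMap_append, List.flatMap_cons, List.flatMap_nil,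
      List.append_nil]
    exact ih.append h.ports_perm

theorem nodes_passR (p n : ℕ) : nodes (passR p n : LWord V E) = [] := by
  induction n generalizing p with
  | zero => rfl
  | succ n ih => simp [passR, nodes, ← ih (p + 1), LEvent.node]

/-- Local relations neither create nor destroy a node; at most they change its height or rotate it.
-/
theorem Rule.classes_perm {L R : LWord V E} (h : Rule L R) :
    (classes (nodes L)).Perm (classes (nodes R)) := by
  cases h with
  | interchange p r x y =>
    refine List.Perm.map _ ?_
    exact (List.Perm.swap _ _ _).filterMap _
  | rotate_vertex p v h hs =>
    have : (h :: hs) ~r (hs ++ [h]) := ⟨1, by simp⟩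
    simp [nodes, classes, LEvent.node, Node.class, this]
  | slide_vertex p v legs =>
    rw [nodes_vertex, nodes_passR]; rfl
  | _ => simp [nodes, classes, LEvent.node, Node.class]

theorem Eqv.classes_perm {n : ℕ} {w w' : LWord V E} (h : Eqv n w w') :
    (classes (nodes w)).Perm (classes (nodes w')) := by
  induction h with
  | rel w w' h =>
    induction h with
    | rule b h _ _ =>
      simp only [nodes_append, classes, List.map_append]
      exact h.classes_perm.append_right _
    | @cons n s w w' _ _ ih =>
      have e (w : LWord V E) : nodes (s :: w) = nodes [s] ++ nodes w := nodes_append [s] w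
      rw [e w, e w']
      simp only [classes, List.map_append]
      exact ih.append_left _
  | refl w => rfl
  | symm _ _ _ ih => exact ih.symm
  | trans _ _ _ _ _ ih ih' => exact ih.trans ih'

/-! ### Words with distinct ports -/

theorem pairwise_ports {w : LWord V E} (h : (ports (nodes w)).Nodup) :
    (∀ s ∈ w, ∀ b, s.ev.node = some b → b.ports.Nodup) ∧
      w.Pairwise fun s s' => ∀ b, s.ev.node = some b → ∀ b', s'.ev.node = some b' →
        List.Disjoint b.ports b'.ports := by
  rw [ports, List.nodup_flatMap, List.pairwise_reverse, nodes, List.pairwise_filterMap] at h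
  refine ⟨fun s hs b hb => h.1 b ?_, h.2.imp fun H b hb b' hb' => (H b hb b' hb').symm⟩
  simp only [List.mem_reverse, List.mem_filterMap]
  exact ⟨s, hs, hb⟩

theorem slice_unique {w : LWord V E} (h : (ports (nodes w)).Nodup) {t t' : ℕ} {s s' : LSlice V E}
    (hs : w[t]? = some s) (hs' : w[t']? = some s') {b b' : Node V E} (hb : s.ev.node = some b)
    (hb' : s'.ev.node = some b') {z : Port E} (hz : z ∈ b.ports) (hz' : z ∈ b'.ports) : t = t' := by
  have hp := List.pairwise_iff_getElem.1 (pairwise_ports h).2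
  obtain ⟨h1, rfl⟩ := List.getElem?_eq_some_iff.1 hs
  obtain ⟨h1', rfl⟩ := List.getElem?_eq_some_iff.1 hs'
  by_contra hne
  rcases Nat.lt_or_gt_of_ne hne with hlt | hlt
  · exact hp t t' h1 h1' hlt b hb b' hb' hz hz'
  · exact hp t' t h1' h1 hlt b' hb' b hb hz' hz

theorem toWord_vertex_iff {w : LWord V E} {t p : ℕ} {v : V} {legs : List (HalfEdge E)} :
    w.toWord[t]? = some ⟨p, .vertex v legs⟩ ↔ w[t]? = some ⟨p, .vertex v legs⟩ := by
  rw [toWord_getElem?]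
  constructor
  · intro hs
    obtain ⟨⟨p', x⟩, hs', hx⟩ := Option.map_eq_some_iff.1 hs
    cases x <;> simp [LSlice.toSlice, LEvent.toEvent] at hx
    obtain ⟨rfl, rfl, rfl⟩ := hx
    exact hs'
  · intro hs
    simp [hs, LSlice.toSlice, LEvent.toEvent]

theorem arrives_half_iff {w : LWord V E} {l : Loc} {h : HalfEdge E} :
    Arrives w l (.inl h) ↔ ∃ t p v legs j, w[t]? = some ⟨p, .vertex v legs⟩ ∧ legs[j]? = some h ∧
      l = ⟨t + 1, p + j, false⟩ := by
  have : Arrives w l (.inl h) ↔ w.toWord.next l = .arrive h :=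
    ⟨fun H => by cases H; assumption, .half⟩
  simp only [this, Word.next_eq_arrive_iff, toWord_vertex_iff]

theorem Node.mem_ports_cross (c : ℕ) (r i : Fin 4) :
    (.inr (c, i) : Port E) ∈ (Node.cross c r : Node V E).ports := by
  simp [Node.ports]; decide +revert

/-- A port determines the slice of its node, and then its place there. -/
theorem separated_of_nodup {w : LWord V E} (hw : (ports (nodes w)).Nodup) : Separated w := by
  rintro l l' (h | ⟨c, i⟩) H H'
  · obtain ⟨t, p, v, legs, j, hs, hj, rfl⟩ := arrives_half_iff.1 H
    obtain ⟨t', p', v', legs', j', hs', hj', rfl⟩ := arrives_half_iff.1 H'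
    obtain rfl := slice_unique hw hs hs' (b := .vertex v legs) (b' := .vertex v' legs') rfl rfl
      (z := .inl h) (List.mem_map_of_mem (List.mem_of_getElem? hj))
      (List.mem_map_of_mem (List.mem_of_getElem? hj'))
    rw [hs] at hs'; cases hs'
    have hn := (pairwise_ports hw).1 _ (List.mem_of_getElem? hs) _ rfl
    have hn : legs.Nodup := List.Nodup.of_map _ hn
    obtain ⟨k, e⟩ := List.getElem?_eq_some_iff.1 hj
    obtain ⟨k', e'⟩ := List.getElem?_eq_some_iff.1 hj'
    rw [hn.getElem_inj_iff.1 (e.trans e'.symm)]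
  · obtain ⟨t, p, r, hs, rfl⟩ := arrives_cross_iff.1 H
    obtain ⟨t', p', r', hs', rfl⟩ := arrives_cross_iff.1 H'
    obtain rfl := slice_unique hw hs hs' (b := .cross c r) (b' := .cross c r') rfl rfl
      (Node.mem_ports_cross c r 0) (Node.mem_ports_cross c r' 0)
    rw [hs] at hs'; cases hs'
    rfl

theorem exists_arrives_iff {w : LWord V E} {z : Port E} :
    (∃ l, Arrives w l z) ↔ z ∈ ports (nodes w) := by
  simp only [ports, nodes, List.mem_flatMap, List.mem_reverse, List.mem_filterMap]
  constructor
  · rintro ⟨l, H⟩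
    obtain h | ⟨c, i⟩ := z
    · obtain ⟨t, p, v, legs, j, hs, hj, rfl⟩ := arrives_half_iff.1 H
      exact ⟨.vertex v legs, ⟨_, List.mem_of_getElem? hs, rfl⟩,
        List.mem_map_of_mem (List.mem_of_getElem? hj)⟩
    · obtain ⟨t, p, r, hs, rfl⟩ := arrives_cross_iff.1 H
      exact ⟨.cross c r, ⟨_, List.mem_of_getElem? hs, rfl⟩, Node.mem_ports_cross c r i⟩
  · rintro ⟨b, ⟨⟨p, x⟩, hs, hb⟩, hz⟩
    obtain ⟨t, hs⟩ := List.mem_iff_getElem?.1 hs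
    cases x <;> simp [LEvent.node] at hb
    · subst hb
      obtain h | ⟨d, i⟩ := z
      · simp [Node.ports] at hz
      · obtain rfl : d = _ := by simp [Node.ports] at hz; tauto
        exact ⟨_, arrives_cross_iff.2 ⟨t, p, _, hs, rfl⟩⟩
    · subst hb
      obtain ⟨h, hh, rfl⟩ := List.mem_map.1 hz
      obtain ⟨j, hj⟩ := List.mem_iff_getElem?.1 hh
      exact ⟨_, arrives_half_iff.2 ⟨t, p, _, _, j, hs, hj, rfl⟩⟩

/-! ### The vertices of a word -/

def LEvent.vert : LEvent V E → Option V
  | vertex v _ => some v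
  | _ => none

def verts (w : LWord V E) : List V := w.filterMap fun s => s.ev.vert

/-- With this and `legs_spec_iff`, the conditions on the vertices of a diagram depend only on the
classes of the nodes, which equivalences preserve up to order. -/
theorem verts_eq (w : LWord V E) :
    verts w = (classes (nodes w)).filterMap (Sum.elim (fun _ => none) fun x => some x.1) := by
  rw [classes, nodes, List.filterMap_map, List.filterMap_filterMap]
  refine List.filterMap_congr fun s _ => ?_
  obtain ⟨p, _ | _ | _ | _ | _⟩ := s <;> rfl

theorem existsUnique_getElem?_iff {α β : Type*} (L : List α) (f : α → Option β) :
    (∀ b, ∃! t : ℕ, ∃ a, L[t]? = some a ∧ f a = some b) ↔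
      (L.filterMap f).Nodup ∧ ∀ b, b ∈ L.filterMap f := by
  rw [List.Nodup, List.pairwise_filterMap, List.pairwise_iff_getElem]
  simp only [List.mem_filterMap]
  constructor
  · intro H
    refine ⟨fun i j hi hj hij b hb b' hb' hbb => ?_, fun b => ?_⟩
    · subst hbb
      exact hij.ne ((H b).unique ⟨_, List.getElem?_eq_getElem hi, hb⟩
        ⟨_, List.getElem?_eq_getElem hj, hb'⟩)
    · obtain ⟨t, ⟨a, h1, h2⟩, -⟩ := H b
      exact ⟨a, List.mem_of_getElem? h1, h2⟩
  · rintro ⟨H, H'⟩ b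
    obtain ⟨a, ha, hb⟩ := H' b
    obtain ⟨t, ht⟩ := List.mem_iff_getElem?.1 ha
    refine ⟨t, ⟨a, ht, hb⟩, ?_⟩
    rintro t' ⟨a', ht', hb'⟩
    obtain ⟨h1, rfl⟩ := List.getElem?_eq_some_iff.1 ht
    obtain ⟨h1', rfl⟩ := List.getElem?_eq_some_iff.1 ht'
    by_contra hne
    rcases Nat.lt_or_gt_of_ne hne with hlt | hlt
    · exact H _ _ h1' h1 hlt b hb' b hb rfl
    · exact H _ _ h1 h1' hlt b hb b hb' rfl

theorem vertex_once_iff (w : LWord V E) :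
    (∀ v : V, ∃! t : ℕ, ∃ (p : ℕ) (legs : List (HalfEdge E)),
      w.toWord[t]? = some ⟨p, .vertex v legs⟩) ↔ (verts w).Nodup ∧ ∀ v, v ∈ verts w := by
  rw [verts, ← existsUnique_getElem?_iff]
  refine forall_congr' fun v => ?_
  have (t : ℕ) : (∃ (p : ℕ) (legs : List (HalfEdge E)),
      w.toWord[t]? = some ⟨p, .vertex v legs⟩) ↔ ∃ s, w[t]? = some s ∧ s.ev.vert = some v := by
    simp only [toWord_vertex_iff]
    constructor
    · rintro ⟨p, legs, h⟩
      exact ⟨_, h, rfl⟩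
    · rintro ⟨⟨p, x⟩, h, hx⟩
      cases x <;> simp [LEvent.vert] at hx
      subst hx
      exact ⟨p, _, h⟩
  simp only [this]

theorem legs_spec_iff (G : DirectedGraph V E) (w : LWord V E) :
    (∀ (t p : ℕ) (v : V) (legs : List (HalfEdge E)), w.toWord[t]? = some ⟨p, .vertex v legs⟩ →
      legs.Nodup ∧ ∀ h, h ∈ legs ↔ G.vert h = v) ↔
      ∀ v (legs : Cycle (HalfEdge E)), Sum.inr (v, legs) ∈ classes (nodes w) →
        legs.Nodup ∧ ∀ h, h ∈ legs ↔ G.vert h = v := by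
  simp only [toWord_vertex_iff]
  constructor
  · intro H v legs hm
    simp only [classes, nodes, List.mem_map, List.mem_filterMap] at hm
    obtain ⟨b, ⟨⟨p, x⟩, hs, hb⟩, h⟩ := hm
    cases x <;> simp [LEvent.node] at hb <;> subst hb <;> simp [Node.class] at h
    obtain ⟨rfl, rfl⟩ := h
    obtain ⟨t, ht⟩ := List.mem_iff_getElem?.1 hs
    simpa using H t p _ _ ht
  · intro H t p v legs hs
    have : Sum.inr (v, (legs : Cycle (HalfEdge E))) ∈ classes (nodes w) := by
      simp only [classes, nodes, List.mem_map, List.mem_filterMap]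
      exact ⟨.vertex v legs, ⟨_, List.mem_of_getElem? hs, rfl⟩, rfl⟩
    simpa using H v legs this

theorem width_toWord (w : LWord V E) (t : ℕ) : w.toWord.width t = W w t := by
  have key (n : ℕ) (w : LWord V E) :
      w.toWord.foldl (fun k s => k - s.ev.bot + s.ev.top) n = out n w := by
    induction w generalizing n with
    | nil => rfl
    | cons s w ih => simp [LWord.toWord, LSlice.toSlice, ← ih]
  rw [W, ← key]
  simp [Word.width, LWord.toWord]

theorem fits_iff (w : LWord V E) : Fits 0 w ↔
    ∀ (t : ℕ) (s : Slice V E), w.toWord[t]? = some s → s.pos + s.ev.bot ≤ w.toWord.width t := by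
  simp only [width_toWord]
  constructor
  · intro h t s hs
    rw [toWord_getElem?] at hs
    obtain ⟨s', hs', rfl⟩ := Option.map_eq_some_iff.1 hs
    simpa [LSlice.toSlice, W] using fits_getElem? h hs'
  · intro H
    have key (n : ℕ) (w : LWord V E)
        (H : ∀ t s, w[t]? = some s → s.pos + s.ev.bot ≤ out n (w.take t)) : Fits n w := by
      induction w generalizing n with
      | nil => trivial
      | cons s w ih => exact ⟨H 0 s rfl, ih _ fun t s' hs => H (t + 1) s' (by simpa using hs)⟩
    refine key 0 w fun t s hs => ?_
    have := H t s.toSlice (by rw [toWord_getElem?, hs]; rfl)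
    simpa [LSlice.toSlice, W] using this

theorem closed_iff (w : LWord V E) : w.toWord.width w.toWord.length = 0 ↔ out 0 w = 0 := by
  rw [width_toWord, W, List.take_of_length_le (by simp [LWord.toWord])]

variable {G : DirectedGraph V E}

/-! ### Curves in a diagram -/

theorem Word.Reaches.rev {w : Word V E} {l m : Loc} (H : w.Reaches l m) :
    w.Reaches m.rev l.rev := by
  induction H with
  | refl => exact .refl
  | tail _ h ih => exact .head ⟨_, Word.next_rev w h.choose_spec⟩ ih

theorem Word.Reaches.walk {w : Word V E} {l m : Loc} {h : HalfEdge E} (H : w.Reaches l m)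
    (hm : w.next m = .arrive h) : ∃ es, w.Walk l es h := by
  induction H using Relation.ReflTransGen.head_induction_on with
  | refl => exact ⟨_, .arrive hm⟩
  | head h' _ ih =>
    obtain ⟨es, h'⟩ := h'
    exact ⟨_, .go h' ih.choose_spec⟩

theorem Word.Walk.reaches {w : Word V E} {l : Loc} {es : List (ℕ × Bool)} {h : HalfEdge E}
    (H : w.Walk l es h) : ∃ m, w.Reaches l m ∧ w.next m = .arrive h := by
  induction H with
  | arrive h => exact ⟨_, .refl, h⟩
  | go h _ ih => exact ⟨ih.choose, ih.choose_spec.1.head ⟨_, h⟩, ih.choose_spec.2⟩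

theorem Word.Visits.step {w : Word V E} {e : E} {l l' : Loc} {es : List (ℕ × Bool)}
    (H : w.Visits e l) (h : w.next l = .go l' es) : w.Visits e l' :=
  ⟨H.choose, H.choose_spec.1, H.choose_spec.2.tail ⟨es, h⟩⟩

/-- An edge that passes `l` backwards has just come from `l'`. It cannot have started there, since
then a vertex instead of a step would lie ahead of `l`. -/
theorem Word.Visits.back {w : Word V E} {e : E} {l l' : Loc} {es : List (ℕ × Bool)}
    (H : w.Visits e l.rev) (h : w.next l = .go l' es) : w.Visits e l'.rev := by
  obtain ⟨l₀, h0, h1⟩ := H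
  rcases Relation.ReflTransGen.cases_tail h1 with rfl | ⟨m, h2, es', h3⟩
  · rw [Word.isStart_iff, Loc.rev_rev, h] at h0
    cases h0
  · have := w.next_rev h3
    rw [Loc.rev_rev, h] at this
    cases this
    exact ⟨l₀, h0, by rwa [Loc.rev_rev]⟩

/-- No place is passed in both directions. -/
theorem Diagram.not_visits_rev (D : Diagram G) {e e' : E} {l : Loc} (H : D.word.Visits e l)
    (H' : D.word.Visits e' l.rev) : False := by
  obtain ⟨l₀, h1, h2⟩ := H
  obtain ⟨l₀', h1', h2'⟩ := H'
  -- The path of `e` up to `l`, followed by the path of `e'` reversed, ends at the initial half of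
  -- `e'`. But the path of `e` ends at the final half of `e`.
  have h3 : D.word.Reaches l l₀'.rev := by simpa using h2'.rev
  obtain ⟨es, h4⟩ := Word.Reaches.walk (h2.trans h3) ((Word.isStart_iff _).1 h1')
  obtain ⟨es', m, h5, h6⟩ := D.traced e
  obtain rfl := D.isStart_unique h1 h5
  simpa using (h4.unique h6).2

theorem arrives_of_isStart {w : LWord V E} {h : HalfEdge E} {l : Loc}
    (H : w.toWord.IsStart h l) : Arrives w l.rev (.inl h) :=
  .half ((Word.isStart_iff _).1 H)

theorem isStart_of_arrives {w : LWord V E} {h : HalfEdge E} {l : Loc}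
    (H : Arrives w l (.inl h)) : w.toWord.IsStart h l.rev := by
  rw [Word.isStart_iff, Loc.rev_rev]
  cases H; assumption

theorem Visits.lt_W {w : LWord V E} (hw : Fits 0 w) (ho : out 0 w = 0) {e : E} {l : Loc}
    (H : w.toWord.Visits e l) : l.pos < W w l.level := by
  obtain ⟨l₀, h1, h2⟩ := H
  induction h2 with
  | refl => exact (arrives_of_isStart h1).lt_W hw
  | tail _ h ih => exact next_lt_W hw ho ih h.choose_spec

theorem go_cases {w : LWord V E} (hw : Fits 0 w) (ho : out 0 w = 0) {l l' : Loc}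
    {es : List (ℕ × Bool)} (hl : l.pos < W w l.level) (h : w.toWord.next l = .go l' es) :
    es = [] ∨ ∃ c i, Arrives w l (.inr (c, i)) := by
  rcases next_cases hw ho hl with ⟨m, h1, -⟩ | ⟨h' | ⟨c, i⟩, hz⟩
  · rw [h] at h1; cases h1; exact .inl rfl
  · cases hz with
    | half hz => rw [h] at hz; cases hz
  · exact .inr ⟨c, i, hz⟩

theorem Diagram.fits_word (D : Diagram G) {w : LWord V E} (hD : w.toWord = D.word) :
    Fits 0 w ∧ out 0 w = 0 := by
  rw [fits_iff, ← closed_iff, hD]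
  exact ⟨D.fits, D.closed⟩

/-- Equal colourings and distinct ports allow to follow an edge in another word. -/
theorem Diagram.visits_transfer (D : Diagram G) {w w' : LWord V E} (hD : w.toWord = D.word)
    (hs : Separated w) (hw' : Fits 0 w') (ho' : out 0 w' = 0) (hs' : Separated w')
    (hZ : ∀ h, 0 < Z h w' [] → 0 < Z h w []) (hP : ∀ z, (∃ l, Arrives w l z) → ∃ l, Arrives w' l z)
    {e : E} {l : Loc} (H : w.toWord.Visits e l) :
    ∃ z a a', Arrives w a.rev z ∧ Cut w a l ∧ w.toWord.Visits e a ∧ Arrives w' a'.rev z ∧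
      w'.toWord.Visits e a' := by
  obtain ⟨hw, ho⟩ := D.fits_word hD
  obtain ⟨l₀, h1, h2⟩ := H
  induction h2 with
  | refl =>
    have h3 := arrives_of_isStart h1
    obtain ⟨a, ha⟩ := hP _ ⟨_, h3⟩
    exact ⟨_, l₀, a.rev, h3, .refl, ⟨l₀, h1, .refl⟩, by simpa using ha, a.rev,
      isStart_of_arrives ha, .refl⟩
  | @tail l l' h2 h ih =>
    obtain ⟨es, h⟩ := h
    obtain ⟨z, a, a', h3, h4, h5, h6, h7⟩ := ih
    have hv : w.toWord.Visits e l := ⟨l₀, h1, h2⟩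
    rcases go_cases hw ho (Visits.lt_W hw ho hv) h with rfl | ⟨c, i, hz⟩
    · exact ⟨z, a, a', h3, h4.tail h, h5, h6, h7⟩
    · have hne : z ≠ .inr (c, i) := by
        rintro rfl
        have := hs _ _ _ h3 hz
        rw [← this, hD] at hv
        rw [hD] at h5
        exact D.not_visits_rev h5 hv
      -- The strand in `w` from the last port to this crossing has a counterpart in `w'`, along
      -- which the edge reaches the same end of the crossing. It then leaves through the opposite
      -- end in both words.
      obtain ⟨b, m, h8, h9, h10⟩ := Joined.transfer hw ho hw' ho' hs' hZ hne ⟨a, l, h3, h4, hz⟩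
      obtain rfl : b = a' := by simpa using congrArg Loc.rev (hs' _ _ _ h8 h6)
      have hm : w'.toWord.Visits e m := by
        obtain ⟨b₀, g1, g2⟩ := h7
        exact ⟨b₀, g1, g2.trans (Relation.ReflTransGen.mono (fun _ _ h => ⟨_, h⟩) _ _ h9)⟩
      obtain ⟨t, p, r, m', -, -, k1, k2⟩ := h10.pass
      obtain ⟨t', p', r', l'', -, -, k1', k2'⟩ := hz.pass
      rw [h] at k1'; cases k1'
      exact ⟨.inr (c, i + 2), l', m', k2', .refl, ⟨l₀, h1, h2.tail ⟨_, h⟩⟩, k2, hm.step k1⟩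

/-- `visits_transfer` finds in `w'` only the last port that the edge has left. Transferring the
remaining piece of strand brings the edge to the port ahead. -/
theorem Diagram.visits_port (D : Diagram G) {w w' : LWord V E} (hD : w.toWord = D.word)
    (hs : Separated w) (hw' : Fits 0 w') (ho' : out 0 w' = 0) (hs' : Separated w')
    (hZ : ∀ h, 0 < Z h w' [] → 0 < Z h w []) (hP : ∀ z, (∃ l, Arrives w l z) → ∃ l, Arrives w' l z)
    {e : E} {l : Loc} (H : w.toWord.Visits e l) {z : Port E} (hz : Arrives w l z) :
    ∃ l', Arrives w' l' z ∧ w'.toWord.Visits e l' := by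
  obtain ⟨hw, ho⟩ := D.fits_word hD
  obtain ⟨y, a, a', h3, h4, h5, h6, h7⟩ := D.visits_transfer hD hs hw' ho' hs' hZ hP H
  have hne : y ≠ z := by
    rintro rfl
    rw [← hs _ _ _ h3 hz, hD] at H
    rw [hD] at h5
    exact D.not_visits_rev h5 H
  obtain ⟨b, m, h8, h9, h10⟩ := Joined.transfer hw ho hw' ho' hs' hZ hne ⟨a, l, h3, h4, hz⟩
  obtain rfl : b = a' := by simpa using congrArg Loc.rev (hs' _ _ _ h8 h6)
  obtain ⟨b₀, g1, g2⟩ := h7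
  exact ⟨m, h10, b₀, g1, g2.trans (Relation.ReflTransGen.mono (fun _ _ h => ⟨_, h⟩) _ _ h9)⟩

/-- If there are no free circles then there is only one colouring with white ports. -/
theorem Diagram.Z_le_one (D : Diagram G) {w : LWord V E} (hD : w.toWord = D.word) :
    Z (fun _ => false) w [] ≤ 1 := by
  obtain ⟨hw, ho⟩ := D.fits_word hD
  refine Z_le_one_of_valid hw ho fun g hg t i hi => ?_
  have hi' : i < D.word.width t := by rwa [← hD, width_toWord]
  obtain ⟨e, b, hv⟩ := D.covered t i hi'
  rw [← hD] at hv
  -- White spreads along each edge from its initial half; after a crossing it starts again from the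
  -- white port through which the strand leaves.
  have key (l : Loc) (hl : w.toWord.Visits e l) : g l.level l.pos = false := by
    obtain ⟨l₀, h1, h2⟩ := hl
    induction h2 with
    | refl => exact hg.port l₀.rev _ ((arrives_of_isStart h1).lt_W hw) (arrives_of_isStart h1)
    | @tail l l' h2 h ih =>
      obtain ⟨es, h⟩ := h
      have hr := Visits.lt_W hw ho ⟨l₀, h1, h2⟩
      rcases go_cases hw ho hr h with rfl | ⟨c, i, hz⟩
      · rw [← hg.go l l' hr h, ih]
      · obtain ⟨t', p', r', l'', -, -, k1, k2⟩ := hz.pass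
        rw [h] at k1; cases k1
        exact hg.port l'.rev _ (k2.lt_W hw) k2
  exact key _ hv

/-- Every place is visited by an edge, in one of the two directions. -/
theorem Diagram.visits_or (D : Diagram G) {w : LWord V E} (hD : w.toWord = D.word) {l : Loc}
    (hl : l.pos < W w l.level) : ∃ e, D.word.Visits e l ∨ D.word.Visits e l.rev := by
  obtain ⟨t, i, b⟩ := l
  obtain ⟨e, b', h⟩ := D.covered t i (by rwa [← hD, width_toWord])
  refine ⟨e, ?_⟩
  cases b <;> cases b' <;> simp [Loc.rev, h]

open Classical in
/-- A word that is equivalent to the word of a diagram is the word of a diagram. -/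
theorem Diagram.exists_of_eqv (D : Diagram G) {w w' : LWord V E} (hD : w.toWord = D.word)
    (hn : (ports (nodes w)).Nodup) (H : Eqv 0 w w') : ∃ D' : Diagram G, w'.toWord = D'.word := by
  obtain ⟨hw, ho⟩ := D.fits_word hD
  have hw' := H.fits_iff.1 hw
  have ho' : out 0 w' = 0 := H.out_eq ▸ ho
  have hc := H.classes_perm
  have hp := ports_perm hc
  have hs := separated_of_nodup hn
  have hs' := separated_of_nodup (hp.nodup_iff.1 hn)
  have hZ (h) : Z h w' [] = Z h w [] := (H.Op_eq h _ [] rfl).symm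
  have hZ' : ∀ h, 0 < Z h w' [] → 0 < Z h w [] := fun h => by rw [hZ]; exact id
  have hP (z : Port E) : (∃ l, Arrives w l z) ↔ ∃ l, Arrives w' l z := by
    rw [exists_arrives_iff, exists_arrives_iff, hp.mem_iff]
  have key {e : E} {l : Loc} (hl : w.toWord.Visits e l) {z : Port E} (hz : Arrives w l z) :=
    D.visits_port hD hs hw' ho' hs' hZ' (fun z => (hP z).1) hl hz
  refine ⟨⟨w'.toWord, (fits_iff w').1 hw', (closed_iff w').2 ho', ?_, ?_, fun e => ?_, ?_⟩, rfl⟩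
  · have := D.vertex_once
    rw [← hD, vertex_once_iff, verts_eq] at this
    rw [vertex_once_iff, verts_eq, ← (hc.filterMap _).nodup_iff]
    exact ⟨this.1, fun v => (hc.filterMap _).mem_iff.1 (this.2 v)⟩
  · have := D.legs_spec
    rw [← hD, legs_spec_iff] at this
    rw [legs_spec_iff]
    exact fun v legs h => this v legs (hc.mem_iff.2 h)
  · obtain ⟨es, l₀, h1, h2⟩ := D.traced e
    obtain ⟨m, h3, h4⟩ := h2.reaches
    rw [← hD] at h1 h3 h4
    obtain ⟨m', h5, l₀', h6, h7⟩ := key ⟨l₀, h1, h3⟩ (.half h4)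
    cases h5 with
    | half h5 =>
      obtain ⟨es, h8⟩ := h7.walk h5
      exact ⟨es, l₀', h6, h8⟩
  · intro t i hi
    rw [width_toWord] at hi
    by_contra hne
    push Not at hne
    let P (t i : ℕ) : Prop := ∃ e b, w'.toWord.Visits e ⟨t, i, b⟩
    have hPl (l : Loc) : P l.level l.pos ↔ ∃ e, w'.toWord.Visits e l ∨ w'.toWord.Visits e l.rev := by
      obtain ⟨t, i, b⟩ := l
      simp only [P, Bool.exists_bool]
      cases b <;> simp [Loc.rev, or_comm]
    have step {l l' : Loc} (h : w'.toWord.next l = .go l' []) (hl : P l.level l.pos) :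
        P l'.level l'.pos := by
      rw [hPl] at hl ⊢
      obtain ⟨e, hl | hl⟩ := hl
      · exact ⟨e, .inl (hl.step h)⟩
      · exact ⟨e, .inr (hl.back h)⟩
    -- The unvisited places of `w'` are coloured black. They form whole strands without ports, that
    -- is, circles, so this is a colouring with white ports. The count for `D` is at most 1 and is
    -- the same for `w'`, hence nothing is black.
    have hv : Valid w' (fun _ => false) fun t i => !decide (P t i) := by
      refine ⟨fun l l' _ h => ?_, fun l z hl hz => ?_⟩
      · congr 1
        exact decide_eq_decide.2 ⟨step h, step (l := l'.rev) (l' := l.rev) (Word.next_rev _ h)⟩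
      · simp only [Bool.not_eq_false', decide_eq_true_iff]
        obtain ⟨l₁, h1⟩ := (hP z).2 ⟨l, hz⟩
        obtain ⟨e, h3⟩ := D.visits_or hD (h1.lt_W hw)
        rw [← hD] at h3
        rw [hPl]
        rcases h3 with h3 | h3
        · obtain ⟨l', h4, h5⟩ := key h3 h1
          rw [hs' _ _ _ hz h4]
          exact ⟨e, .inl h5⟩
        -- Here the edge is just leaving the port `z`, so `z` is the port found by the transfer, and
        -- the edge leaves it in `w'` as well.
        · obtain ⟨y, a, a', h4, h5, -, h6, h7⟩ :=
            D.visits_transfer hD hs hw' ho' hs' hZ' (fun z => (hP z).1) h3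
          rcases h5.rev_cases with rfl | ⟨m, h8, -⟩
          · rw [Loc.rev_rev] at h4
            rw [h4.det h1] at h6
            rw [← hs' _ _ _ h6 hz, Loc.rev_rev]
            exact ⟨e, .inr h7⟩
          · exact (h1.not_go h8).elim
    have := hv.eq_false hw' ho' (by rw [hZ]; exact D.Z_le_one hD) hi
    simp only [Bool.not_eq_false', decide_eq_true_iff] at this
    obtain ⟨e, b, h⟩ := this
    exact hne e b h

/-! ### From equivalent words to virtually equivalent diagrams -/

theorem Diagram.eq_of_word_eq {D D' : Diagram G} (h : D.word = D'.word) : D = D' := by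
  cases D; cases D'; cases h; rfl

theorem Step.move {n : ℕ} {w w' : LWord V E} (h : Step n w w') :
    ∃ a b L R : Word V E, (PlanarMove L R ∨ ClassicalMove L R ∨ VirtualMove L R) ∧
      w.toWord = a ++ L ++ b ∧ w'.toWord = a ++ R ++ b := by
  induction h with
  | @rule n L R b h _ _ =>
    exact ⟨[], b.toWord, L.toWord, R.toWord, h.move.imp_right .inr, by simp [LWord.toWord],
      by simp [LWord.toWord]⟩
  | @cons n s w w' _ _ ih =>
    obtain ⟨a, b, L, R, h, h1, h2⟩ := ih
    refine ⟨s.toSlice :: a, b, L, R, h, ?_, ?_⟩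
    · simpa [LWord.toWord] using h1
    · simpa [LWord.toWord] using h2

/-- The words between `w` and `w'` are diagrams of the graph by `exists_of_eqv`. The distinctness of
the ports, which that needs, is carried along since equivalences permute the ports. -/
theorem Eqv.virtuallyEquivalent {w w' : LWord V E} (H : Eqv 0 w w')
    (hn : (ports (nodes w)).Nodup) (D D' : Diagram G) (hD : w.toWord = D.word)
    (hD' : w'.toWord = D'.word) : VirtuallyEquivalent D D' := by
  induction H generalizing D D' with
  | rel w w' h =>
    refine .rel _ _ ?_
    rw [Diagram.Move, ← hD, ← hD']
    exact h.move
  | refl w =>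
    rw [Diagram.eq_of_word_eq (hD.symm.trans hD')]
    exact .refl _
  | symm w w' h ih =>
    refine .symm _ _ (ih ?_ D' D hD' hD)
    exact ((ports_perm (Eqv.classes_perm h)).nodup_iff).2 hn
  | trans w w' w'' h h' ih ih' =>
    obtain ⟨D'', hD''⟩ := D.exists_of_eqv hD hn h
    exact .trans _ _ _ (ih hn D D'' hD hD'')
      (ih' ((ports_perm (Eqv.classes_perm h)).nodup_iff.1 hn) D'' D' hD'' hD')

/-! ### The labelled word of a diagram -/

open Classical in
/-- The event in slice `t` of a diagram, where a crossing gets the name `c` and the upper strand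
enters it through the end `0`. -/
noncomputable def Diagram.labelEvent (D : Diagram G) (c t p : ℕ) : Event V E → LEvent V E
  | .cup => .cup
  | .cap => .cap
  | .cross .slash => .cross c (if ∃ e, D.word.Visits e ⟨t, p, true⟩ then 0 else 2)
  | .cross .backslash => .cross c (if ∃ e, D.word.Visits e ⟨t, p + 1, true⟩ then 1 else 3)
  | .cross .virtual => .virt
  | .vertex v legs => .vertex v legs

/-- The word of a diagram, where the crossing in slice `t` gets the name `σ t`. -/
noncomputable def Diagram.label (D : Diagram G) (σ : ℕ → ℕ) : LWord V E :=
  D.word.mapIdx fun t s => ⟨s.pos, D.labelEvent (σ t) t s.pos s.ev⟩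

theorem Diagram.label_getElem? (D : Diagram G) (σ : ℕ → ℕ) (t : ℕ) :
    (D.label σ)[t]? = D.word[t]?.map fun s => ⟨s.pos, D.labelEvent (σ t) t s.pos s.ev⟩ := by
  simp [label, List.getElem?_mapIdx]

theorem Diagram.toEvent_labelEvent (D : Diagram G) (c t p : ℕ) (x : Event V E) :
    (D.labelEvent c t p x).toEvent = x := by
  obtain _ | _ | (_ | _ | _) | _ := x <;> simp only [labelEvent, LEvent.toEvent]
  · split_ifs <;> rfl
  · split_ifs <;> rfl

theorem Diagram.toWord_label (D : Diagram G) (σ : ℕ → ℕ) : (D.label σ).toWord = D.word := by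
  refine List.ext_getElem? fun t => ?_
  rw [toWord_getElem?, label_getElem?, Option.map_map]
  cases D.word[t]? with
  | none => rfl
  | some s => simp [LSlice.toSlice, D.toEvent_labelEvent]

theorem Diagram.label_cross (D : Diagram G) {σ : ℕ → ℕ} {t p c : ℕ} {r : Fin 4}
    (h : (D.label σ)[t]? = some ⟨p, .cross c r⟩) : c = σ t := by
  rw [label_getElem?] at h
  obtain ⟨⟨p', x⟩, -, h⟩ := Option.map_eq_some_iff.1 h
  obtain _ | _ | (_ | _ | _) | _ := x <;> simp [labelEvent] at h <;> exact h.2.1.symm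

/-- The number of the end through which a crossing is entered. -/
def entry (o s : Bool) : Fin 4 := if o then 0 else if s then 3 else 1

/-- The ends are numbered clockwise and the upper strand runs from `0` to `2`. At a positive
crossing the lower strand is directed to the left of the upper one, so it enters through `3`,
otherwise through `1`. Over/under information and sign thus determine the end of entry. -/
theorem Diagram.entry_eq (D : Diagram G) {σ : ℕ → ℕ} {e : E} {t p c : ℕ} {r k : Fin 4}
    (h : (D.label σ)[t]? = some ⟨p, .cross c r⟩) (hv : D.word.Visits e (corner t p k)) :
    r + k = entry (decide ((r + k).val % 2 = 0)) (D.sign t) := by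
  classical
  have hvl : k = 0 → ∃ e, D.word.Visits e ⟨t, p, true⟩ := by rintro rfl; exact ⟨e, hv⟩
  have hvr : k = 3 → ∃ e, D.word.Visits e ⟨t, p + 1, true⟩ := by rintro rfl; exact ⟨e, hv⟩
  have hn (k) := next_corner h k
  rw [D.toWord_label] at hn
  -- A strand passing the crossing downwards is not passed upwards by any edge. Hence the visits
  -- upwards at the two lower ends, which define the sign and the numbering, are decided by the
  -- direction of the given edge.
  have hvl' : k = 2 → ¬ ∃ e, D.word.Visits e ⟨t, p, true⟩ := by
    rintro rfl ⟨e', h'⟩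
    exact D.not_visits_rev hv (h'.step (hn 0))
  have hvr' : k = 1 → ¬ ∃ e, D.word.Visits e ⟨t, p + 1, true⟩ := by
    rintro rfl ⟨e', h'⟩
    exact D.not_visits_rev hv (h'.step (hn 3))
  rw [label_getElem?] at h
  obtain ⟨⟨p', x⟩, hx, h⟩ := Option.map_eq_some_iff.1 h
  obtain _ | _ | (_ | _ | _) | _ := x <;> simp [labelEvent] at h
  all_goals
    obtain ⟨rfl, -, rfl⟩ := h
    simp only [sign, hx]
    by_cases h1 : ∃ e, D.word.Visits e ⟨t, p', true⟩ <;>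
    by_cases h2 : ∃ e, D.word.Visits e ⟨t, p' + 1, true⟩ <;>
    simp only [h1, h2, if_true, if_false] <;>
    fin_cases k <;> simp [h1, h2] at hvl hvr hvl' hvr' <;> simp [entry]

/-! ### The colourings of a diagram and its Gauss code -/

/-- Ports which follow each other along an edge have the same colour; the edge leads from `x` to
`y`, entering crossings through the ports `L`. -/
def Linked (h : Port E → Bool) (x y : Port E) : List (ℕ × Fin 4) → Prop
  | [] => h x = h y
  | z :: L => h x = h (.inr z) ∧ Linked h (.inr (z.1, z.2 + 2)) y L

/-- The port through which a crossing is entered. -/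
noncomputable def Diagram.entryPort (D : Diagram G) (σ : ℕ → ℕ) (x : ℕ × Bool) : ℕ × Fin 4 :=
  (σ x.1, entry x.2 (D.sign x.1))

theorem Diagram.go_cases (D : Diagram G) (σ : ℕ → ℕ) {e : E} {l l' : Loc} {es : List (ℕ × Bool)}
    (hv : D.word.Visits e l) (hl : D.word.next l = .go l' es) :
    es = [] ∨ ∃ x, es = [x] ∧ Arrives (D.label σ) l (.inr (D.entryPort σ x)) ∧
      Arrives (D.label σ) l'.rev (.inr ((D.entryPort σ x).1, (D.entryPort σ x).2 + 2)) := by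
  have hD := D.toWord_label σ
  obtain ⟨hw, ho⟩ := D.fits_word hD
  have hlt : l.pos < W (D.label σ) l.level := Visits.lt_W hw ho (e := e) (by rwa [hD])
  rcases VirtualGraph.go_cases hw ho hlt (hD ▸ hl) with rfl | ⟨c, i, hz⟩
  · exact .inl rfl
  · right
    obtain ⟨t, p, r, l', h1, rfl, h2, h3⟩ := hz.pass
    rw [hD, hl] at h2
    cases h2
    have hi := D.entry_eq h1 hv
    rw [add_sub_cancel] at hi
    have : D.entryPort σ (t, decide (i.val % 2 = 0)) = (c, i) := by
      rw [entryPort, ← hi, D.label_cross h1]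
    exact ⟨_, rfl, by rwa [this], by rwa [this]⟩

theorem Diagram.linked_of_valid (D : Diagram G) (σ : ℕ → ℕ) {h : Port E → Bool} {g : ℕ → ℕ → Bool}
    (H : Valid (D.label σ) h g) {e : E} {l : Loc} {es : List (ℕ × Bool)} {h' : HalfEdge E}
    (hw : D.word.Walk l es h') (hv : D.word.Visits e l) {x : Port E}
    (hx : h x = g l.level l.pos) : Linked h x (.inl h') (es.map (D.entryPort σ)) := by
  have hD := D.toWord_label σ
  obtain ⟨hf, ho⟩ := D.fits_word hD
  have hlt {l : Loc} (hv : D.word.Visits e l) : l.pos < W (D.label σ) l.level :=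
    Visits.lt_W hf ho (e := e) (by rwa [hD])
  induction hw generalizing x with
  | arrive hl => exact hx.trans (H.port _ _ (hlt hv) (.half (hD ▸ hl)))
  | go hl _ ih =>
    rcases D.go_cases σ hv hl with rfl | ⟨y, rfl, h1, h2⟩
    · exact ih (hv.step hl) (hx.trans (H.go _ _ (hlt hv) (hD ▸ hl)))
    · refine ⟨hx.trans (H.port _ _ (hlt hv) h1), ih (hv.step hl) ?_⟩
      have hr := hlt (hv.step hl)
      exact (H.port (Loc.rev _) _ hr h2).symm

/-- Along the edge, the part of the chain `Linked` that is still ahead is kept, together with the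
port from which the current strand started. -/
theorem Diagram.linked_of_reaches (D : Diagram G) (σ : ℕ → ℕ) {h : Port E → Bool} {e : E}
    {l₀ l : Loc} {es : List (ℕ × Bool)} (h0 : D.word.IsStart (e, false) l₀)
    (hw : D.word.Walk l₀ es (e, true))
    (H : Linked h (.inl (e, false)) (.inl (e, true)) (es.map (D.entryPort σ)))
    (hl : D.word.Reaches l₀ l) :
    ∃ x a es', Arrives (D.label σ) a.rev x ∧ Cut (D.label σ) a l ∧ D.word.Walk l es' (e, true) ∧
      Linked h x (.inl (e, true)) (es'.map (D.entryPort σ)) := by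
  have hD := D.toWord_label σ
  induction hl with
  | refl => exact ⟨_, l₀, es, arrives_of_isStart (hD.symm ▸ h0), .refl, hw, H⟩
  | @tail l l' h2 h3 ih =>
    obtain ⟨es₁, h3⟩ := h3
    obtain ⟨x, a, es', h4, h5, h6, h7⟩ := ih
    cases h6 with
    | arrive h6 => rw [h3] at h6; cases h6
    | go h6 h8 =>
      rw [h3] at h6; cases h6
      rcases D.go_cases σ ⟨l₀, h0, h2⟩ h3 with rfl | ⟨y, rfl, h9, h10⟩
      · exact ⟨x, a, _, h4, h5.tail (hD.symm ▸ h3), h8, h7⟩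
      · exact ⟨_, l', _, h10, .refl, h8, h7.2⟩

theorem Diagram.eq_of_joined (D : Diagram G) (σ : ℕ → ℕ) {h : Port E → Bool}
    (H : ∀ e, Linked h (.inl (e, false)) (.inl (e, true))
      ((D.traced e).choose.map (D.entryPort σ))) {x y : Port E} {a l : Loc} {e : E}
    (hx : Arrives (D.label σ) a.rev x) (hc : Cut (D.label σ) a l) (hy : Arrives (D.label σ) l y)
    (hv : D.word.Visits e l) : h x = h y := by
  have hD := D.toWord_label σ
  obtain ⟨l₀, h1, h2⟩ := hv
  obtain ⟨l₀', h1', hw⟩ := (D.traced e).choose_spec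
  obtain rfl := D.isStart_unique h1 h1'
  obtain ⟨x', a', es', h3, h4, h5, h6⟩ := D.linked_of_reaches σ h1 hw (H e) h2
  obtain rfl : x' = x := h4.rev.det h3 hc.rev hx
  cases h5 with
  | arrive h5 =>
    rw [hy.det (.half (hD.symm ▸ h5))]
    exact h6
  | go h5 h8 =>
    rcases D.go_cases σ ⟨l₀, h1, h2⟩ h5 with rfl | ⟨z, rfl, h9, -⟩
    · exact (hy.not_go (hD.symm ▸ h5)).elim
    · rw [hy.det h9]
      exact h6.1

/-- The bridge between colourings and Gauss codes. A colouring of the ports extends exactly when the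
two ends of each strand have equal colours. Every strand lies on an edge, so these conditions are
listed by walking along all edges, and each walk is recorded by the code. -/
theorem Diagram.Z_pos_iff (D : Diagram G) (σ : ℕ → ℕ) (h : Port E → Bool) :
    0 < Z h (D.label σ) [] ↔ ∀ e, Linked h (.inl (e, false)) (.inl (e, true))
      ((D.traced e).choose.map (D.entryPort σ)) := by
  have hD := D.toWord_label σ
  obtain ⟨hf, ho⟩ := D.fits_word hD
  constructor
  · intro hZ e
    obtain ⟨g, hg⟩ := exists_valid hf ho hZ
    obtain ⟨l₀, h1, h2⟩ := (D.traced e).choose_spec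
    refine D.linked_of_valid σ hg h2 ⟨l₀, h1, .refl⟩ ?_
    have := arrives_of_isStart (w := D.label σ) (hD.symm ▸ h1)
    exact (hg.port _ _ (this.lt_W hf) this).symm
  · intro H
    obtain ⟨g, hg⟩ := exists_valid_of_joined (w := D.label σ) h fun x y hx ⟨a, l, h1, h2, h3⟩ => by
      rw [← hx]
      obtain ⟨e, hv | hv⟩ := D.visits_or hD (h3.lt_W hf)
      · exact (D.eq_of_joined σ H h1 h2 h3 hv).symm
      -- The edge runs along this strand from `y` to `x`, so the strand is read backwards.
      · have hva : D.word.Visits e a.rev := by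
          obtain ⟨l₀, h4, h5⟩ := hv
          have := h2.rev
          exact ⟨l₀, h4, h5.trans (Relation.ReflTransGen.mono (fun _ _ h => ⟨_, hD ▸ h⟩) _ _ this)⟩
        exact D.eq_of_joined σ H (by rwa [Loc.rev_rev]) h2.rev h1 hva
    exact hg.Z_pos hf ho

/-! ### Diagrams with the same Gauss code -/

/-- The name of a crossing or of a vertex. -/
def Node.key : Node V E → ℕ ⊕ V
  | cross c _ => .inl c
  | vertex v _ => .inr v

theorem classes_nodup {B : List (Node V E)} (h : (B.map Node.key).Nodup) : (classes B).Nodup := by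
  have : B.map Node.key = (classes B).map (Sum.map id Prod.fst) := by
    rw [classes, List.map_map]
    exact List.map_congr_left fun b _ => by cases b <;> rfl
  rw [this] at h
  exact h.of_map

theorem Diagram.legs_of_mem_nodes (D : Diagram G) {w : LWord V E} (hD : w.toWord = D.word) {v : V}
    {legs : List (HalfEdge E)} (h : Node.vertex v legs ∈ nodes w) :
    ∃ t p : ℕ, D.word[t]? = some ⟨p, .vertex v legs⟩ := by
  obtain ⟨⟨p, x⟩, hs, hx⟩ := List.mem_filterMap.1 h
  cases x <;> simp [LEvent.node] at hx
  obtain ⟨rfl, rfl⟩ := hx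
  obtain ⟨t, ht⟩ := List.mem_iff_getElem?.1 hs
  exact ⟨t, p, by rw [← hD, toWord_vertex_iff, ht]⟩

theorem Diagram.legs_unique (D : Diagram G) {t t' p p' : ℕ} {v : V} {legs legs' : List (HalfEdge E)}
    (h : D.word[t]? = some ⟨p, .vertex v legs⟩) (h' : D.word[t']? = some ⟨p', .vertex v legs'⟩) :
    legs = legs' := by
  obtain rfl := (D.vertex_once _).unique ⟨_, _, h⟩ ⟨_, _, h'⟩
  rw [h] at h'
  cases h'; rfl

/-- A half-edge determines its vertex in the graph, so different nodes share no half-edge. The ends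
of different crossings are told apart by the names. -/
theorem Diagram.ports_nodup (D : Diagram G) {w : LWord V E} (hD : w.toWord = D.word)
    (h : ((nodes w).map Node.key).Nodup) : (ports (nodes w)).Nodup := by
  rw [ports, List.nodup_flatMap, List.pairwise_reverse]
  have spec {v : V} {legs : List (HalfEdge E)} (hb : Node.vertex v legs ∈ nodes w) :
      legs.Nodup ∧ ∀ h, h ∈ legs ↔ G.vert h = v := by
    obtain ⟨t, p, ht⟩ := D.legs_of_mem_nodes hD hb
    exact D.legs_spec _ _ _ _ ht
  refine ⟨fun b hb => ?_, ?_⟩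
  · rw [List.mem_reverse] at hb
    cases b with
    | cross c r => simp [Node.ports]
    | vertex v legs => exact (spec hb).1.map Sum.inl_injective
  · rw [List.Nodup, List.pairwise_map] at h
    refine h.imp_of_mem fun {b b'} hb hb' hne => ?_
    rintro (h' | ⟨c, i⟩) hz' hz
    · cases b with
      | cross c r => simp [Node.ports] at hz
      | vertex v legs => cases b' with
        | cross c r => simp [Node.ports] at hz'
        | vertex v' legs' =>
          simp [Node.ports] at hz hz'
          refine hne (congrArg Sum.inr ?_)
          rw [← ((spec hb).2 h').1 hz, ← ((spec hb').2 h').1 hz']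
    · cases b with
      | vertex v legs => simp [Node.ports] at hz
      | cross d r => cases b' with
        | vertex v legs => simp [Node.ports] at hz'
        | cross d' r' =>
          refine hne (congrArg Sum.inl ?_)
          simp [Node.ports] at hz hz'
          have e : c = d := by tauto
          have e' : c = d' := by tauto
          exact e.symm.trans e'

theorem Diagram.label_keys_nodup (D : Diagram G) {σ : ℕ → ℕ} (hσ : σ.Injective) :
    ((nodes (D.label σ)).map Node.key).Nodup := by
  rw [List.Nodup, List.pairwise_map, nodes, List.pairwise_filterMap, List.pairwise_iff_getElem]
  intro t t' ht ht' hlt b hb b' hb' hne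
  have hs := List.getElem?_eq_getElem ht
  have hs' := List.getElem?_eq_getElem ht'
  generalize (D.label σ)[t] = s at hs hb
  generalize (D.label σ)[t'] = s' at hs' hb'
  obtain ⟨p, x⟩ := s
  obtain ⟨p', x'⟩ := s'
  cases x <;> simp [LEvent.node] at hb <;> subst hb <;> cases x' <;> simp [LEvent.node] at hb' <;>
    subst hb' <;> simp [Node.key] at hne
  · rw [D.label_cross hs, D.label_cross hs'] at hne
    exact hlt.ne (hσ hne)
  · subst hne
    rw [← toWord_vertex_iff, D.toWord_label] at hs hs'
    exact hlt.ne ((D.vertex_once _).unique ⟨_, _, hs⟩ ⟨_, _, hs'⟩)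

theorem inl_mem_classes {w : LWord V E} {c : ℕ} :
    Sum.inl c ∈ classes (nodes w) ↔ ∃ l i, Arrives w l (.inr (c, i)) := by
  rw [exists_comm]
  simp only [exists_arrives_iff, classes, ports, List.mem_map, List.mem_flatMap, List.mem_reverse]
  constructor
  · rintro ⟨b, hb, h⟩
    cases b <;> simp [Node.class] at h
    subst h
    exact ⟨0, _, hb, Node.mem_ports_cross _ _ _⟩
  · rintro ⟨i, b, hb, hz⟩
    cases b <;> simp [Node.ports] at hz
    exact ⟨_, hb, by simp [Node.class]; tauto⟩

theorem Word.Walk.subset {w : Word V E} {l₀ l l' : Loc} {es es' : List (ℕ × Bool)}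
    {h : HalfEdge E} (H : w.Reaches l₀ l) (hw : w.Walk l₀ es h) (hl : w.next l = .go l' es') :
    es' ⊆ es := by
  induction H using Relation.ReflTransGen.head_induction_on generalizing es with
  | refl =>
    cases hw with
    | arrive h => rw [hl] at h; cases h
    | go h _ => rw [hl] at h; cases h; exact List.subset_append_left _ _
  | head h' _ ih =>
    obtain ⟨es₁, h'⟩ := h'
    cases hw with
    | arrive h => rw [h'] at h; cases h
    | go h k => rw [h'] at h; cases h; exact fun _ hx => List.subset_append_right _ _ (ih k hx)

theorem Diagram.mem_classes_of_walk (D : Diagram G) (σ : ℕ → ℕ) {e : E} {l : Loc}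
    {es : List (ℕ × Bool)} {h : HalfEdge E} (hw : D.word.Walk l es h) (hv : D.word.Visits e l)
    {x : ℕ × Bool} (hx : x ∈ es) : Sum.inl (σ x.1) ∈ classes (nodes (D.label σ)) := by
  induction hw with
  | arrive => simp at hx
  | go hl _ ih =>
    rcases D.go_cases σ hv hl with rfl | ⟨y, rfl, h1, -⟩
    · exact ih (hv.step hl) hx
    · rcases List.mem_cons.1 hx with rfl | hx
      · exact inl_mem_classes.2 ⟨_, _, h1⟩
      · exact ih (hv.step hl) hx

/-- No crossing escapes the code: some edge visits its strands by `covered`, and the walk along that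
edge records it. -/
theorem Diagram.inl_mem_classes_label (D : Diagram G) (σ : ℕ → ℕ) {c : ℕ} :
    Sum.inl c ∈ classes (nodes (D.label σ)) ↔ ∃ e, ∃ x ∈ D.gaussCode.along e, c = σ x.symbol := by
  have hD := D.toWord_label σ
  obtain ⟨hf, ho⟩ := D.fits_word hD
  simp only [gaussCode, List.mem_map]
  constructor
  · intro h
    obtain ⟨l, i, h⟩ := inl_mem_classes.1 h
    obtain ⟨t, p, r, l', h1, -, h2, -⟩ := h.pass
    rw [D.label_cross h1]
    rw [hD] at h2
    obtain ⟨e, hv⟩ := D.visits_or hD (h.lt_W hf)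
    obtain ⟨m, m', hm, hm'⟩ : ∃ m m', D.word.Visits e m ∧
        D.word.next m = .go m' [(t, decide (i.val % 2 = 0))] := by
      rcases hv with hv | hv
      · exact ⟨_, _, hv, h2⟩
      · exact ⟨_, _, hv.back h2, Word.next_rev _ h2⟩
    obtain ⟨l₀, h3, h4⟩ := hm
    obtain ⟨l₀', h3', h5⟩ := (D.traced e).choose_spec
    obtain rfl := D.isStart_unique h3 h3'
    exact ⟨e, _, ⟨_, h5.subset h4 hm' (List.mem_singleton.2 rfl), rfl⟩, rfl⟩
  · rintro ⟨e, _, ⟨x, hx, rfl⟩, rfl⟩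
    obtain ⟨l₀, h1, h2⟩ := (D.traced e).choose_spec
    exact D.mem_classes_of_walk σ h2 ⟨l₀, h1, .refl⟩ hx

theorem Diagram.inr_mem_classes_label (D : Diagram G) (σ : ℕ → ℕ) {v : V}
    {legs : Cycle (HalfEdge E)} :
    Sum.inr (v, legs) ∈ classes (nodes (D.label σ)) ↔ legs = D.gaussCode.order v := by
  have hD := D.toWord_label σ
  have hc := (D.vertex_once v).exists.choose_spec.choose_spec.choose_spec
  simp only [classes, List.mem_map]
  constructor
  · rintro ⟨b, hb, h⟩
    cases b <;> simp [Node.class] at h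
    obtain ⟨rfl, rfl⟩ := h
    obtain ⟨t, p, h⟩ := D.legs_of_mem_nodes hD hb
    exact congrArg _ (D.legs_unique h hc)
  · rintro rfl
    have key {t p : ℕ} {legs : List (HalfEdge E)} (h : D.word[t]? = some ⟨p, .vertex v legs⟩) :
        (D.label σ)[t]? = some ⟨p, .vertex v legs⟩ := by rwa [← toWord_vertex_iff, hD]
    exact ⟨.vertex v _, List.mem_filterMap.2 ⟨_, List.mem_of_getElem? (key hc), rfl⟩, rfl⟩

theorem Diagram.entryPorts_eq (D : Diagram G) (σ : ℕ → ℕ) (e : E) :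
    (D.traced e).choose.map (D.entryPort σ) =
      (D.gaussCode.along e).map fun x => (σ x.symbol, entry x.isOver x.positive) := by
  simp [gaussCode, entryPort, Function.comp_def]

/-- Diagrams with the same Gauss code are virtually equivalent. -/
theorem virtuallyEquivalent_of_same (D D' : Diagram G) (h : D'.gaussCode.Same D.gaussCode) :
    VirtuallyEquivalent D D' := by
  obtain ⟨⟨σ, hσ⟩, ho⟩ := h
  -- The permutation `σ` renames the crossings of `D'` as those of `D`. Labelling `D'` by `σ` and
  -- `D` by the identity gives the two words the same ports.
  have hD := D.toWord_label id
  have hD' := D'.toWord_label σ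
  obtain ⟨hf, hc⟩ := D.fits_word hD
  obtain ⟨hf', hc'⟩ := D'.fits_word hD'
  have hk := D.label_keys_nodup Function.injective_id
  have hk' := D'.label_keys_nodup σ.injective
  have hn := D.ports_nodup hD hk
  have hperm : (classes (nodes (D'.label σ))).Perm (classes (nodes (D.label id))) := by
    refine (List.perm_ext_iff_of_nodup (classes_nodup hk') (classes_nodup hk)).2 fun x => ?_
    obtain c | ⟨v, legs⟩ := x
    · simp [Diagram.inl_mem_classes_label, hσ]
    · rw [Diagram.inr_mem_classes_label, Diagram.inr_mem_classes_label, ho]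
  obtain ⟨C, h1, h2⟩ := exists_turn hperm
  have hZ := D.Z_le_one hD
  have hZ' := D'.Z_le_one hD'
  obtain ⟨c, g1, g2, g3⟩ := normal_of_Z_le _ hf hc hZ
  obtain ⟨c', g1', g2', g3'⟩ := Normal.turn hf' hc' hZ' h2 (A := []) <|
    Normal.perm hf' hc' hZ' h1 (A := []) <| normal_of_Z_le _ hf' hc' hZ'
  simp only [List.nil_append] at g3'
  -- Both normal forms now have the same boxes. Equal codes allow the same port colourings by
  -- `Z_pos_iff`, and therefore the pairings coincide.
  have hcc : c = c' := by
    refine normal_unique hn g1 g1' (by simpa using g2) (by simpa using g2') fun h => ?_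
    rw [Z, Z, ← g3.Op_eq h _ [] rfl, ← g3'.Op_eq h _ [] rfl]
    refine (D.Z_pos_iff id h).trans (Iff.trans (forall_congr' fun e => ?_) (D'.Z_pos_iff σ h).symm)
    rw [Diagram.entryPorts_eq, Diagram.entryPorts_eq, hσ, List.map_map]
    rfl
  subst hcc
  exact (g3.trans g3'.symm).virtuallyEquivalent hn D D' hD hD'

end VirtualGraph

/-- A virtual graph diagram with a realizable Gauss code is virtually equivalent to a classical
graph diagram. -/
theorem corollaryC {V E : Type*} (G : VirtualGraph.DirectedGraph V E)
    (D : VirtualGraph.Diagram G) (hD : D.gaussCode.Realizable G) :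
    ∃ D' : VirtualGraph.Diagram G, D'.IsClassical ∧ VirtualGraph.VirtuallyEquivalent D D' := by
  obtain ⟨D', h, h'⟩ := hD
  exact ⟨D', h, VirtualGraph.virtuallyEquivalent_of_same D D' h'⟩
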